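/- Let $\alpha\colon\mathbb N\to\mathbb C$ be a Steinhaus random multiplicative function: the values $\alpha(p)$, $p$ prime, are i.i.d. random variables uniformly distributed on the unit circle, and $\alpha(n)=\prod_p\alpha(p)^{a_p}$ for $n=\prod_p p^{a_p}$. For $\theta\in\mathbb C$ let $\mathbf P_\theta$ be the class of functions $g\colon\mathbb N\to\mathbb C$ such that $\mathcal E_g(t):=\sum_{p\le t}g(p)-\theta\,\frac{t}{\log t}$ satisfies $\mathcal E_g(t)=o(t/\log t)$ as $t\to\infty$ and $\int_2^\infty t^{-2}|\mathcal E_g(t)|\,dt<\infty$. Let $\theta\in(0,\tfrac12)$, and let $f\colon\mathbb N\to\mathbb C$ be multiplicative ($f(nm)=f(n)f(m)$ for coprime $n,m$) with $|f|^2\in\mathbf P_\theta$ and $$\sum_p\Big(\frac{|f(p)|^3}{p^{3/2}}+\frac{|f(p^2)|^2}{p^2}+\sum_{k\ge3}\frac{|f(p^k)|^2}{p^{k/2}}\Big)<\infty .$$ Put $\sigma_t=\frac12\big(1+\frac1{\log t}\big)$ for $t>1$, $\sigma_\infty=\frac12$, let $$A_y(s)=\prod_{p\le y}\Big(1+\sum_{k\ge1}\frac{\alpha(p)^kf(p^k)}{p^{ks}}\Big),\qquad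 A_\infty(s)=\lim_{y\to\infty}A_y(s),$$ and define the random measures on $\mathbb R$ $$m_{y,t}(ds)=\frac{|A_y(\sigma_t+is)|^2}{\mathbb E\big[|A_y(\sigma_t+is)|^2\big]}\,ds ,$$ where $y=\infty$ or $t=\infty$ is allowed, but not both. (For all $t>1$ and $s\in\mathbb R$ the limit defining $A_\infty(\sigma_t+is)$ exists almost surely.) Then there exists a random Radon measure $m_\infty(ds)$ on $\mathbb R$, nontrivial (almost surely nonzero), such that for every bounded interval $I$ and every bounded continuous function $h\colon I\to\mathbb R$, writing $m(h)=\int_I h\,dm$, the random variables $m_{y,\infty}(h)$ ($y\in\mathbb R$), $m_{\infty,t}(h)$ ($t>1$) and $m_\infty(h)$ are in $L^2$, and $$\text{(i)}\quad m_{y,\infty}(h)\xrightarrow[y\to\infty]{L^2}m_\infty(h)\qquad\text{and}\qquad\text{(ii)}\quad m_{\infty,t}(h)\xrightarrow[t\to\infty]{L^2}m_\infty(h);$$ in particular both convergences also hold in probability. Moreover, almost surely the support of $m_\infty$ is all of $\mathbb R$. -/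

import Mathlib

open MeasureTheory ProbabilityTheory Filter Topology Asymptotics
open scoped ENNReal

noncomputable section

namespace RandomEuler

/-- Multiplicative functions: `f (n m) = f n * f m` whenever `n`, `m` are coprime. -/
def IsMultiplicative (f : ℕ → ℂ) : Prop :=
  ∀ n m : ℕ, n.Coprime m → f (n * m) = f n * f m

/-- The error `E_g(t) = ∑_{p ≤ t} g(p) - θ t / log t`. -/
def primeSumError (θ : ℂ) (g : ℕ → ℂ) (t : ℝ) : ℂ :=
  ∑ p ∈ Finset.Iic ⌊t⌋₊ with p.Prime, g p - θ * ((t / Real.log t : ℝ) : ℂ)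

/-- The class `P_θ`: `E_g(t) = o(t / log t)` and `∫_2^∞ |E_g(t)| / t ^ 2 dt < ∞`. -/
def ClassP (θ : ℂ) (g : ℕ → ℂ) : Prop :=
  primeSumError θ g =o[atTop] (fun t : ℝ => t / Real.log t) ∧
    IntegrableOn (fun t : ℝ => ‖primeSumError θ g t‖ / t ^ 2) (Set.Ioi 2)

/-- `∑_p (|f(p)|^3 / p^(3/2) + |f(p^2)|^2 / p^2 + ∑_{k ≥ 3} |f(p^k)|^2 / p^(k/2)) < ∞`,
the sums being taken in `[0, ∞]`. -/
def SummabilityCondition (f : ℕ → ℂ) : Prop :=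
  ∑' p : Nat.Primes,
    (ENNReal.ofReal (‖f p‖ ^ 3 / ((p : ℕ) : ℝ) ^ (3 / 2 : ℝ))
      + ENNReal.ofReal (‖f ((p : ℕ) ^ 2)‖ ^ 2 / ((p : ℕ) : ℝ) ^ 2)
      + ∑' k : ℕ, ENNReal.ofReal
          (‖f ((p : ℕ) ^ (k + 3))‖ ^ 2 / ((p : ℕ) : ℝ) ^ (((k : ℝ) + 3) / 2))) < ∞

/-- The uniform distribution on the unit circle of `ℂ`: the law of `exp (2 π i U)` with `U`
uniform on `(0, 1]`. -/
def uniformCircle : Measure ℂ :=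
  (volume.restrict (Set.Ioc (0 : ℝ) 1)).map
    (fun u : ℝ => Complex.exp (2 * Real.pi * u * Complex.I))

variable {Ω : Type*} [MeasurableSpace Ω]

/-- A Steinhaus random multiplicative function: the `α(p)`, `p` prime, are i.i.d. uniform on the
unit circle, and `α(n) = ∏_p α(p)^(a_p)` for `n = ∏_p p^(a_p)`. -/
structure IsSteinhaus (P : Measure Ω) (α : ℕ → Ω → ℂ) : Prop where
  measurable : ∀ p : ℕ, p.Prime → Measurable (α p)
  law : ∀ p : ℕ, p.Prime → P.map (α p) = uniformCircle
  indep : iIndepFun (fun p : Nat.Primes => α p) P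
  mult : ∀ n : ℕ, n ≠ 0 → ∀ ω, α n ω = n.factorization.prod (fun p k => α p ω ^ k)

/-- The Euler factor `1 + ∑_{k ≥ 1} α(p)^k f(p^k) / p^(k s)`. -/
def eulerFactor (f : ℕ → ℂ) (α : ℕ → Ω → ℂ) (p : ℕ) (s : ℂ) (ω : Ω) : ℂ :=
  1 + ∑' k : ℕ, α p ω ^ (k + 1) * f (p ^ (k + 1)) / (p : ℂ) ^ (((k : ℂ) + 1) * s)

/-- The random Euler product `A_y(s)` over the primes `p ≤ y`. For `y = ∞` it is the limit of the
finite products. -/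
def eulerProduct (f : ℕ → ℂ) (α : ℕ → Ω → ℂ) : WithTop ℝ → ℂ → Ω → ℂ
  | (y : ℝ), s, ω => ∏ p ∈ Finset.Iic ⌊y⌋₊ with p.Prime, eulerFactor f α p s ω
  | ⊤, s, ω => limUnder atTop
      (fun N : ℕ => ∏ p ∈ Finset.Iic N with p.Prime, eulerFactor f α p s ω)

/-- `σ_t = (1 + 1 / log t) / 2`, and `σ_∞ = 1 / 2`. -/
def sigma : WithTop ℝ → ℝ
  | (t : ℝ) => (1 / 2) * (1 + 1 / Real.log t)
  | ⊤ => 1 / 2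

/-- The random measure
`m_{y,t}(ds) = |A_y(σ_t + i s)|^2 / E[|A_y(σ_t + i s)|^2] ds`, for `y, t ≤ ∞`. -/
def eulerMeasure (P : Measure Ω) (f : ℕ → ℂ) (α : ℕ → Ω → ℂ) (y t : WithTop ℝ) (ω : Ω) :
    Measure ℝ :=
  volume.withDensity (fun s : ℝ => ENNReal.ofReal
    (‖eulerProduct f α y ((sigma t : ℂ) + s * Complex.I) ω‖ ^ 2 /
      ∫ ω', ‖eulerProduct f α y ((sigma t : ℂ) + s * Complex.I) ω'‖ ^ 2 ∂P))

end RandomEuler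

end

/-! ### Products of independent mean-one fields and the moments of their masses -/

noncomputable section

namespace RandomEuler

variable {Ω E : Type*} [MeasurableSpace Ω] [MeasurableSpace E]

/-! Enumerate the primes as p_0 < p_1 < … and put τ = 1 / log t, with τ = 0 for the critical line.
Both families of measures come from one array of independent factors: the k-th field is |F_k|² /
E|F_k|², where F_k is the Euler factor of p_k on the line of real part (1 + τ) / 2. Each field is
nonnegative with mean one at every point. The density of m_{y,∞} is a finite product of fields at τ
= 0, that of m_{∞,t} an infinite product at τ > 0. For fixed τ the mass of a test function is a
martingale in the number of primes, and the limit is a multiplicative chaos in the L² regime.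

Everything rests on two-point correlations. For α(p) uniform on the circle all positive moments
vanish, so one field has correlation 1 + 2 cos((s - s') log p) |f(p)|² / p^(1+τ) + O(A³ + r²), where
A and r majorise the first coefficient of the Euler factor and the sum of the later ones
(`IsCentered.abs_corr_sub_le`); the errors are summable over the primes. Abel summation with the
hypothesis |f|² ∈ P_θ bounds the sums of cos(u log p) |f(p)|² / p by θ log(1/|u|) + O(1) and makes
their tails vanish for u ≠ 0. The damping p^(-τ) decreases in p, so Abel's inequality gives the same
bounds for all τ at once. Hence correlations are dominated on bounded sets by a multiple of |s -
s'|^(-2θ) and tail correlations tend to one off the diagonal, both uniformly in τ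
(`hasCorrBound_eulerField`). As 2θ < 1 this kernel is locally integrable, and dominated convergence
makes the masses Cauchy in L², uniformly in τ (`HasCorrBound.tendsto_eLpNorm_sub`).

At τ = 0 this gives the limiting masses and (i). For (ii), the infinite product at τ > 0 is an L²
limit of finite ones (`SummabilityCondition.isLimitField`); its mass is close, uniformly in τ, to
the mass with n factors, which is continuous in τ, so the limits n → ∞ and τ → 0 may be exchanged
(`HasCorrBound.tendsto_limitField`).

The limits of masses are realised by a measure (`HasCorrBound.exists_limitMeasure`): on a bounded
interval the limits for rational half-lines form, after normalisation, a distribution function; a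
π-λ argument and L¹ density extend the convergence to test functions, and unit intervals are glued.

Positivity (`HasCorrBound.limit_pos`) needs no zero-one law. The mass built from the factors beyond
n alone is concentrated near its mean for large n, and the first n factors are almost surely nonzero
at each point, because an Euler factor is a power series of radius larger than one and so has
finitely many zeros on the circle. The limiting mass therefore vanishes only with arbitrarily small
probability. Positivity on all rational intervals gives full support, hence nontriviality. -/

/-- A sequence of independent nonnegative bounded random fields on `ℝ` with pointwise mean one. -/
structure IsUnitField (P : Measure Ω) (γ : ℕ → Ω → E) (ψ : ℕ → ℝ → E → ℝ) : Prop where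
  indep : iIndepFun γ P
  meas_var : ∀ k, Measurable (γ k)
  meas : ∀ k, Measurable (Function.uncurry (ψ k))
  nonneg : ∀ k s z, 0 ≤ ψ k s z
  bdd : ∀ k, ∃ B, ∀ s z, ψ k s z ≤ B
  mean : ∀ k s, ∫ ω, ψ k s (γ k ω) ∂P = 1

/-- The product of the first `n` fields. -/
def partialField (γ : ℕ → Ω → E) (ψ : ℕ → ℝ → E → ℝ) (n : ℕ) (s : ℝ) (ω : Ω) : ℝ :=
  ∏ k ∈ Finset.range n, ψ k s (γ k ω)

/-- The integral of `g` against the density `partialField γ ψ n`. -/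
def partialMass (γ : ℕ → Ω → E) (ψ : ℕ → ℝ → E → ℝ) (n : ℕ) (g : ℝ → ℝ) (ω : Ω) : ℝ :=
  ∫ s, g s * partialField γ ψ n s ω

/-- The two-point correlation of the `k`-th field. -/
def factorCorr (P : Measure Ω) (γ : ℕ → Ω → E) (ψ : ℕ → ℝ → E → ℝ) (k : ℕ) (s s' : ℝ) : ℝ :=
  ∫ ω, ψ k s (γ k ω) * ψ k s' (γ k ω) ∂P

/-- The two-point correlation of the product of the fields with index in `[n, m)`. -/
def blockCorr (P : Measure Ω) (γ : ℕ → Ω → E) (ψ : ℕ → ℝ → E → ℝ) (n m : ℕ) (s s' : ℝ) : ℝ :=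
  ∏ k ∈ Finset.Ico n m, factorCorr P γ ψ k s s'

theorem integral_prod_range_comp {P : Measure Ω} {γ : ℕ → Ω → E} (h : iIndepFun γ P)
    (hγ : ∀ k, Measurable (γ k)) {φ : ℕ → E → ℝ} (hφ : ∀ k, Measurable (φ k)) (n : ℕ) :
    ∫ ω, ∏ k ∈ Finset.range n, φ k (γ k ω) ∂P
      = ∏ k ∈ Finset.range n, ∫ ω, φ k (γ k ω) ∂P := by
  have h1 : iIndepFun (fun i : Fin n => γ i) P := h.precomp Fin.val_injective
  have := h1.integral_fun_prod_comp (𝕜 := ℝ) (f := fun i : Fin n => φ i)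
    (fun i => (hγ i).aemeasurable)
    (fun i => (hφ i).aestronglyMeasurable)
  simpa [Finset.prod_range] using this

namespace IsUnitField

variable {P : Measure Ω} {γ : ℕ → Ω → E} {ψ : ℕ → ℝ → E → ℝ}

theorem isProbabilityMeasure (h : IsUnitField P γ ψ) : IsProbabilityMeasure P :=
  h.indep.isProbabilityMeasure

theorem shift (h : IsUnitField P γ ψ) (n : ℕ) :
    IsUnitField P (fun k => γ (n + k)) (fun k => ψ (n + k)) where
  indep := h.indep.precomp (add_right_injective n)
  meas_var _ := h.meas_var _
  meas _ := h.meas _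
  nonneg _ := h.nonneg _
  bdd _ := h.bdd _
  mean _ := h.mean _

theorem measurable_field (h : IsUnitField P γ ψ) (k : ℕ) :
    Measurable (fun x : ℝ × Ω => ψ k x.1 (γ k x.2)) :=
  (h.meas k).comp (measurable_fst.prodMk ((h.meas_var k).comp measurable_snd))

theorem measurable_partialField (h : IsUnitField P γ ψ) (n : ℕ) :
    Measurable (fun x : ℝ × Ω => partialField γ ψ n x.1 x.2) := by
  unfold partialField
  exact Finset.measurable_fun_prod _ (fun k _ => h.measurable_field k)

theorem partialField_nonneg (h : IsUnitField P γ ψ) (n : ℕ) (s : ℝ) (ω : Ω) :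
    0 ≤ partialField γ ψ n s ω :=
  Finset.prod_nonneg fun k _ => h.nonneg k _ _

theorem exists_partialField_le (h : IsUnitField P γ ψ) (n : ℕ) :
    ∃ B, 0 ≤ B ∧ ∀ s ω, partialField γ ψ n s ω ≤ B := by
  choose B hB using h.bdd
  have hP := h.isProbabilityMeasure
  -- A sample point is needed only to see that the bounds `B k` are nonnegative.
  obtain ⟨ω₀⟩ : Nonempty Ω := nonempty_of_isProbabilityMeasure P
  refine ⟨∏ k ∈ Finset.range n, B k, Finset.prod_nonneg fun k _ =>
    (h.nonneg k 0 (γ k ω₀)).trans (hB k _ _), fun s ω => ?_⟩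
  exact Finset.prod_le_prod (fun k _ => h.nonneg k _ _) (fun k _ => hB k _ _)

/-- By independence the expectation factorises over the fields. Those with index in [n, m) occur
only once and contribute their mean, which is one. -/
theorem integral_partialField_mul (h : IsUnitField P γ ψ) {n m : ℕ} (hnm : n ≤ m) (s s' : ℝ) :
    ∫ ω, partialField γ ψ m s ω * partialField γ ψ n s' ω ∂P = blockCorr P γ ψ 0 n s s' := by
  have hm : ∀ k s, Measurable (ψ k s) := fun k s => (h.meas k).comp measurable_prodMk_left
  have key := integral_prod_range_comp h.indep h.meas_var
    (φ := fun k z => ψ k s z * if k < n then ψ k s' z else 1)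
    (fun k => by
      by_cases hk : k < n
      · simp only [hk, if_true]; exact (hm k s).mul (hm k s')
      · simpa [hk] using hm k s) m
  have e1 : ∀ ω, partialField γ ψ m s ω * partialField γ ψ n s' ω
      = ∏ k ∈ Finset.range m, (ψ k s (γ k ω) * if k < n then ψ k s' (γ k ω) else 1) := by
    intro ω
    rw [Finset.prod_mul_distrib, ← Finset.prod_filter]
    congr 1
    unfold partialField
    apply Finset.prod_congr _ (fun _ _ => rfl)
    ext k; simp; omega
  simp_rw [e1, key, blockCorr, factorCorr]
  rw [← Finset.prod_subset (s₁ := Finset.Ico 0 n) (s₂ := Finset.range m)]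
  · refine Finset.prod_congr rfl fun k hk => ?_
    have : k < n := (Finset.mem_Ico.1 hk).2
    simp [this]
  · intro k; simp; omega
  · intro k _ hk
    have : ¬ k < n := by simpa using hk
    simp [this, h.mean]

theorem integral_partialField (h : IsUnitField P γ ψ) (n : ℕ) (s : ℝ) :
    ∫ ω, partialField γ ψ n s ω ∂P = 1 := by
  have := h.integral_partialField_mul (Nat.zero_le n) s s
  simpa [partialField, blockCorr] using this

theorem integrable_prod_partialField (h : IsUnitField P γ ψ) (n : ℕ) {g : ℝ → ℝ}
    (hg : Integrable g) :
    Integrable (fun x : ℝ × Ω => g x.1 * partialField γ ψ n x.1 x.2) (volume.prod P) := by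
  have hP := h.isProbabilityMeasure
  obtain ⟨B, hB0, hB⟩ := h.exists_partialField_le n
  refine (hg.comp_fst P).mul_bdd (c := B) (h.measurable_partialField n).aestronglyMeasurable
    (ae_of_all _ fun x => ?_)
  rw [Real.norm_of_nonneg (h.partialField_nonneg _ _ _)]
  exact hB _ _

theorem integrable_mul_partialField (h : IsUnitField P γ ψ) (n : ℕ) {g : ℝ → ℝ}
    (hg : Integrable g) (ω : Ω) : Integrable (fun s => g s * partialField γ ψ n s ω) := by
  obtain ⟨B, hB0, hB⟩ := h.exists_partialField_le n
  refine hg.mul_bdd (c := B) ?_ (ae_of_all _ fun x => ?_)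
  · exact ((h.measurable_partialField n).comp measurable_prodMk_right).aestronglyMeasurable
  · rw [Real.norm_of_nonneg (h.partialField_nonneg _ _ _)]
    exact hB _ _

theorem abs_partialMass_le (h : IsUnitField P γ ψ) (n : ℕ) :
    ∃ B, 0 ≤ B ∧ ∀ g : ℝ → ℝ, Integrable g → ∀ ω, |partialMass γ ψ n g ω| ≤ B * ∫ s, |g s| := by
  obtain ⟨B, hB0, hB⟩ := h.exists_partialField_le n
  refine ⟨B, hB0, fun g hg ω => ?_⟩
  rw [← integral_const_mul, ← Real.norm_eq_abs]
  refine norm_integral_le_of_norm_le (hg.abs.const_mul B) (ae_of_all _ fun s => ?_)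
  rw [norm_mul, Real.norm_of_nonneg (h.partialField_nonneg _ _ _), mul_comm B, Real.norm_eq_abs]
  exact mul_le_mul_of_nonneg_left (hB _ _) (abs_nonneg _)

theorem aestronglyMeasurable_partialMass (h : IsUnitField P γ ψ) (n : ℕ) {g : ℝ → ℝ}
    (hg : Integrable g) : AEStronglyMeasurable (partialMass γ ψ n g) P := by
  have hP := h.isProbabilityMeasure
  exact (h.integrable_prod_partialField n hg).swap.integral_prod_left.aestronglyMeasurable

theorem memLp_partialMass (h : IsUnitField P γ ψ) (n : ℕ) {g : ℝ → ℝ}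
    (hg : Integrable g) (p : ℝ≥0∞) : MemLp (partialMass γ ψ n g) p P := by
  have hP := h.isProbabilityMeasure
  obtain ⟨B, hB0, hB⟩ := h.abs_partialMass_le n
  exact MemLp.of_bound (h.aestronglyMeasurable_partialMass n hg) _ (ae_of_all _ (hB g hg))

theorem integral_partialMass (h : IsUnitField P γ ψ) (n : ℕ) {g : ℝ → ℝ} (hg : Integrable g) :
    ∫ ω, partialMass γ ψ n g ω ∂P = ∫ s, g s := by
  have hP := h.isProbabilityMeasure
  unfold partialMass
  rw [← integral_integral_swap (h.integrable_prod_partialField n hg)]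
  simp [integral_const_mul, h.integral_partialField]

/-- Fubini and the mean-one property make g ↦ mass of g a contraction in L¹. This is what later
extends convergence from indicators to integrable functions. -/
theorem integral_abs_partialMass_le (h : IsUnitField P γ ψ) (n : ℕ) {g : ℝ → ℝ}
    (hg : Integrable g) : ∫ ω, |partialMass γ ψ n g ω| ∂P ≤ ∫ s, |g s| := by
  have hP := h.isProbabilityMeasure
  rw [← h.integral_partialMass n hg.abs]
  refine integral_mono ((h.memLp_partialMass n hg 1).integrable le_rfl).abs
    ((h.memLp_partialMass n hg.abs 1).integrable le_rfl) fun ω => ?_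
  refine (abs_integral_le_integral_abs).trans (le_of_eq ?_)
  unfold partialMass
  simp_rw [abs_mul, abs_of_nonneg (h.partialField_nonneg _ _ _)]

theorem integral_partialMass_mul (h : IsUnitField P γ ψ) {n m : ℕ} (hnm : n ≤ m) {g : ℝ → ℝ}
    (hg : Integrable g) :
    ∫ ω, partialMass γ ψ m g ω * partialMass γ ψ n g ω ∂P
      = ∫ x : ℝ × ℝ, g x.1 * g x.2 * blockCorr P γ ψ 0 n x.1 x.2 := by
  have hP := h.isProbabilityMeasure
  obtain ⟨B, hB0, hB⟩ := h.exists_partialField_le n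
  obtain ⟨B', hB0', hB'⟩ := h.exists_partialField_le m
  have hint : Integrable (fun y : (ℝ × ℝ) × Ω => g y.1.1 * g y.1.2 *
      (partialField γ ψ m y.1.1 y.2 * partialField γ ψ n y.1.2 y.2))
      ((volume.prod volume).prod P) := by
    refine ((hg.mul_prod hg).comp_fst P).mul_bdd (c := B' * B) ?_ (ae_of_all _ fun y => ?_)
    · exact (((h.measurable_partialField m).comp (f := fun y : (ℝ × ℝ) × Ω => (y.1.1, y.2))
        (by fun_prop)).mul ((h.measurable_partialField n).comp
        (f := fun y : (ℝ × ℝ) × Ω => (y.1.2, y.2)) (by fun_prop))).aestronglyMeasurable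
    · rw [norm_mul, Real.norm_of_nonneg (h.partialField_nonneg _ _ _),
        Real.norm_of_nonneg (h.partialField_nonneg _ _ _)]
      exact mul_le_mul (hB' _ _) (hB _ _) (h.partialField_nonneg _ _ _) hB0'
  have e1 : ∀ ω, partialMass γ ψ m g ω * partialMass γ ψ n g ω
      = ∫ x : ℝ × ℝ, g x.1 * g x.2 *
        (partialField γ ψ m x.1 ω * partialField γ ψ n x.2 ω) ∂(volume.prod volume) := by
    intro ω
    unfold partialMass
    rw [← integral_prod_mul]
    congr 1 with x
    ring
  simp_rw [e1]
  rw [← integral_integral_swap hint]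
  refine integral_congr_ae (ae_of_all _ fun x => ?_)
  simp [integral_const_mul, h.integral_partialField_mul hnm]

/-- Orthogonality of martingale increments: the mixed moment equals the second moment at the earlier
index, so the square expands to a difference of second moments. -/
theorem integral_partialMass_sub_sq (h : IsUnitField P γ ψ) {n m : ℕ} (hnm : n ≤ m) {g : ℝ → ℝ}
    (hg : Integrable g) :
    ∫ ω, (partialMass γ ψ m g ω - partialMass γ ψ n g ω) ^ 2 ∂P
      = (∫ x : ℝ × ℝ, g x.1 * g x.2 * blockCorr P γ ψ 0 m x.1 x.2)
        - ∫ x : ℝ × ℝ, g x.1 * g x.2 * blockCorr P γ ψ 0 n x.1 x.2 := by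
  have hP := h.isProbabilityMeasure
  have hi : ∀ a b, Integrable (fun ω => partialMass γ ψ a g ω * partialMass γ ψ b g ω) P :=
    fun a b => (h.memLp_partialMass a hg 2).integrable_mul (h.memLp_partialMass b hg 2)
  have e : ∀ ω, (partialMass γ ψ m g ω - partialMass γ ψ n g ω) ^ 2
      = partialMass γ ψ m g ω * partialMass γ ψ m g ω
        - 2 * (partialMass γ ψ m g ω * partialMass γ ψ n g ω)
        + partialMass γ ψ n g ω * partialMass γ ψ n g ω := fun ω => by ring
  simp_rw [e]
  have hi2 : Integrable (fun ω => partialMass γ ψ m g ω * partialMass γ ψ m g ω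
      - 2 * (partialMass γ ψ m g ω * partialMass γ ψ n g ω)) P := (hi m m).sub ((hi m n).const_mul 2)
  rw [integral_add hi2 (hi n n),
    integral_sub (hi m m) ((hi m n).const_mul 2), integral_const_mul,
    h.integral_partialMass_mul le_rfl hg, h.integral_partialMass_mul le_rfl hg,
    h.integral_partialMass_mul hnm hg]
  ring

theorem measurable_factorCorr (h : IsUnitField P γ ψ) (k : ℕ) :
    Measurable (fun x : ℝ × ℝ => factorCorr P γ ψ k x.1 x.2) := by
  have hP := h.isProbabilityMeasure
  have : StronglyMeasurable (fun y : (ℝ × ℝ) × Ω => ψ k y.1.1 (γ k y.2) * ψ k y.1.2 (γ k y.2)) :=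
    (((h.measurable_field k).comp (f := fun y : (ℝ × ℝ) × Ω => (y.1.1, y.2)) (by fun_prop)).mul
      ((h.measurable_field k).comp (f := fun y : (ℝ × ℝ) × Ω => (y.1.2, y.2))
        (by fun_prop))).stronglyMeasurable
  exact (this.integral_prod_right (ν := P)).measurable

theorem measurable_blockCorr (h : IsUnitField P γ ψ) (n m : ℕ) :
    Measurable (fun x : ℝ × ℝ => blockCorr P γ ψ n m x.1 x.2) := by
  unfold blockCorr
  exact Finset.measurable_fun_prod _ (fun k _ => h.measurable_factorCorr k)

theorem factorCorr_nonneg (h : IsUnitField P γ ψ) (k : ℕ) (s s' : ℝ) :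
    0 ≤ factorCorr P γ ψ k s s' :=
  integral_nonneg fun _ => mul_nonneg (h.nonneg _ _ _) (h.nonneg _ _ _)

theorem blockCorr_nonneg (h : IsUnitField P γ ψ) (n m : ℕ) (s s' : ℝ) :
    0 ≤ blockCorr P γ ψ n m s s' :=
  Finset.prod_nonneg fun k _ => h.factorCorr_nonneg k s s'

theorem exists_factorCorr_le (h : IsUnitField P γ ψ) (k : ℕ) :
    ∃ B, ∀ s s', factorCorr P γ ψ k s s' ≤ B := by
  have hP := h.isProbabilityMeasure
  obtain ⟨B, hB⟩ := h.bdd k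
  refine ⟨B * B, fun s s' => ?_⟩
  have : ∫ _ω : Ω, B * B ∂P = B * B := by simp
  rw [← this]
  refine integral_mono_of_nonneg (ae_of_all _ fun ω => mul_nonneg (h.nonneg _ _ _) (h.nonneg _ _ _))
    (integrable_const _) (ae_of_all _ fun ω => ?_)
  exact mul_le_mul (hB _ _) (hB _ _) (h.nonneg _ _ _) ((h.nonneg k 0 (γ k ω)).trans (hB _ _))

theorem exists_blockCorr_le (h : IsUnitField P γ ψ) (n m : ℕ) :
    ∃ B, ∀ s s', blockCorr P γ ψ n m s s' ≤ B := by
  choose B hB using h.exists_factorCorr_le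
  exact ⟨∏ k ∈ Finset.Ico n m, B k, fun s s' =>
    Finset.prod_le_prod (fun k _ => h.factorCorr_nonneg k _ _) (fun k _ => hB k _ _)⟩

theorem integrable_mul_blockCorr (h : IsUnitField P γ ψ) (n m : ℕ) {g : ℝ → ℝ}
    (hg : Integrable g) :
    Integrable (fun x : ℝ × ℝ => g x.1 * g x.2 * blockCorr P γ ψ n m x.1 x.2) := by
  obtain ⟨B, hB⟩ := h.exists_blockCorr_le n m
  refine (hg.mul_prod hg).mul_bdd (c := B) (h.measurable_blockCorr n m).aestronglyMeasurable
    (ae_of_all _ fun x => ?_)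
  rw [Real.norm_of_nonneg (h.blockCorr_nonneg _ _ _ _)]
  exact hB _ _

omit [MeasurableSpace E] in
theorem blockCorr_shift (n m : ℕ) (s s' : ℝ) :
    blockCorr P (fun k => γ (n + k)) (fun k => ψ (n + k)) 0 m s s'
      = blockCorr P γ ψ n (n + m) s s' := by
  unfold blockCorr
  rw [Finset.prod_Ico_eq_prod_range, Finset.prod_Ico_eq_prod_range]
  simp [factorCorr]

omit [MeasurableSpace E] in
theorem blockCorr_mul (n m : ℕ) (hnm : n ≤ m) (s s' : ℝ) :
    blockCorr P γ ψ 0 n s s' * blockCorr P γ ψ n m s s' = blockCorr P γ ψ 0 m s s' :=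
  Finset.prod_Ico_consecutive _ (Nat.zero_le _) hnm

end IsUnitField

end RandomEuler

end

/-! ### Correlation bounds and L² convergence of the masses -/

noncomputable section

namespace RandomEuler

variable {Ω E T : Type*} [MeasurableSpace Ω] [MeasurableSpace E]

theorem eLpNorm_two_eq {P : Measure Ω} {f : Ω → ℝ} (hf : MemLp f 2 P) :
    eLpNorm f 2 P = ENNReal.ofReal (√(∫ ω, f ω ^ 2 ∂P)) := by
  rw [hf.eLpNorm_eq_integral_rpow_norm (by norm_num) (by norm_num), Real.sqrt_eq_rpow]
  simp

theorem tendsto_eLpNorm_two_iff {ι : Type*} {l : Filter ι} {P : Measure Ω} {f : ι → Ω → ℝ}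
    (hf : ∀ i, MemLp (f i) 2 P) :
    Tendsto (fun i => eLpNorm (f i) 2 P) l (𝓝 0) ↔
      Tendsto (fun i => ∫ ω, f i ω ^ 2 ∂P) l (𝓝 0) := by
  simp_rw [fun i => eLpNorm_two_eq (hf i)]
  constructor
  · intro h
    have h1 := (ENNReal.tendsto_toReal ENNReal.zero_ne_top).comp h
    have h2 : Tendsto (fun i => (√(∫ ω, f i ω ^ 2 ∂P)) ^ 2) l (𝓝 (0 ^ 2)) := by
      refine Tendsto.pow ?_ 2
      simpa [Function.comp_def, ENNReal.toReal_ofReal (Real.sqrt_nonneg _)] using h1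
    refine (h2.congr fun i => Real.sq_sqrt (integral_nonneg fun ω => sq_nonneg _)).trans_eq
      (by simp)
  · intro h
    have := (ENNReal.continuous_ofReal.comp Real.continuous_sqrt).tendsto 0
    simpa [Function.comp_def] using this.comp h

theorem integral_abs_le_sqrt {P : Measure Ω} [IsProbabilityMeasure P] {f : Ω → ℝ}
    (hf : MemLp f 2 P) : ∫ ω, |f ω| ∂P ≤ √(∫ ω, f ω ^ 2 ∂P) := by
  have h1 := eLpNorm_le_eLpNorm_of_exponent_le (μ := P) (p := 1) (q := 2) (by norm_num) hf.1
  rw [eLpNorm_two_eq hf, eLpNorm_one_eq_lintegral_enorm,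
    ← ofReal_integral_norm_eq_lintegral_enorm (hf.integrable (by norm_num))] at h1
  exact (ENNReal.ofReal_le_ofReal_iff (Real.sqrt_nonneg _)).1 h1

/-- Bounded measurable functions with bounded support. -/
structure IsTest (g : ℝ → ℝ) : Prop where
  meas : Measurable g
  bdd : ∃ C, ∀ s, |g s| ≤ C
  supp : ∃ M, ∀ s, M < |s| → g s = 0

theorem IsTest.integrable {g : ℝ → ℝ} (hg : IsTest g) : Integrable g := by
  obtain ⟨C, hC⟩ := hg.bdd
  obtain ⟨M, hM⟩ := hg.supp
  have : IntegrableOn g (Set.Icc (-M) M) :=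
    Measure.integrableOn_of_bounded (M := C) (by simp) hg.meas.aestronglyMeasurable
      (ae_of_all _ hC)
  refine (integrableOn_iff_integrable_of_support_subset fun s hs => ?_).1 this
  by_contra h
  exact hs (hM s (by simpa [← abs_le] using h))

theorem isTest_indicator {B : Set ℝ} (hB : MeasurableSet B) (hb : Bornology.IsBounded B) :
    IsTest (B.indicator 1) where
  meas := measurable_one.indicator hB
  bdd := ⟨1, fun s => by by_cases h : s ∈ B <;> simp [h]⟩
  supp := by
    obtain ⟨M, hM⟩ := hb.subset_closedBall 0
    refine ⟨M, fun s hs => ?_⟩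
    have : s ∉ B := fun h => lt_irrefl M (hs.trans_le (by simpa using hM h))
    simp [this]

/-- The filter of triples `(n, m, τ)` with `n ≤ m`, as `n → ∞`. -/
def tailFilter (T : Type*) : Filter (ℕ × ℕ × T) :=
  comap Prod.fst atTop ⊓ 𝓟 {q | q.1 ≤ q.2.1}

instance : (tailFilter T).IsCountablyGenerated := by unfold tailFilter; infer_instance

/-- The threshold does not depend on `τ` or on `m`: convergence along this filter is uniform in the
parameter. -/
theorem eventually_tailFilter {p : ℕ × ℕ × T → Prop} :
    (∀ᶠ q in tailFilter T, p q) ↔ ∃ N, ∀ n m τ, N ≤ n → n ≤ m → p (n, m, τ) := by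
  rw [tailFilter, eventually_inf_principal, eventually_comap, eventually_atTop]
  constructor
  · rintro ⟨N, h⟩
    exact ⟨N, fun n m τ h1 h2 => h n h1 (n, m, τ) rfl h2⟩
  · rintro ⟨N, h⟩
    exact ⟨N, fun n h1 q hq h2 => h q.1 q.2.1 q.2.2 (hq ▸ h1) h2⟩

theorem le_of_tailFilter : ∀ᶠ q in tailFilter T, q.1 ≤ q.2.1 :=
  eventually_tailFilter.2 ⟨0, fun _ _ _ _ h => h⟩

theorem integrableOn_abs_rpow {a : ℝ} (ha : a < 1) (M : ℝ) :
    IntegrableOn (fun u : ℝ => |u| ^ (-a)) (Set.Icc (-M) M) := by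
  rcases lt_or_ge M 0 with hM | hM
  · simp [Set.Icc_eq_empty (a := -M) (b := M) (by linarith)]
  have h1 : IntegrableOn (fun u : ℝ => |u| ^ (-a)) (Set.Icc 0 M) := by
    have := intervalIntegral.intervalIntegrable_rpow' (a := 0) (b := M) (r := -a) (by linarith)
    rw [intervalIntegrable_iff_integrableOn_Icc_of_le hM] at this
    refine this.congr_fun (fun u hu => ?_) measurableSet_Icc
    simp [abs_of_nonneg hu.1]
  have h2 : IntegrableOn (fun u : ℝ => |u| ^ (-a)) (Set.Icc (-M) 0) := by
    have := h1.comp_neg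
    simpa using this
  have : Set.Icc (-M) M = Set.Icc (-M) 0 ∪ Set.Icc 0 M := by
    rw [Set.Icc_union_Icc_eq_Icc] <;> linarith
  rw [this]
  exact h2.union h1

/-- On the square this is the integrand of the convolution of two integrable functions: the
indicator of [-M, M], and |u|^(-a) cut off at 2M, which contains all differences. -/
theorem integrableOn_abs_sub_rpow {a : ℝ} (ha : a < 1) (M : ℝ) :
    IntegrableOn (fun x : ℝ × ℝ => |x.1 - x.2| ^ (-a)) (Set.Icc (-M) M ×ˢ Set.Icc (-M) M) := by
  have h1 : Integrable ((Set.Icc (-M) M).indicator (fun _ : ℝ => (1 : ℝ))) :=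
    (integrable_indicator_iff measurableSet_Icc).2 (integrableOn_const (by simp))
  have h2 := (integrable_indicator_iff measurableSet_Icc).2 (integrableOn_abs_rpow ha (2 * M))
  have h3 := h1.convolution_integrand (ContinuousLinearMap.mul ℝ ℝ) h2
  refine (h3.integrableOn (s := Set.Icc (-M) M ×ˢ Set.Icc (-M) M)).congr_fun (fun x hx => ?_)
    (measurableSet_Icc.prod measurableSet_Icc)
  obtain ⟨⟨a1, a2⟩, b1, b2⟩ := hx
  have : x.1 - x.2 ∈ Set.Icc (-(2 * M)) (2 * M) := ⟨by linarith, by linarith⟩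
  simp [b1, b2, this]

theorem ae_fst_ne_snd : ∀ᵐ x : ℝ × ℝ, x.1 ≠ x.2 := by
  refine (Measure.ae_prod_iff_ae_ae (measurableSet_eq_fun measurable_fst measurable_snd).compl).2
    (ae_of_all _ fun x => ?_)
  filter_upwards [volume.ae_ne x] with y hy
  exact hy.symm

/-- A family of random fields whose block correlations are dominated by `|s - s'| ^ (-a)`, `a < 1`,
and whose tail correlations tend to one off the diagonal, uniformly in the parameter. -/
structure HasCorrBound (P : Measure Ω) (γ : ℕ → Ω → E) (ψ : T → ℕ → ℝ → E → ℝ) (a : ℝ) :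
    Prop where
  field : ∀ τ, IsUnitField P γ (ψ τ)
  exp_lt : a < 1
  le_rpow : ∀ M : ℝ, ∃ C : ℝ, ∀ τ n m s s', |s| ≤ M → |s'| ≤ M → s ≠ s' →
    blockCorr P γ (ψ τ) n m s s' ≤ C * |s - s'| ^ (-a)
  tendsto_one : ∀ s s', s ≠ s' →
    Tendsto (fun q : ℕ × ℕ × T => blockCorr P γ (ψ q.2.2) q.1 q.2.1 s s') (tailFilter T) (𝓝 1)

namespace HasCorrBound

variable {P : Measure Ω} {γ : ℕ → Ω → E} {ψ : T → ℕ → ℝ → E → ℝ} {a : ℝ}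

/-- Dominated convergence on a square containing the support; the diagonal is null and the majorant
is integrable because `a < 1`. The kernel is kept general, since it will be a difference of
correlations in one use and a tail correlation minus one in the other. -/
theorem tendsto_integral_test (h : HasCorrBound P γ ψ a) {g : ℝ → ℝ} (hg : IsTest g)
    {F : ℕ × ℕ × T → ℝ × ℝ → ℝ} (hF : ∀ q, Measurable (F q))
    (hbd : ∀ M : ℝ, ∃ c d : ℝ, ∀ᶠ q in tailFilter T, ∀ s s', |s| ≤ M → |s'| ≤ M → s ≠ s' →
      |F q (s, s')| ≤ c * |s - s'| ^ (-a) + d)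
    (hlim : ∀ s s', s ≠ s' → Tendsto (fun q => F q (s, s')) (tailFilter T) (𝓝 0)) :
    Tendsto (fun q => ∫ x : ℝ × ℝ, g x.1 * g x.2 * F q x) (tailFilter T) (𝓝 0) := by
  obtain ⟨C, hC⟩ := hg.bdd
  obtain ⟨M, hM⟩ := hg.supp
  obtain ⟨c, d, hcd⟩ := hbd M
  set S := Set.Icc (-M) M ×ˢ Set.Icc (-M) M
  have hSm : MeasurableSet S := measurableSet_Icc.prod measurableSet_Icc
  have hint : IntegrableOn (fun x : ℝ × ℝ => C * C * (c * |x.1 - x.2| ^ (-a) + d)) S := by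
    refine Integrable.const_mul (((integrableOn_abs_sub_rpow h.exp_lt M).const_mul c).add ?_) _
    refine integrableOn_const ?_
    rw [Measure.volume_eq_prod, Measure.prod_prod]
    simp [ENNReal.mul_eq_top]
  have := tendsto_integral_filter_of_dominated_convergence (μ := volume)
    (F := fun q (x : ℝ × ℝ) => g x.1 * g x.2 * F q x) (f := fun _ => (0 : ℝ)) (l := tailFilter T)
    (S.indicator fun x : ℝ × ℝ => C * C * (c * |x.1 - x.2| ^ (-a) + d)) ?_ ?_
    ((integrable_indicator_iff hSm).2 hint) ?_
  · simpa using this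
  · exact Eventually.of_forall fun q => (((hg.meas.comp measurable_fst).mul
      (hg.meas.comp measurable_snd)).mul (hF q)).aestronglyMeasurable
  · filter_upwards [hcd] with q hq
    filter_upwards [ae_fst_ne_snd] with x hx
    by_cases hxS : x ∈ S
    · rw [Set.indicator_of_mem hxS, norm_mul, norm_mul]
      refine mul_le_mul (mul_le_mul (hC _) (hC _) (norm_nonneg _) ((abs_nonneg _).trans (hC 0)))
        (hq _ _ (abs_le.2 hxS.1) (abs_le.2 hxS.2) hx) (norm_nonneg _)
        (mul_self_nonneg _)
    · rw [Set.indicator_of_notMem hxS]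
      have : M < |x.1| ∨ M < |x.2| := by
        by_contra! h'
        exact hxS ⟨abs_le.1 h'.1, abs_le.1 h'.2⟩
      rcases this with h' | h' <;> simp [hM _ h']
  · filter_upwards [ae_fst_ne_snd] with x hx
    simpa using (hlim x.1 x.2 hx).const_mul (g x.1 * g x.2)

theorem tendsto_integral_sub_sq (h : HasCorrBound P γ ψ a) {g : ℝ → ℝ} (hg : IsTest g) :
    Tendsto (fun q : ℕ × ℕ × T => ∫ ω, (partialMass γ (ψ q.2.2) q.2.1 g ω
      - partialMass γ (ψ q.2.2) q.1 g ω) ^ 2 ∂P) (tailFilter T) (𝓝 0) := by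
  have := h.tendsto_integral_test hg (F := fun q x => blockCorr P γ (ψ q.2.2) 0 q.2.1 x.1 x.2
    - blockCorr P γ (ψ q.2.2) 0 q.1 x.1 x.2)
    (fun q => ((h.field _).measurable_blockCorr _ _).sub ((h.field _).measurable_blockCorr _ _))
    ?_ ?_
  · refine this.congr' ?_
    filter_upwards [le_of_tailFilter] with q hq
    rw [(h.field _).integral_partialMass_sub_sq hq hg.integrable, ← integral_sub]
    · congr 1 with x; ring
    · exact (h.field _).integrable_mul_blockCorr _ _ hg.integrable
    · exact (h.field _).integrable_mul_blockCorr _ _ hg.integrable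
  · intro M
    obtain ⟨C, hC⟩ := h.le_rpow M
    refine ⟨C + C, 0, Eventually.of_forall fun q s s' h1 h2 h3 => ?_⟩
    have e1 := hC q.2.2 0 q.2.1 s s' h1 h2 h3
    have e2 := hC q.2.2 0 q.1 s s' h1 h2 h3
    have e3 := (h.field q.2.2).blockCorr_nonneg 0 q.2.1 s s'
    have e4 := (h.field q.2.2).blockCorr_nonneg 0 q.1 s s'
    rw [abs_le]
    constructor <;> linarith
  · intro s s' hs
    -- The correlation over [0, m) is the one over [0, n) times the one over [n, m). Off the
    -- diagonal the first stays bounded and the second tends to one.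
    obtain ⟨C, hC⟩ := h.le_rpow (max |s| |s'|)
    have h0 : Tendsto (fun q : ℕ × ℕ × T => C * |s - s'| ^ (-a) *
        |blockCorr P γ (ψ q.2.2) q.1 q.2.1 s s' - 1|) (tailFilter T) (𝓝 0) := by
      simpa using (((h.tendsto_one s s' hs).sub_const 1).abs.const_mul (C * |s - s'| ^ (-a)))
    refine squeeze_zero_norm' ?_ h0
    filter_upwards [le_of_tailFilter] with q hq
    have e4 := (h.field q.2.2).blockCorr_nonneg 0 q.1 s s'
    rw [← IsUnitField.blockCorr_mul q.1 q.2.1 hq, ← mul_sub_one, norm_mul, Real.norm_of_nonneg e4]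
    exact mul_le_mul_of_nonneg_right
      (hC _ _ _ _ _ (le_max_left _ _) (le_max_right _ _) hs) (abs_nonneg _)

theorem tendsto_eLpNorm_sub (h : HasCorrBound P γ ψ a) {g : ℝ → ℝ} (hg : IsTest g) :
    Tendsto (fun q : ℕ × ℕ × T => eLpNorm (partialMass γ (ψ q.2.2) q.2.1 g
      - partialMass γ (ψ q.2.2) q.1 g) 2 P) (tailFilter T) (𝓝 0) := by
  have hm : ∀ q : ℕ × ℕ × T, MemLp (partialMass γ (ψ q.2.2) q.2.1 g
      - partialMass γ (ψ q.2.2) q.1 g) 2 P := fun q =>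
    ((h.field q.2.2).memLp_partialMass _ hg.integrable 2).sub
      ((h.field q.2.2).memLp_partialMass _ hg.integrable 2)
  rw [tendsto_eLpNorm_two_iff hm]
  exact h.tendsto_integral_sub_sq hg

/-- The product of the fields from n on is a field of the same kind, with empty product at the
start, so the variance of its mass is governed by the tail correlations minus one. This
concentration is the source of positivity. -/
theorem tendsto_integral_tail_sq (h : HasCorrBound P γ ψ a) {g : ℝ → ℝ} (hg : IsTest g) :
    Tendsto (fun q : ℕ × ℕ × T => ∫ ω, (partialMass (fun k => γ (q.1 + k))
      (fun k => ψ q.2.2 (q.1 + k)) (q.2.1 - q.1) g ω - ∫ s, g s) ^ 2 ∂P) (tailFilter T) (𝓝 0) := by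
  have := h.tendsto_integral_test hg (F := fun q x => blockCorr P γ (ψ q.2.2) q.1 q.2.1 x.1 x.2 - 1)
    (fun q => ((h.field _).measurable_blockCorr _ _).sub measurable_const) ?_ ?_
  · refine this.congr' ?_
    filter_upwards [le_of_tailFilter] with q hq
    have e := ((h.field q.2.2).shift q.1).integral_partialMass_sub_sq (Nat.zero_le (q.2.1 - q.1))
      hg.integrable
    simp_rw [IsUnitField.blockCorr_shift, Nat.add_sub_cancel' hq] at e
    have e0 : ∀ ω, partialMass (fun k => γ (q.1 + k)) (fun k => ψ q.2.2 (q.1 + k)) 0 g ω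
        = ∫ s, g s := by intro ω; simp [partialMass, partialField]
    simp_rw [e0] at e
    rw [e, ← integral_sub]
    · congr 1 with x; simp [blockCorr]; ring
    · exact (h.field _).integrable_mul_blockCorr _ _ hg.integrable
    · exact (h.field _).integrable_mul_blockCorr _ _ hg.integrable
  · intro M
    obtain ⟨C, hC⟩ := h.le_rpow M
    refine ⟨C, 1, Eventually.of_forall fun q s s' h1 h2 h3 => ?_⟩
    have e1 := hC q.2.2 q.1 q.2.1 s s' h1 h2 h3
    have e3 := (h.field q.2.2).blockCorr_nonneg q.1 q.2.1 s s'
    rw [abs_le]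
    constructor <;> linarith
  · intro s s' hs
    simpa using (h.tendsto_one s s' hs).sub_const 1

theorem exists_limit (h : HasCorrBound P γ ψ a) (τ : T) {g : ℝ → ℝ} (hg : IsTest g) :
    ∃ L : Ω → ℝ, Measurable L ∧ MemLp L 2 P ∧
      Tendsto (fun n => eLpNorm (partialMass γ (ψ τ) n g - L) 2 P) atTop (𝓝 0) := by
  have hm := fun n => (h.field τ).memLp_partialMass n hg.integrable 2
  have hc : CauchySeq (fun n => (hm n).toLp (partialMass γ (ψ τ) n g)) := by
    refine EMetric.cauchySeq_iff'.2 fun ε hε => ?_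
    obtain ⟨N, hN⟩ := eventually_tailFilter.1 ((h.tendsto_eLpNorm_sub hg).eventually_lt_const hε)
    exact ⟨N, fun n hn => by simpa [Lp.edist_toLp_toLp] using hN N n τ le_rfl hn⟩
  obtain ⟨L, hL⟩ := cauchySeq_tendsto_of_complete hc
  have hLm := Lp.memLp L
  refine ⟨hLm.1.mk, hLm.1.stronglyMeasurable_mk.measurable, (memLp_congr_ae hLm.1.ae_eq_mk).1 hLm,
    ?_⟩
  rw [Lp.tendsto_Lp_iff_tendsto_eLpNorm'] at hL
  refine hL.congr fun n => eLpNorm_congr_ae ?_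
  filter_upwards [(hm n).coeFn_toLp, hLm.1.ae_eq_mk] with ω h1 h2
  simp [h1, h2]

end HasCorrBound

end RandomEuler

end

/-! ### Almost sure positivity of the limiting masses -/

noncomputable section

namespace RandomEuler

variable {Ω E T : Type*} [MeasurableSpace Ω] [MeasurableSpace E]

/-- The indicator of `x ≥ ε`. -/
def levelInd (ε x : ℝ) : ℝ := if ε ≤ x then 1 else 0

theorem measurable_levelInd (ε : ℝ) : Measurable (levelInd ε) :=
  Measurable.ite measurableSet_Ici measurable_const measurable_const

theorem levelInd_nonneg (ε x : ℝ) : 0 ≤ levelInd ε x := by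
  unfold levelInd; split_ifs <;> norm_num

theorem levelInd_le_one (ε x : ℝ) : levelInd ε x ≤ 1 := by
  unfold levelInd; split_ifs <;> norm_num

theorem mul_levelInd_le {ε x : ℝ} (hx : 0 ≤ x) : ε * levelInd ε x ≤ x := by
  unfold levelInd; split_ifs with h <;> simp [h, hx]

namespace IsUnitField

variable {P : Measure Ω} {γ : ℕ → Ω → E} {ψ : ℕ → ℝ → E → ℝ}

theorem tendsto_integral_levelInd (h : IsUnitField P γ ψ)
    (hz : ∀ k s, ∀ᵐ ω ∂P, ψ k s (γ k ω) ≠ 0) (k : ℕ) (s : ℝ) :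
    Tendsto (fun i : ℕ => ∫ ω, levelInd (1 / ((i : ℝ) + 1)) (ψ k s (γ k ω)) ∂P) atTop (𝓝 1) := by
  have hP := h.isProbabilityMeasure
  have hm : Measurable fun ω => ψ k s (γ k ω) :=
    ((h.meas k).comp measurable_prodMk_left).comp (h.meas_var k)
  have := tendsto_integral_of_dominated_convergence (μ := P)
    (F := fun (i : ℕ) ω => levelInd (1 / ((i : ℝ) + 1)) (ψ k s (γ k ω))) (f := fun _ => (1 : ℝ))
    (fun _ => 1) (fun i => ((measurable_levelInd _).comp hm).aestronglyMeasurable)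
    (integrable_const _) (fun i => ae_of_all _ fun ω => ?_) ?_
  · simpa using this
  · rw [Real.norm_of_nonneg (levelInd_nonneg _ _)]
    exact levelInd_le_one _ _
  · filter_upwards [hz k s] with ω hω
    have hpos : 0 < ψ k s (γ k ω) := lt_of_le_of_ne (h.nonneg _ _ _) hω.symm
    refine tendsto_const_nhds.congr' ?_
    filter_upwards [(tendsto_one_div_add_atTop_nhds_zero_nat (𝕜 := ℝ)).eventually_lt_const hpos]
      with i hi
    rw [levelInd, if_pos hi.le]

/-- Each inner integral is the probability that a field is at least ε at s. It tends to one as ε → 0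
because the field is almost surely nonzero at s; dominated convergence in s does the rest. -/
theorem exists_level (h : IsUnitField P γ ψ)
    (hz : ∀ k s, ∀ᵐ ω ∂P, ψ k s (γ k ω) ≠ 0) {g : ℝ → ℝ} (hg : Integrable g) (n : ℕ)
    {δ : ℝ} (hδ : 0 < δ) :
    ∃ ε > 0, |(∫ s, g s) - ∫ s, g s * ∏ k ∈ Finset.range n,
      ∫ ω, levelInd ε (ψ k s (γ k ω)) ∂P| < δ := by
  have hP := h.isProbabilityMeasure
  have hm : ∀ ε k, Measurable fun s => ∫ ω, levelInd ε (ψ k s (γ k ω)) ∂P := fun ε k =>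
    (StronglyMeasurable.integral_prod_right (ν := P) (f := fun s ω => levelInd ε (ψ k s (γ k ω)))
      ((measurable_levelInd ε).comp (h.measurable_field k)).stronglyMeasurable).measurable
  have h0 : ∀ ε k s, 0 ≤ ∫ ω, levelInd ε (ψ k s (γ k ω)) ∂P := fun ε k s =>
    integral_nonneg fun ω => levelInd_nonneg _ _
  have h1 : ∀ ε k s, ∫ ω, levelInd ε (ψ k s (γ k ω)) ∂P ≤ 1 := fun ε k s => by
    have : ∫ _ω : Ω, (1 : ℝ) ∂P = 1 := by simp
    rw [← this]
    exact integral_mono_of_nonneg (ae_of_all _ fun ω => levelInd_nonneg _ _)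
      (integrable_const _) (ae_of_all _ fun ω => levelInd_le_one _ _)
  have := tendsto_integral_of_dominated_convergence (μ := volume)
    (F := fun (i : ℕ) s => g s * ∏ k ∈ Finset.range n,
      ∫ ω, levelInd (1 / ((i : ℝ) + 1)) (ψ k s (γ k ω)) ∂P) (f := fun s => g s * 1)
    (fun s => |g s|) (fun i => hg.aestronglyMeasurable.mul
      (Finset.measurable_fun_prod _ fun k _ => hm _ k).aestronglyMeasurable)
    hg.abs (fun i => ae_of_all _ fun s => ?_) (ae_of_all _ fun s => ?_)
  · simp only [mul_one] at this
    have h2 := ((tendsto_const_nhds (x := ∫ s, g s)).sub this).abs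
    rw [sub_self, abs_zero] at h2
    obtain ⟨i, hi⟩ := (h2.eventually_lt_const hδ).exists
    exact ⟨1 / ((i : ℝ) + 1), by positivity, hi⟩
  · rw [norm_mul, Real.norm_eq_abs, Real.norm_of_nonneg (Finset.prod_nonneg fun k _ => h0 _ _ _)]
    exact mul_le_of_le_one_right (abs_nonneg _)
      (Finset.prod_le_one (fun k _ => h0 _ _ _) fun k _ => h1 _ _ _)
  · refine Tendsto.const_mul _ ?_
    have := tendsto_finsetProd (Finset.range n)
      (fun k _ => h.tendsto_integral_levelInd hz k s)
    simpa using this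

omit [MeasurableSpace Ω] [MeasurableSpace E] in
theorem partialField_add (n k : ℕ) (s : ℝ) (ω : Ω) :
    partialField γ ψ (n + k) s ω = partialField γ ψ n s ω *
      partialField (fun i => γ (n + i)) (fun i => ψ (n + i)) k s ω :=
  Finset.prod_range_add _ _ _

/-- A lower bound for the mass in terms of the mass of the tail field. -/
theorem exists_tailMass_le (h : IsUnitField P γ ψ)
    (hz : ∀ k s, ∀ᵐ ω ∂P, ψ k s (γ k ω) ≠ 0) {g : ℝ → ℝ} (hg : IsTest g) (hg0 : ∀ s, 0 ≤ g s)
    (n : ℕ) {δ : ℝ} (hδ : 0 < δ) :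
    ∃ C, 0 ≤ C ∧ ∀ k, ∃ R : Ω → ℝ, Integrable R P ∧ (∀ ω, 0 ≤ R ω) ∧ ∫ ω, R ω ∂P ≤ δ ∧
      ∀ ω, partialMass (fun i => γ (n + i)) (fun i => ψ (n + i)) k g ω
        ≤ C * partialMass γ ψ (n + k) g ω + R ω := by
  have hP := h.isProbabilityMeasure
  obtain ⟨ε, hε, hεδ⟩ := h.exists_level hz hg.integrable n hδ
  -- Split the tail mass at s according to whether the first n fields are all at least ε there. If
  -- so, the full product is at least ε^n times the tail product. The other points form the
  -- remainder `R`, whose mean is, by independence, the loss bounded in `exists_level`.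
  refine ⟨(ε ^ n)⁻¹, by positivity, fun k => ?_⟩
  set Y := partialField (fun i => γ (n + i)) (fun i => ψ (n + i)) k with hY
  have hsh := h.shift n
  set b : ℝ → Ω → ℝ := fun s ω => ∏ i ∈ Finset.range n, levelInd ε (ψ i s (γ i ω)) with hb
  have hb0 : ∀ s ω, 0 ≤ b s ω := fun s ω => Finset.prod_nonneg fun i _ => levelInd_nonneg _ _
  have hb1 : ∀ s ω, b s ω ≤ 1 := fun s ω =>
    Finset.prod_le_one (fun i _ => levelInd_nonneg _ _) fun i _ => levelInd_le_one _ _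
  have hbm : Measurable fun x : ℝ × Ω => b x.1 x.2 :=
    Finset.measurable_fun_prod _ fun i _ => (measurable_levelInd ε).comp (h.measurable_field i)
  have hble : ∀ s ω, ε ^ n * b s ω ≤ partialField γ ψ n s ω := fun s ω => by
    have : ε ^ n * b s ω = ∏ i ∈ Finset.range n, (ε * levelInd ε (ψ i s (γ i ω))) := by
      simp [hb, Finset.prod_mul_distrib]
    rw [this]
    exact Finset.prod_le_prod (fun i _ => mul_nonneg hε.le (levelInd_nonneg _ _))
      fun i _ => mul_levelInd_le (h.nonneg _ _ _)
  have hi2 : Integrable (fun x : ℝ × Ω => g x.1 * Y x.1 x.2) (volume.prod P) :=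
    hsh.integrable_prod_partialField k hg.integrable
  have hi1 : Integrable (fun x : ℝ × Ω => g x.1 * Y x.1 x.2 * b x.1 x.2) (volume.prod P) :=
    hi2.mul_bdd (c := 1) hbm.aestronglyMeasurable (ae_of_all _ fun x => by
      rw [Real.norm_of_nonneg (hb0 _ _)]; exact hb1 _ _)
  have hi3 : Integrable (fun x : ℝ × Ω => g x.1 * Y x.1 x.2 * (1 - b x.1 x.2)) (volume.prod P) := by
    refine (hi2.sub hi1).congr (ae_of_all _ fun x => ?_)
    simp only [Pi.sub_apply]; ring
  have hj2 : ∀ ω, Integrable (fun s => g s * Y s ω) := fun ω =>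
    hsh.integrable_mul_partialField k hg.integrable ω
  have hj1 : ∀ ω, Integrable (fun s => g s * Y s ω * b s ω) := fun ω =>
    (hj2 ω).mul_bdd (c := 1) (hbm.comp measurable_prodMk_right).aestronglyMeasurable
      (ae_of_all _ fun x => by rw [Real.norm_of_nonneg (hb0 _ _)]; exact hb1 _ _)
  refine ⟨fun ω => ∫ s, g s * Y s ω * (1 - b s ω), hi3.integral_prod_right, fun ω =>
    integral_nonneg fun s => mul_nonneg (mul_nonneg (hg0 s) (hsh.partialField_nonneg k s ω))
      (sub_nonneg.2 (hb1 _ _)), ?_, fun ω => ?_⟩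
  · rw [← integral_integral_swap hi3]
    have hprod : ∀ s, ∫ ω, Y s ω * b s ω ∂P
        = ∏ i ∈ Finset.range n, ∫ ω, levelInd ε (ψ i s (γ i ω)) ∂P := fun s => by
      have hm : ∀ k s, Measurable (ψ k s) := fun k s => (h.meas k).comp measurable_prodMk_left
      have := integral_prod_range_comp h.indep h.meas_var
        (φ := fun i z => if i < n then levelInd ε (ψ i s z) else ψ i s z) (fun i => by
          split_ifs
          · exact (measurable_levelInd ε).comp (hm i s)
          · exact hm i s) (n + k)
      simp_rw [Finset.prod_range_add] at this
      simp only [Nat.not_lt.2 (Nat.le_add_right n _), if_false, h.mean, Finset.prod_const_one,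
        mul_one] at this
      have e2 : ∏ i ∈ Finset.range n, ∫ ω, levelInd ε (ψ i s (γ i ω)) ∂P
          = ∏ i ∈ Finset.range n,
            ∫ ω, (if i < n then levelInd ε (ψ i s (γ i ω)) else ψ i s (γ i ω)) ∂P :=
        Finset.prod_congr rfl (fun i hi => by simp [Finset.mem_range.1 hi])
      rw [e2, ← this]
      refine integral_congr_ae (ae_of_all _ fun ω => ?_)
      simp only [hb, hY, partialField]
      rw [mul_comm]
      congr 1
      exact Finset.prod_congr rfl (fun i hi => by simp [Finset.mem_range.1 hi])
    have hYm : ∀ s, Integrable (fun ω => Y s ω) P := fun s =>  by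
      obtain ⟨B, hB0, hB⟩ := hsh.exists_partialField_le k
      refine Integrable.of_bound (C := B) ?_ (ae_of_all _ fun ω => ?_)
      · exact ((hsh.measurable_partialField k).comp measurable_prodMk_left).aestronglyMeasurable
      · rw [Real.norm_of_nonneg (hsh.partialField_nonneg k s ω)]; exact hB _ _
    have hYb : ∀ s, Integrable (fun ω => Y s ω * b s ω) P := fun s =>
      (hYm s).mul_bdd (c := 1) (hbm.comp measurable_prodMk_left).aestronglyMeasurable
        (ae_of_all _ fun x => by rw [Real.norm_of_nonneg (hb0 _ _)]; exact hb1 _ _)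
    have : ∀ s, ∫ ω, g s * Y s ω * (1 - b s ω) ∂P
        = g s - g s * ∏ i ∈ Finset.range n, ∫ ω, levelInd ε (ψ i s (γ i ω)) ∂P := fun s => by
      rw [← hprod s]
      have e : ∀ ω, g s * Y s ω * (1 - b s ω) = g s * Y s ω - g s * (Y s ω * b s ω) :=
        fun ω => by ring
      simp_rw [e]
      rw [integral_sub ((hYm s).const_mul _) ((hYb s).const_mul _), integral_const_mul,
        integral_const_mul, hsh.integral_partialField, mul_one]
    simp_rw [this]
    rw [integral_sub hg.integrable]
    · exact (le_abs_self _).trans hεδ.le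
    · refine hi1.integral_prod_left.congr (ae_of_all _ fun s => ?_)
      simp only [mul_assoc, integral_const_mul, hprod]
  · have e1 : partialMass (fun i => γ (n + i)) (fun i => ψ (n + i)) k g ω
        = ∫ s, (g s * Y s ω * b s ω + g s * Y s ω * (1 - b s ω)) := by
      unfold partialMass
      congr 1 with s
      ring
    rw [e1, integral_add (hj1 ω) (((hj2 ω).sub (hj1 ω)).congr (ae_of_all _ fun s => by
      simp only [Pi.sub_apply]; ring))]
    refine add_le_add_left ?_ _
    unfold partialMass
    rw [← integral_const_mul]
    refine integral_mono (hj1 ω) ((h.integrable_mul_partialField _ hg.integrable ω).const_mul _)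
      fun s => ?_
    simp only
    rw [partialField_add, inv_mul_eq_div, le_div_iff₀ (by positivity)]
    have := mul_le_mul_of_nonneg_left (hble s ω)
      (mul_nonneg (hg0 s) (hsh.partialField_nonneg k s ω))
    calc _ = g s * Y s ω * (ε ^ n * b s ω) := by ring
      _ ≤ _ := this
      _ = _ := by ring

end IsUnitField

namespace HasCorrBound

variable {P : Measure Ω} {γ : ℕ → Ω → E} {ψ : T → ℕ → ℝ → E → ℝ} {a : ℝ}

/-- On the event L ≤ 0 the mass is at most its distance to L, hence small in mean; the tail mass,
bounded by a multiple of the mass plus a small remainder, is then small there too. But the tail mass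
is close to ∫ g in L¹, so the event has small probability. -/
theorem limit_pos (h : HasCorrBound P γ ψ a) (τ : T)
    (hz : ∀ k s, ∀ᵐ ω ∂P, ψ τ k s (γ k ω) ≠ 0) {g : ℝ → ℝ} (hg : IsTest g) (hg0 : ∀ s, 0 ≤ g s)
    (hgpos : 0 < ∫ s, g s) {L : Ω → ℝ} (hLm : Measurable L) (hL2 : MemLp L 2 P)
    (hL : Tendsto (fun n => eLpNorm (partialMass γ (ψ τ) n g - L) 2 P) atTop (𝓝 0)) :
    ∀ᵐ ω ∂P, 0 < L ω := by
  have hP := (h.field τ).isProbabilityMeasure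
  set Z : Set Ω := {ω | L ω ≤ 0} with hZ
  have hZm : MeasurableSet Z := measurableSet_le hLm measurable_const
  set c := ∫ s, g s with hc
  have hM2 := fun n => (h.field τ).memLp_partialMass n hg.integrable 2
  have hM1 := fun n => (hM2 n).integrable (by norm_num)
  have hLi : Integrable L P := hL2.integrable (by norm_num)
  have key : ∀ δ > 0, P.real Z * c ≤ 3 * δ := by
    intro δ hδ
    -- The order of choices matters: `n` makes the tail variance small for all `k`; `C` depends on
    -- `n` and `δ`; only then is `k` taken so large that `C` times the distance to `L` is small.
    obtain ⟨n, hn⟩ := eventually_tailFilter.1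
      ((h.tendsto_integral_tail_sq hg).eventually_lt_const (show (0 : ℝ) < δ ^ 2 by positivity))
    obtain ⟨C, hC0, hC⟩ := (h.field τ).exists_tailMass_le hz hg hg0 n hδ
    have hL1 : Tendsto (fun N => C * √(∫ ω, (partialMass γ (ψ τ) N g ω - L ω) ^ 2 ∂P)) atTop
        (𝓝 0) := by
      have := (tendsto_eLpNorm_two_iff (fun n => (hM2 n).sub hL2)).1 hL
      have h2 := ((Real.continuous_sqrt.tendsto 0).comp this).const_mul C
      simpa [Function.comp_def] using h2
    obtain ⟨k, hk⟩ := (((tendsto_add_atTop_iff_nat n).2 hL1).eventually_lt_const hδ).exists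
    obtain ⟨R, hRi, hR0, hRδ, hR⟩ := hC k
    have hY2 := ((h.field τ).shift n).memLp_partialMass k hg.integrable 2
    set Y := partialMass (fun i => γ (n + i)) (fun i => ψ τ (n + i)) k g with hY
    have hYc : MemLp (fun ω => Y ω - c) 2 P := hY2.sub (memLp_const c)
    have hv := hn n (n + k) τ le_rfl (Nat.le_add_right _ _)
    simp only [Nat.add_sub_cancel_left] at hv
    have h1 : ∫ ω, |Y ω - c| ∂P ≤ δ := by
      refine (integral_abs_le_sqrt hYc).trans ?_
      rw [Real.sqrt_le_left hδ.le]
      exact hv.le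
    have h2 : ∫ ω, |partialMass γ (ψ τ) (n + k) g ω - L ω| ∂P
        ≤ √(∫ ω, (partialMass γ (ψ τ) (n + k) g ω - L ω) ^ 2 ∂P) :=
      integral_abs_le_sqrt ((hM2 (n + k)).sub hL2)
    rw [add_comm] at hk
    have hDi : Integrable (fun ω => |partialMass γ (ψ τ) (n + k) g ω - L ω|) P :=
      ((hM1 (n + k)).sub hLi).abs
    have hYi : Integrable (fun ω => |Y ω - c|) P := (hYc.integrable (by norm_num)).abs
    have hconst : P.real Z * c = ∫ ω in Z, c ∂P := by simp
    calc P.real Z * c = ∫ ω in Z, c ∂P := hconst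
      _ ≤ ∫ ω in Z, (|Y ω - c| + (C * |partialMass γ (ψ τ) (n + k) g ω - L ω| + R ω)) ∂P := by
        refine setIntegral_mono_on (integrable_const c)
          ((hYi.add ((hDi.const_mul C).add hRi)).integrableOn) hZm fun ω hω => ?_
        have e1 := neg_abs_le (Y ω - c)
        have e2 := hR ω
        have e3 : partialMass γ (ψ τ) (n + k) g ω
            ≤ |partialMass γ (ψ τ) (n + k) g ω - L ω| :=
          le_trans (by have : L ω ≤ 0 := hω; linarith) (le_abs_self _)
        have e4 := mul_le_mul_of_nonneg_left e3 hC0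
        linarith
      _ ≤ ∫ ω, (|Y ω - c| + (C * |partialMass γ (ψ τ) (n + k) g ω - L ω| + R ω)) ∂P := by
        refine setIntegral_le_integral (hYi.add ((hDi.const_mul C).add hRi)) (ae_of_all _ fun ω => ?_)
        exact add_nonneg (abs_nonneg _) (add_nonneg (mul_nonneg hC0 (abs_nonneg _)) (hR0 ω))
      _ = ∫ ω, |Y ω - c| ∂P + (C * ∫ ω, |partialMass γ (ψ τ) (n + k) g ω - L ω| ∂P
            + ∫ ω, R ω ∂P) := by
        have hDR : Integrable (fun ω => C * |partialMass γ (ψ τ) (n + k) g ω - L ω| + R ω) P :=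
          (hDi.const_mul C).add hRi
        rw [integral_add hYi hDR, integral_add (hDi.const_mul C) hRi, integral_const_mul]
      _ ≤ 3 * δ := by
        have := mul_le_mul_of_nonneg_left h2 hC0
        linarith
  have hZ0 : P.real Z = 0 := by
    by_contra hne
    have hpos : 0 < P.real Z * c := mul_pos (lt_of_le_of_ne measureReal_nonneg (Ne.symm hne)) hgpos
    have := key (P.real Z * c / 6) (by positivity)
    linarith
  rw [measureReal_eq_zero_iff] at hZ0
  rw [ae_iff]
  convert hZ0 using 2
  ext ω
  simp [hZ]

end HasCorrBound

end RandomEuler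

end

/-! ### The limiting random measure on a bounded interval -/

noncomputable section

namespace RandomEuler

variable {Ω E T : Type*} [MeasurableSpace Ω] [MeasurableSpace E]

/-- Both sequences converge almost surely along a common subsequence, and there the inequality
passes to the limit. -/
theorem ae_le_of_tendsto_eLpNorm {P : Measure Ω} {p : ℝ≥0∞} (hp : p ≠ 0) {f g : ℕ → Ω → ℝ}
    {F G : Ω → ℝ} (hf : ∀ n, AEStronglyMeasurable (f n) P) (hF : AEStronglyMeasurable F P)
    (hg : ∀ n, AEStronglyMeasurable (g n) P) (hG : AEStronglyMeasurable G P)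
    (hfF : Tendsto (fun n => eLpNorm (f n - F) p P) atTop (𝓝 0))
    (hgG : Tendsto (fun n => eLpNorm (g n - G) p P) atTop (𝓝 0))
    (hle : ∀ n ω, f n ω ≤ g n ω) : ∀ᵐ ω ∂P, F ω ≤ G ω := by
  obtain ⟨ns, hns, h1⟩ := (tendstoInMeasure_of_tendsto_eLpNorm hp hf hF hfF).exists_seq_tendsto_ae
  obtain ⟨ns', hns', h2⟩ := ((tendstoInMeasure_of_tendsto_eLpNorm hp hg hG hgG).comp
    hns.tendsto_atTop).exists_seq_tendsto_ae
  filter_upwards [h1, h2] with ω h1 h2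
  exact le_of_tendsto_of_tendsto' (h1.comp hns'.tendsto_atTop) h2 fun n => hle _ ω

namespace IsUnitField

variable {P : Measure Ω} {γ : ℕ → Ω → E} {ψ : ℕ → ℝ → E → ℝ}

theorem partialMass_mono (h : IsUnitField P γ ψ) {f g : ℝ → ℝ} (hf : Integrable f)
    (hg : Integrable g) (hfg : ∀ s, f s ≤ g s) (n : ℕ) (ω : Ω) :
    partialMass γ ψ n f ω ≤ partialMass γ ψ n g ω :=
  integral_mono (h.integrable_mul_partialField n hf ω) (h.integrable_mul_partialField n hg ω)
    fun s => mul_le_mul_of_nonneg_right (hfg s) (h.partialField_nonneg n s ω)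

theorem partialMass_sub (h : IsUnitField P γ ψ) {f g : ℝ → ℝ} (hf : Integrable f)
    (hg : Integrable g) (n : ℕ) :
    partialMass γ ψ n (f - g) = partialMass γ ψ n f - partialMass γ ψ n g := by
  ext ω
  rw [Pi.sub_apply, partialMass, partialMass, partialMass,
    ← integral_sub (h.integrable_mul_partialField n hf ω) (h.integrable_mul_partialField n hg ω)]
  congr 1 with s
  simp [sub_mul]

theorem partialMass_add (h : IsUnitField P γ ψ) {f g : ℝ → ℝ} (hf : Integrable f)
    (hg : Integrable g) (n : ℕ) :
    partialMass γ ψ n (f + g) = partialMass γ ψ n f + partialMass γ ψ n g := by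
  ext ω
  rw [Pi.add_apply, partialMass, partialMass, partialMass,
    ← integral_add (h.integrable_mul_partialField n hf ω) (h.integrable_mul_partialField n hg ω)]
  congr 1 with s
  simp [add_mul]

theorem integral_limit (h : IsUnitField P γ ψ) {g : ℝ → ℝ} (hg : Integrable g) {L : Ω → ℝ}
    (hL2 : MemLp L 2 P)
    (hL : Tendsto (fun n => eLpNorm (partialMass γ ψ n g - L) 2 P) atTop (𝓝 0)) :
    ∫ ω, L ω ∂P = ∫ s, g s := by
  have hP := h.isProbabilityMeasure
  have hM2 := fun n => h.memLp_partialMass n hg 2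
  have h1 := (tendsto_eLpNorm_two_iff (fun n => (hM2 n).sub hL2)).1 hL
  have h2 := (Real.continuous_sqrt.tendsto 0).comp h1
  rw [Real.sqrt_zero] at h2
  have h3 : ∀ n, |(∫ s, g s) - ∫ ω, L ω ∂P|
      ≤ √(∫ ω, ((partialMass γ ψ n g - L) ω) ^ 2 ∂P) := fun n => by
    have : (∫ s, g s) - ∫ ω, L ω ∂P = ∫ ω, (partialMass γ ψ n g - L) ω ∂P := by
      simp only [Pi.sub_apply]
      rw [integral_sub ((hM2 n).integrable (by norm_num)) (hL2.integrable (by norm_num)),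
        h.integral_partialMass n hg]
    rw [this]
    exact abs_integral_le_integral_abs.trans (integral_abs_le_sqrt ((hM2 n).sub hL2))
  have h4 : |(∫ s, g s) - ∫ ω, L ω ∂P| ≤ 0 := ge_of_tendsto' h2 h3
  linarith [abs_nonpos_iff.1 h4]

end IsUnitField

namespace HasCorrBound

variable {P : Measure Ω} {γ : ℕ → Ω → E} {ψ : T → ℕ → ℝ → E → ℝ} {a : ℝ}

/-- The limiting random measure on a bounded interval. -/
theorem exists_limitMeasure_Ioc (h : HasCorrBound P γ ψ a) (τ : T)
    (hz : ∀ k s, ∀ᵐ ω ∂P, ψ τ k s (γ k ω) ≠ 0) {x y : ℚ} (hxy : x < y) :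
    ∃ m : Ω → Measure ℝ, Measurable m ∧ (∀ ω, IsFiniteMeasure (m ω)) ∧
      (∀ ω, m ω (Set.Ioc (x : ℝ) y)ᶜ = 0) ∧ ∀ q : ℚ,
        MemLp (fun ω => (m ω).real (Set.Iic (q : ℝ))) 2 P ∧
        Tendsto (fun n => eLpNorm (partialMass γ (ψ τ) n
          ((Set.Ioc (x : ℝ) y ∩ Set.Iic (q : ℝ)).indicator 1)
            - fun ω => (m ω).real (Set.Iic (q : ℝ))) 2 P) atTop (𝓝 0) := by
  have hP := (h.field τ).isProbabilityMeasure
  have hxy' : (x : ℝ) < y := by exact_mod_cast hxy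
  set I : Set ℝ := Set.Ioc (x : ℝ) y with hI
  set g : ℚ → ℝ → ℝ := fun q => (I ∩ Set.Iic (q : ℝ)).indicator 1 with hgdef
  have hset : ∀ q : ℚ, I ∩ Set.Iic (q : ℝ) = Set.Ioc (x : ℝ) (min y q) := fun q => by
    rw [hI, Set.Ioc_inter_Iic]
  have hg : ∀ q, IsTest (g q) := fun q => isTest_indicator (measurableSet_Ioc.inter measurableSet_Iic)
    ((Metric.isBounded_Ioc _ _).subset Set.inter_subset_left)
  have hgmono : ∀ q r : ℚ, q ≤ r → ∀ s, g q s ≤ g r s := fun q r hqr s => by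
    refine Set.indicator_le_indicator_of_subset ?_ (fun _ => zero_le_one) s
    exact Set.inter_subset_inter_right _ (Set.Iic_subset_Iic.2 (by exact_mod_cast hqr))
  have hg0 : ∀ q s, 0 ≤ g q s := fun q s => Set.indicator_nonneg (fun _ _ => zero_le_one) s
  have hgint : ∀ q : ℚ, ∫ s, g q s = max (min (y : ℝ) q - x) 0 := fun q => by
    simp only [hgdef, hset q]
    rw [integral_indicator_one measurableSet_Ioc, Measure.real, Real.volume_Ioc,
      ENNReal.toReal_ofReal']
  choose G hGm hG2 hGL using fun q => h.exists_limit τ (hg q)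
  have hM := fun q n => ((h.field τ).memLp_partialMass n (hg q).integrable 2).1
  have hGint : ∀ q, ∫ ω, G q ω ∂P = max (min (y : ℝ) q - x) 0 := fun q => by
    rw [(h.field τ).integral_limit (hg q).integrable (hG2 q) (hGL q), hgint]
  have hGmono : ∀ᵐ ω ∂P, ∀ q r : ℚ, q ≤ r → G q ω ≤ G r ω := by
    rw [ae_all_iff]; intro q; rw [ae_all_iff]; intro r
    by_cases hqr : q ≤ r
    · filter_upwards [ae_le_of_tendsto_eLpNorm (by norm_num) (hM q) (hG2 q).1 (hM r) (hG2 r).1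
        (hGL q) (hGL r) fun n ω => (h.field τ).partialMass_mono (hg q).integrable (hg r).integrable
          (hgmono q r hqr) n ω] with ω hω _ using hω
    · simp [hqr]
  have hGy : ∀ᵐ ω ∂P, ∀ q : ℚ, y ≤ q → G q ω = G y ω := by
    rw [ae_all_iff]; intro q
    by_cases hq : y ≤ q
    · have hgq : g q = g y := by
        simp only [hgdef, hset, min_self]
        rw [min_eq_left (by exact_mod_cast hq)]
      have e := hGL q
      rw [show (fun n => eLpNorm (partialMass γ (ψ τ) n (g q) - G q) 2 P)
        = fun n => eLpNorm (partialMass γ (ψ τ) n (g y) - G q) 2 P by rw [hgq]] at e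
      filter_upwards [ae_le_of_tendsto_eLpNorm (by norm_num) (hM y) (hG2 q).1 (hM y) (hG2 y).1
        e (hGL y) fun n ω => le_rfl, ae_le_of_tendsto_eLpNorm (by norm_num) (hM y) (hG2 y).1
          (hM y) (hG2 q).1 (hGL y) e fun n ω => le_rfl] with ω h1 h2 _
      exact le_antisymm h1 h2
    · simp [hq]
  have hGx : ∀ᵐ ω ∂P, ∀ q : ℚ, q ≤ x → G q ω = 0 := by
    rw [ae_all_iff]; intro q
    by_cases hq : q ≤ x
    · have hgq : g q = 0 := by
        simp only [hgdef, hset]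
        rw [Set.Ioc_eq_empty, Set.indicator_empty]
        · rfl
        · exact not_lt.2 ((min_le_right _ _).trans (by exact_mod_cast hq))
      have e := hGL q
      have e0 : ∀ n, partialMass γ (ψ τ) n (g q) = 0 := fun n => by
        ext ω; simp [partialMass, hgq]
      simp_rw [e0] at e
      have e1 : eLpNorm (0 - G q) 2 P = 0 := tendsto_nhds_unique tendsto_const_nhds e
      rw [zero_sub, eLpNorm_neg, eLpNorm_eq_zero_iff (hG2 q).1 (by norm_num)] at e1
      filter_upwards [e1] with ω hω _ using hω
    · simp [hq]
  -- Positivity of the total mass is what permits normalising to a distribution function.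
  have hGpos : ∀ᵐ ω ∂P, 0 < G y ω := by
    refine h.limit_pos τ hz (hg y) (hg0 y) ?_ (hGm y) (hG2 y) (hGL y)
    rw [hgint, min_self]
    exact lt_max_of_lt_left (by linarith)
  -- Right continuity. By monotonicity the L¹ distance between `G r` and `G q` is a difference of
  -- means, that is, of lengths, and it vanishes as r decreases to q; an almost surely convergent
  -- subsequence is enough.
  have hGr : ∀ᵐ ω ∂P, ∀ q : ℚ, ∀ ε > 0, ∃ r : ℚ, q < r ∧ G r ω < G q ω + ε := by
    rw [ae_all_iff]; intro q
    set r : ℕ → ℚ := fun i => q + 1 / ((i : ℚ) + 1) with hr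
    have hqr : ∀ i, q < r i := fun i => by simp only [hr]; linarith [Nat.one_div_pos_of_nat (α := ℚ) (n := i)]
    have hrt : Tendsto (fun i => ((r i : ℚ) : ℝ)) atTop (𝓝 q) := by
      have := (tendsto_one_div_add_atTop_nhds_zero_nat (𝕜 := ℝ)).const_add (q : ℝ)
      simpa [hr] using this
    have hlim : Tendsto (fun i => eLpNorm (G (r i) - G q) 1 P) atTop (𝓝 0) := by
      have e : ∀ i, eLpNorm (G (r i) - G q) 1 P
          = ENNReal.ofReal (max (min (y : ℝ) (r i) - x) 0 - max (min (y : ℝ) q - x) 0) := by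
        intro i
        have hi : Integrable (G (r i) - G q) P :=
          ((hG2 _).integrable (by norm_num)).sub ((hG2 _).integrable (by norm_num))
        rw [eLpNorm_one_eq_lintegral_enorm, ← ofReal_integral_norm_eq_lintegral_enorm hi,
          ← hGint, ← hGint, ← integral_sub ((hG2 _).integrable (by norm_num))
            ((hG2 _).integrable (by norm_num))]
        congr 1
        refine integral_congr_ae ?_
        filter_upwards [hGmono] with ω hω
        simp only [Pi.sub_apply]
        rw [Real.norm_of_nonneg (sub_nonneg.2 (hω _ _ (hqr i).le))]
      simp_rw [e]
      have hc : Continuous fun z : ℝ =>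
        ENNReal.ofReal (max (min (y : ℝ) z - x) 0 - max (min (y : ℝ) q - x) 0) :=
        ENNReal.continuous_ofReal.comp (by fun_prop)
      have := (hc.tendsto (q : ℝ)).comp hrt
      simpa [Function.comp_def] using this
    obtain ⟨ns, hns, h1⟩ := (tendstoInMeasure_of_tendsto_eLpNorm (by norm_num)
      (fun i => (hG2 (r i)).1) (hG2 q).1 hlim).exists_seq_tendsto_ae
    filter_upwards [h1] with ω hω ε hε
    obtain ⟨i, hi⟩ := (hω.eventually_lt_const (show G q ω < G q ω + ε by linarith)).exists
    exact ⟨r (ns i), hqr _, hi⟩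
  -- Almost surely `F ω` is a distribution function on ℚ, which extends measurably in ω to a
  -- Stieltjes function on ℝ. On the exceptional null set the extension falls back on a default
  -- distribution function.
  set F : Ω → ℚ → ℝ := fun ω q => G q ω / G y ω with hF
  have hFm : Measurable F := measurable_pi_iff.2 fun q => (hGm q).div (hGm y)
  have hstieltjes : ∀ᵐ ω ∂P, IsRatStieltjesPoint F ω := by
    filter_upwards [hGmono, hGy, hGx, hGpos, hGr] with ω hmono hy hx hpos hr
    have hFmono : Monotone (F ω) := fun q r hqr =>
      div_le_div_of_nonneg_right (hmono q r hqr) hpos.le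
    refine ⟨hFmono, ?_, ?_, fun t => ?_⟩
    · refine tendsto_const_nhds.congr' ?_
      filter_upwards [eventually_ge_atTop y] with q hq
      simp [hF, hy q hq, hpos.ne']
    · refine tendsto_const_nhds.congr' ?_
      filter_upwards [eventually_le_atBot x] with q hq
      simp [hF, hx q hq]
    · have hbdd : BddBelow (Set.range fun r : Set.Ioi t => F ω r) :=
        ⟨F ω t, by rintro _ ⟨r, rfl⟩; exact hFmono (le_of_lt r.2)⟩
      have : Nonempty (Set.Ioi t) := ⟨⟨t + 1, by simp⟩⟩
      refine le_antisymm (le_of_forall_pos_le_add fun ε hε => ?_) (le_ciInf fun r =>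
        hFmono (le_of_lt r.2))
      obtain ⟨r, hrt, hrε⟩ := hr t (ε * G y ω) (by positivity)
      refine (ciInf_le hbdd ⟨r, hrt⟩).trans ?_
      simp only [hF]
      rw [div_le_iff₀ hpos, add_mul, div_mul_cancel₀ _ hpos.ne']
      exact hrε.le
  set ν : Ω → Measure ℝ := fun ω => (stieltjesOfMeasurableRat F hFm ω).measure with hν
  have hνm : Measurable ν := measurable_measure_stieltjesOfMeasurableRat hFm
  -- The factor `G y ω` undoes the normalisation. The restriction to `I` costs nothing almost
  -- surely, and makes the measure vanish off `I` for every ω, the default case included.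
  refine ⟨fun ω => ENNReal.ofReal (G y ω) • (ν ω).restrict I, ?_, fun ω => ?_, fun ω => ?_, ?_⟩
  · refine Measure.measurable_of_measurable_coe _ fun s hs => ?_
    simp only [Measure.smul_apply, smul_eq_mul, Measure.restrict_apply hs]
    exact (hGm y).ennreal_ofReal.mul
      ((Measure.measurable_coe (hs.inter measurableSet_Ioc)).comp hνm)
  · exact Measure.smul_finite _ ENNReal.ofReal_ne_top
  · simp [Measure.restrict_apply measurableSet_Ioc.compl, hI]
  · have hae : ∀ᵐ ω ∂P, ∀ q : ℚ, (ENNReal.ofReal (G y ω) • (ν ω).restrict I).real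
        (Set.Iic (q : ℝ)) = G q ω := by
      filter_upwards [hstieltjes, hGpos, hGmono, hGx] with ω hs hpos hmono hx q
      have hνI : ∀ q : ℚ, ν ω (Set.Iic (q : ℝ)) = ENNReal.ofReal (G q ω / G y ω) := fun q => by
        simp only [hν]
        rw [measure_stieltjesOfMeasurableRat_Iic, stieltjesOfMeasurableRat_eq,
          toRatCDF_of_isRatStieltjesPoint hs]
      have hG0 : 0 ≤ G q ω := by
        rcases le_total q x with hqx | hqx
        · rw [hx q hqx]
        · rw [← hx x le_rfl]; exact hmono _ _ hqx
      have hc : ν ω Iᶜ = 0 := by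
        have e1 : Iᶜ = Set.Iic (x : ℝ) ∪ (Set.Iic (y : ℝ))ᶜ := by
          ext s; simp [hI, imp_iff_not_or]
        rw [e1]
        refine measure_union_null ?_ ?_
        · rw [hνI, hx x le_rfl]; simp
        · rw [prob_compl_eq_zero_iff measurableSet_Iic, hνI, div_self hpos.ne']; simp
      rw [Measure.real, Measure.smul_apply, Measure.restrict_apply measurableSet_Iic,
        measure_inter_conull hc, hνI, smul_eq_mul, ← ENNReal.ofReal_mul hpos.le,
        mul_div_cancel₀ _ hpos.ne', ENNReal.toReal_ofReal hG0]
    intro q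
    have hq : (fun ω => (ENNReal.ofReal (G y ω) • (ν ω).restrict I).real (Set.Iic (q : ℝ)))
        =ᵐ[P] G q := by filter_upwards [hae] with ω hω using hω q
    refine ⟨(memLp_congr_ae hq).2 (hG2 q), (hGL q).congr fun n => eLpNorm_congr_ae ?_⟩
    filter_upwards [hq] with ω hω
    simp only [Pi.sub_apply]
    rw [hω]

end HasCorrBound

end RandomEuler

end

/-! ### Random measures with given intensity; from half-lines to integrable functions -/

noncomputable section

namespace RandomEuler

variable {Ω E T : Type*} [MeasurableSpace Ω] [MeasurableSpace E]

/-- The measure `μ` is the intensity (mean measure) of the random measure `m`. -/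
structure HasIntensity (P : Measure Ω) (m : Ω → Measure ℝ) (μ : Measure ℝ) : Prop where
  meas : Measurable m
  bind_eq : P.bind m = μ

namespace HasIntensity

variable {P : Measure Ω} {m : Ω → Measure ℝ} {μ : Measure ℝ}

theorem lintegral_lintegral (h : HasIntensity P m μ) {g : ℝ → ℝ≥0∞} (hg : Measurable g) :
    ∫⁻ ω, ∫⁻ s, g s ∂(m ω) ∂P = ∫⁻ s, g s ∂μ := by
  rw [← h.bind_eq, Measure.lintegral_bind h.meas.aemeasurable hg.aemeasurable]

theorem ae_integrable (h : HasIntensity P m μ) {g : ℝ → ℝ} (hgm : Measurable g)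
    (hg : Integrable g μ) : ∀ᵐ ω ∂P, Integrable g (m ω) := by
  have h1 : ∫⁻ ω, ∫⁻ s, ‖g s‖ₑ ∂(m ω) ∂P ≠ ∞ := by
    rw [h.lintegral_lintegral hgm.enorm]
    exact hg.2.ne
  have h2 := ae_lt_top' ((Measure.measurable_lintegral hgm.enorm).comp h.meas).aemeasurable h1
  filter_upwards [h2] with ω hω
  exact ⟨hgm.aestronglyMeasurable, hω⟩

theorem aestronglyMeasurable_integral (h : HasIntensity P m μ) {g : ℝ → ℝ} (hgm : Measurable g)
    (hg : Integrable g μ) : AEStronglyMeasurable (fun ω => ∫ s, g s ∂(m ω)) P := by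
  have h1 : Measurable fun ω => ENNReal.toReal (∫⁻ s, ENNReal.ofReal (g s) ∂(m ω))
      - ENNReal.toReal (∫⁻ s, ENNReal.ofReal (-g s) ∂(m ω)) :=
    ((Measure.measurable_lintegral hgm.ennreal_ofReal).comp h.meas).ennreal_toReal.sub
      ((Measure.measurable_lintegral hgm.neg.ennreal_ofReal).comp h.meas).ennreal_toReal
  refine h1.aestronglyMeasurable.congr ?_
  filter_upwards [h.ae_integrable hgm hg] with ω hω
  rw [integral_eq_lintegral_pos_part_sub_lintegral_neg_part hω]

theorem eLpNorm_integral_le (h : HasIntensity P m μ) {g : ℝ → ℝ} (hgm : Measurable g) :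
    eLpNorm (fun ω => ∫ s, g s ∂(m ω)) 1 P ≤ eLpNorm g 1 μ := by
  rw [eLpNorm_one_eq_lintegral_enorm, eLpNorm_one_eq_lintegral_enorm,
    ← h.lintegral_lintegral hgm.enorm]
  exact lintegral_mono fun ω => enorm_integral_le_lintegral_enorm _

end HasIntensity

namespace IsUnitField

variable {P : Measure Ω} {γ : ℕ → Ω → E} {ψ : ℕ → ℝ → E → ℝ}

theorem eLpNorm_partialMass_le (h : IsUnitField P γ ψ) (n : ℕ) {g : ℝ → ℝ} (hg : Integrable g) :
    eLpNorm (partialMass γ ψ n g) 1 P ≤ eLpNorm g 1 volume := by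
  have hP := h.isProbabilityMeasure
  rw [eLpNorm_one_eq_lintegral_enorm, eLpNorm_one_eq_lintegral_enorm,
    ← ofReal_integral_norm_eq_lintegral_enorm hg, ← ofReal_integral_norm_eq_lintegral_enorm
      ((h.memLp_partialMass n hg 1).integrable le_rfl)]
  exact ENNReal.ofReal_le_ofReal (h.integral_abs_partialMass_le n hg)

/-- Convergence in `L^1` of the masses restricted to the set `I` to a random measure. -/
def MassConv (P : Measure Ω) (γ : ℕ → Ω → E) (ψ : ℕ → ℝ → E → ℝ) (m : Ω → Measure ℝ) (I : Set ℝ)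
    (g : ℝ → ℝ) : Prop :=
  Tendsto (fun n => eLpNorm (partialMass γ ψ n (I.indicator g) - fun ω => ∫ s, g s ∂(m ω)) 1 P)
    atTop (𝓝 0)

variable {m : Ω → Measure ℝ} {I : Set ℝ}

theorem MassConv.add (h : IsUnitField P γ ψ) (hI : MeasurableSet I)
    (hm : HasIntensity P m (volume.restrict I)) {f g : ℝ → ℝ} (hfm : Measurable f)
    (hf : IntegrableOn f I) (hgm : Measurable g) (hg : IntegrableOn g I)
    (hcf : MassConv P γ ψ m I f) (hcg : MassConv P γ ψ m I g) : MassConv P γ ψ m I (f + g) := by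
  have hf' := (integrable_indicator_iff hI).2 hf
  have hg' := (integrable_indicator_iff hI).2 hg
  refine tendsto_of_tendsto_of_tendsto_of_le_of_le tendsto_const_nhds
    (by simpa using Tendsto.add hcf hcg) (fun n => zero_le) fun n => ?_
  refine le_trans (le_of_eq ?_) (eLpNorm_add_le
    (((h.memLp_partialMass n hf' 1).1).sub (hm.aestronglyMeasurable_integral hfm hf))
    (((h.memLp_partialMass n hg' 1).1).sub (hm.aestronglyMeasurable_integral hgm hg)) le_rfl)
  refine eLpNorm_congr_ae ?_
  filter_upwards [hm.ae_integrable hfm hf, hm.ae_integrable hgm hg] with ω h1 h2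
  rw [Set.indicator_add', h.partialMass_add hf' hg']
  simp only [Pi.sub_apply, Pi.add_apply]
  rw [integral_add h1 h2]
  ring

omit [MeasurableSpace E] in
theorem MassConv.const_mul {g : ℝ → ℝ} (c : ℝ) (hcg : MassConv P γ ψ m I g) :
    MassConv P γ ψ m I (fun s => c * g s) := by
  have : ∀ n, partialMass γ ψ n (I.indicator fun s => c * g s)
      - (fun ω => ∫ s, c * g s ∂(m ω))
      = c • (partialMass γ ψ n (I.indicator g) - fun ω => ∫ s, g s ∂(m ω)) := fun n => by
    ext ω
    simp only [Pi.sub_apply, Pi.smul_apply, smul_eq_mul, integral_const_mul, mul_sub]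
    congr 1
    rw [partialMass, partialMass, ← integral_const_mul]
    congr 1 with s
    by_cases hs : s ∈ I <;> simp [hs, mul_assoc]
  unfold MassConv
  simp_rw [this, eLpNorm_const_smul]
  simpa using ENNReal.Tendsto.const_mul hcg (Or.inr (by simp))

/-- Both operations are contractions from L¹(I) to L¹(P): the partial masses because the fields have
mean one, the integral against `m` because its intensity is Lebesgue measure on `I`. Hence the
functions for which convergence holds form a closed set in L¹(I). -/
theorem MassConv.of_approx (h : IsUnitField P γ ψ) (hI : MeasurableSet I)
    (hm : HasIntensity P m (volume.restrict I)) {g : ℝ → ℝ} (hgm : Measurable g)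
    (hg : IntegrableOn g I)
    (happ : ∀ ε : ℝ≥0∞, ε ≠ 0 → ∃ f : ℝ → ℝ, Measurable f ∧ IntegrableOn f I ∧
      MassConv P γ ψ m I f ∧ eLpNorm (g - f) 1 (volume.restrict I) ≤ ε) :
    MassConv P γ ψ m I g := by
  have hg' := (integrable_indicator_iff hI).2 hg
  refine ENNReal.tendsto_nhds_zero.2 fun ε hε => ?_
  have hε3 : ε / 3 ≠ 0 := by simpa using hε.ne'
  obtain ⟨f, hfm, hf, hcf, hfε⟩ := happ (ε / 3) hε3
  have hf' := (integrable_indicator_iff hI).2 hf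
  filter_upwards [ENNReal.tendsto_nhds_zero.1 hcf (ε / 3) (pos_iff_ne_zero.2 hε3)] with n hn
  have e1 : eLpNorm (partialMass γ ψ n (I.indicator (g - f))) 1 P ≤ ε / 3 := by
    refine (h.eLpNorm_partialMass_le n ?_).trans ?_
    · exact (integrable_indicator_iff hI).2 (hg.sub hf)
    · rwa [eLpNorm_indicator_eq_eLpNorm_restrict hI]
  have e2 : eLpNorm (fun ω => ∫ s, (f - g) s ∂(m ω)) 1 P ≤ ε / 3 := by
    refine (hm.eLpNorm_integral_le (hfm.sub hgm)).trans ?_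
    rwa [eLpNorm_sub_comm]
  calc _ = eLpNorm (partialMass γ ψ n (I.indicator (g - f))
          + ((partialMass γ ψ n (I.indicator f) - fun ω => ∫ s, f s ∂(m ω))
          + fun ω => ∫ s, (f - g) s ∂(m ω))) 1 P := by
        refine eLpNorm_congr_ae ?_
        filter_upwards [hm.ae_integrable hfm hf, hm.ae_integrable hgm hg] with ω h1 h2
        rw [Set.indicator_sub', h.partialMass_sub hg' hf']
        simp only [Pi.sub_apply, Pi.add_apply]
        rw [integral_sub h1 h2]
        ring
    _ ≤ ε / 3 + (ε / 3 + ε / 3) := by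
        have m1 := hm.aestronglyMeasurable_integral (hfm.sub hgm) (hf.sub hg)
        have m2 := (h.memLp_partialMass n hf' 1).1.sub (hm.aestronglyMeasurable_integral hfm hf)
        refine (eLpNorm_add_le (h.memLp_partialMass n ((integrable_indicator_iff hI).2
          (hg.sub hf)) 1).1 (m2.add m1) le_rfl).trans (add_le_add e1 ?_)
        exact (eLpNorm_add_le m2 m1 le_rfl).trans (add_le_add hn e2)
    _ = ε := by rw [← add_assoc, ENNReal.add_thirds]

/-- A π-λ argument: rational half-lines generate the Borel sets, complements follow by linearity,
and a countable disjoint union is approximated in L¹(I) by finite ones. -/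
theorem MassConv.of_Iic (h : IsUnitField P γ ψ) (hI : MeasurableSet I) (hIfin : volume I ≠ ∞)
    (hm : HasIntensity P m (volume.restrict I)) (huniv : MassConv P γ ψ m I 1)
    (hIic : ∀ q : ℚ, MassConv P γ ψ m I ((Set.Iic (q : ℝ)).indicator 1)) {B : Set ℝ}
    (hB : MeasurableSet B) : MassConv P γ ψ m I (B.indicator 1) := by
  have : IsFiniteMeasure (volume.restrict I) := ⟨by simpa using hIfin.lt_top⟩
  have hind : ∀ B : Set ℝ, MeasurableSet B → IntegrableOn (B.indicator (1 : ℝ → ℝ)) I :=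
    fun B hB => (integrable_const (1 : ℝ)).indicator hB
  have hmeas : ∀ B : Set ℝ, MeasurableSet B → Measurable (B.indicator (1 : ℝ → ℝ)) :=
    fun B hB => measurable_one.indicator hB
  have hzero : MassConv P γ ψ m I (fun _ => 0 * (0 : ℝ)) :=
    MassConv.const_mul (g := fun _ => 0) 0 (by simpa [Pi.one_def] using huniv.const_mul 0)
  refine MeasurableSpace.induction_on_inter (C := fun B _ => MassConv P γ ψ m I (B.indicator 1))
    ((BorelSpace.measurable_eq (α := ℝ)).trans Real.borel_eq_generateFrom_Iic_rat)
    Real.isPiSystem_Iic_rat ?_ ?_ ?_ ?_ B hB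
  · rw [Set.indicator_empty]; simpa using hzero
  · rintro t ht
    obtain ⟨q, hq⟩ := Set.mem_iUnion.1 ht
    rw [Set.mem_singleton_iff.1 hq]
    exact hIic q
  · intro t ht hc
    have e : (tᶜ).indicator (1 : ℝ → ℝ) = 1 + fun s => (-1) * t.indicator 1 s := by
      ext s; by_cases hs : s ∈ t <;> simp [hs]
    rw [e]
    exact MassConv.add h hI hm measurable_one (integrable_const (1 : ℝ))
      ((hmeas t ht).const_mul _) ((hind t ht).const_mul _) huniv (hc.const_mul (-1))
  · intro f hd hfm hc
    have hfin : ∀ n, MassConv P γ ψ m I ((⋃ i ∈ Finset.range n, f i).indicator 1) := by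
      intro n
      induction n with
      | zero => simp only [Finset.range_zero, Finset.notMem_empty, Set.iUnion_of_empty,
                  Set.iUnion_empty, Set.indicator_empty]; simpa using hzero
      | succ n ih =>
        have e : (⋃ i ∈ Finset.range (n + 1), f i).indicator (1 : ℝ → ℝ)
            = (⋃ i ∈ Finset.range n, f i).indicator 1 + (f n).indicator 1 := by
          rw [Finset.range_add_one, Finset.set_biUnion_insert, Set.union_comm,
            Set.indicator_union_of_disjoint]
          · rfl
          · refine Set.disjoint_iUnion₂_left.2 fun i hi => hd ?_
            exact (Finset.mem_range.1 hi).ne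
        rw [e]
        have hmu := Finset.measurableSet_biUnion (Finset.range n) fun i _ => hfm i
        exact MassConv.add h hI hm (hmeas _ hmu) (hind _ hmu) (hmeas _ (hfm n)) (hind _ (hfm n))
          ih (hc n)
    have hU := MeasurableSet.iUnion hfm
    refine MassConv.of_approx h hI hm (hmeas _ hU) (hind _ hU) fun ε hε => ?_
    have hlim : Tendsto (fun n => eLpNorm ((⋃ i, f i).indicator (1 : ℝ → ℝ)
        - (⋃ i ∈ Finset.range n, f i).indicator 1) 1 (volume.restrict I)) atTop (𝓝 0) := by
      have e : ∀ n, eLpNorm ((⋃ i, f i).indicator (1 : ℝ → ℝ)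
          - (⋃ i ∈ Finset.range n, f i).indicator 1) 1 (volume.restrict I)
          = volume.restrict I ((⋃ i, f i) \ ⋃ i ∈ Finset.range n, f i) := fun n => by
        have hsub : (⋃ i ∈ Finset.range n, f i) ⊆ ⋃ i, f i :=
          Set.iUnion₂_subset fun i _ => Set.subset_iUnion f i
        have hmu := Finset.measurableSet_biUnion (Finset.range n) fun i _ => hfm i
        rw [← Set.indicator_sdiff hsub, Pi.one_def, eLpNorm_indicator_const (hU.diff hmu) (by simp)
          (by simp)]
        simp
      simp_rw [e]
      have := tendsto_measure_iInter_atTop (μ := volume.restrict I)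
        (s := fun n => (⋃ i, f i) \ ⋃ i ∈ Finset.range n, f i)
        (fun n => (hU.diff (Finset.measurableSet_biUnion _ fun i _ => hfm i)).nullMeasurableSet)
        (fun a b hab => Set.sdiff_subset_sdiff_right
          (Set.biUnion_subset_biUnion_left (by simpa using hab))) ⟨0, by finiteness⟩
      rw [show (⋂ n, (⋃ i, f i) \ ⋃ i ∈ Finset.range n, f i) = ∅ by
        ext s
        simp only [Set.mem_iInter, Set.mem_sdiff, Set.mem_iUnion, Finset.mem_range,
          Set.mem_empty_iff_false, iff_false, not_forall]
        by_cases hs : ∃ i, s ∈ f i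
        · obtain ⟨i, hi⟩ := hs
          exact ⟨i + 1, fun h' => h'.2 ⟨i, Nat.lt_succ_self i, hi⟩⟩
        · exact ⟨0, fun h' => hs h'.1⟩, measure_empty] at this
      exact this
    obtain ⟨n, hn⟩ := (ENNReal.tendsto_nhds_zero.1 hlim ε (pos_iff_ne_zero.2 hε)).exists
    have hmu := Finset.measurableSet_biUnion (Finset.range n) fun i _ => hfm i
    exact ⟨_, hmeas _ hmu, hind _ hmu, hfin n, hn⟩

theorem MassConv.of_integrable (h : IsUnitField P γ ψ) (hI : MeasurableSet I)
    (hIfin : volume I ≠ ∞) (hm : HasIntensity P m (volume.restrict I))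
    (huniv : MassConv P γ ψ m I 1)
    (hIic : ∀ q : ℚ, MassConv P γ ψ m I ((Set.Iic (q : ℝ)).indicator 1)) {g : ℝ → ℝ}
    (hgm : Measurable g) (hg : IntegrableOn g I) : MassConv P γ ψ m I g := by
  have : IsFiniteMeasure (volume.restrict I) := ⟨by simpa using hIfin.lt_top⟩
  refine MassConv.of_approx h hI hm hgm hg fun ε hε => ?_
  obtain ⟨f, hf, hfi⟩ := (memLp_one_iff_integrable.2 hg).exists_simpleFunc_eLpNorm_sub_lt
    (by simp) hε
  refine ⟨f, f.measurable, memLp_one_iff_integrable.1 hfi, ?_, hf.le⟩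
  have hsi : ∀ f : SimpleFunc ℝ ℝ, IntegrableOn f I := fun f => f.integrable_of_isFiniteMeasure
  clear hf hfi
  induction f using SimpleFunc.induction with
  | const c hs =>
    rename_i s
    have := (MassConv.of_Iic h hI hIfin hm huniv hIic hs).const_mul c
    convert this using 1
    ext x
    by_cases hx : x ∈ s <;> simp [hx]
  | add hd hf hg =>
    exact MassConv.add h hI hm (SimpleFunc.measurable _) (hsi _) (SimpleFunc.measurable _)
      (hsi _) hf hg

end IsUnitField

end RandomEuler

end

/-! ### Test functions, gluing of unit intervals, and full support -/

noncomputable section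

namespace RandomEuler

variable {Ω E T : Type*} [MeasurableSpace Ω] [MeasurableSpace E]

theorem IsTest.indicator {g : ℝ → ℝ} (hg : IsTest g) {I : Set ℝ} (hI : MeasurableSet I) :
    IsTest (I.indicator g) where
  meas := hg.meas.indicator hI
  bdd := by
    obtain ⟨C, hC⟩ := hg.bdd
    refine ⟨C, fun s => ?_⟩
    by_cases hs : s ∈ I
    · simpa [hs] using hC s
    · simpa [hs] using (abs_nonneg _).trans (hC s)
  supp := by
    obtain ⟨M, hM⟩ := hg.supp
    exact ⟨M, fun s hs => by simp [hM s hs]⟩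

/-- The unit intervals meeting `[-M, M]`. -/
def unitCover (M : ℝ) : Finset ℤ := Finset.Icc (⌊-M⌋ - 1) ⌈M⌉

theorem mem_unitCover {M s : ℝ} (hs : |s| ≤ M) {j : ℤ} (hj : s ∈ Set.Ioc (j : ℝ) (j + 1)) :
    j ∈ unitCover M := by
  rw [unitCover, Finset.mem_Icc]
  obtain ⟨h1, h2⟩ := abs_le.1 hs
  constructor
  -- Only `j + 1 ≥ -M` is available, since the intervals are closed on the right: -M itself may be
  -- the right end point of one. Hence the extra `-1` at the lower end of `unitCover`.
  · have := Int.floor_le (-M)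
    have : (⌊-M⌋ : ℝ) ≤ ((j + 1 : ℤ) : ℝ) := by push_cast; linarith [hj.2]
    have : ⌊-M⌋ ≤ j + 1 := by exact_mod_cast this
    linarith
  · have := Int.le_ceil M
    have : (j : ℝ) ≤ (⌈M⌉ : ℝ) := by linarith [hj.1]
    exact_mod_cast this

theorem sum_unitCover_indicator {g : ℝ → ℝ} {M : ℝ} (hM : ∀ s, M < |s| → g s = 0) (s : ℝ) :
    ∑ j ∈ unitCover M, (Set.Ioc (j : ℝ) (j + 1)).indicator g s = g s := by
  by_cases h0 : g s = 0
  · rw [h0]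
    exact Finset.sum_eq_zero fun j _ => by simp [Set.indicator_apply, h0]
  have hs : |s| ≤ M := not_lt.1 fun h => h0 (hM s h)
  have hmem : s ∈ Set.Ioc (((⌈s⌉ - 1 : ℤ) : ℝ)) ((⌈s⌉ - 1 : ℤ) + 1) := by
    have h1 := Int.le_ceil s
    have h2 := Int.ceil_lt_add_one s
    constructor <;> push_cast <;> linarith
  rw [Finset.sum_eq_single_of_mem (⌈s⌉ - 1) (mem_unitCover hs hmem)]
  · rw [Set.indicator_of_mem hmem]
  · intro j _ hj
    refine Set.indicator_of_notMem (fun hmem' => hj ?_) _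
    have h1 : (j : ℝ) < ((⌈s⌉ - 1 : ℤ) : ℝ) + 1 := hmem'.1.trans_le hmem.2
    have h2 : ((⌈s⌉ - 1 : ℤ) : ℝ) < (j : ℝ) + 1 := hmem.1.trans_le hmem'.2
    have h1' : j < (⌈s⌉ - 1) + 1 := by exact_mod_cast h1
    have h2' : ⌈s⌉ - 1 < j + 1 := by exact_mod_cast h2
    omega

namespace HasCorrBound

variable {P : Measure Ω} {γ : ℕ → Ω → E} {ψ : T → ℕ → ℝ → E → ℝ} {a : ℝ}

/-- Convergence of means on half-lines identifies the intensity of the limit as Lebesgue measure on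
(x, y], whence L¹ convergence for every test function. It upgrades to L² because the masses have
some L² limit by `exists_limit`, and limits in measure are almost surely unique. -/
theorem exists_limitMeasure_Ioc_test (h : HasCorrBound P γ ψ a) (τ : T)
    (hz : ∀ k s, ∀ᵐ ω ∂P, ψ τ k s (γ k ω) ≠ 0) {x y : ℚ} (hxy : x < y) :
    ∃ m : Ω → Measure ℝ, Measurable m ∧ (∀ ω, IsFiniteMeasure (m ω)) ∧
      (∀ ω, m ω (Set.Ioc (x : ℝ) y)ᶜ = 0) ∧ ∀ g : ℝ → ℝ, IsTest g →
        MemLp (fun ω => ∫ s, g s ∂(m ω)) 2 P ∧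
        Tendsto (fun n => eLpNorm (partialMass γ (ψ τ) n ((Set.Ioc (x : ℝ) y).indicator g)
            - fun ω => ∫ s, g s ∂(m ω)) 2 P) atTop (𝓝 0) := by
  have hP := (h.field τ).isProbabilityMeasure
  obtain ⟨m, hmm, hmf, hmc, hm⟩ := h.exists_limitMeasure_Ioc τ hz hxy
  refine ⟨m, hmm, hmf, hmc, ?_⟩
  set I : Set ℝ := Set.Ioc (x : ℝ) y with hI
  have hIm : MeasurableSet I := measurableSet_Ioc
  have hIb : Bornology.IsBounded I := Metric.isBounded_Ioc _ _
  have hIfin : volume I ≠ ∞ := by simp [hI]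
  have hIi : IsFiniteMeasure (volume.restrict I) := ⟨by simpa using hIfin.lt_top⟩
  have htest : ∀ q : ℚ, IsTest ((I ∩ Set.Iic (q : ℝ)).indicator 1) := fun q =>
    isTest_indicator (hIm.inter measurableSet_Iic) (hIb.subset Set.inter_subset_left)
  have huy : ∀ ω, m ω Set.univ = m ω (Set.Iic (y : ℝ)) := fun ω => by
    rw [← measure_inter_conull (hmc ω) (s := Set.univ), ← measure_inter_conull (hmc ω)
      (s := Set.Iic (y : ℝ))]
    congr 1
    ext s; simp [hI]
  have hIy : I ∩ Set.Iic (y : ℝ) = I := Set.inter_eq_left.2 fun s hs => hs.2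
  have hbind : ∀ q : ℚ, P.bind m (Set.Iic (q : ℝ)) = volume.restrict I (Set.Iic (q : ℝ)) := by
    intro q
    rw [Measure.bind_apply measurableSet_Iic hmm.aemeasurable]
    have e1 : ∀ ω, m ω (Set.Iic (q : ℝ)) = ENNReal.ofReal ((m ω).real (Set.Iic (q : ℝ))) :=
      fun ω => by have := hmf ω; simp
    simp_rw [e1]
    rw [← ofReal_integral_eq_lintegral_ofReal ((hm q).1.integrable (by norm_num))
      (ae_of_all _ fun ω => measureReal_nonneg),
      (h.field τ).integral_limit (htest q).integrable (hm q).1 (hm q).2,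
      integral_indicator_one (hIm.inter measurableSet_Iic), Measure.restrict_apply measurableSet_Iic,
      Set.inter_comm, ofReal_measureReal]
  have hint : HasIntensity P m (volume.restrict I) := by
    refine ⟨hmm, (ext_of_generate_finite _
      ((BorelSpace.measurable_eq (α := ℝ)).trans Real.borel_eq_generateFrom_Iic_rat)
      Real.isPiSystem_Iic_rat ?_ ?_).symm⟩
    · intro s hs
      obtain ⟨q, hq⟩ := Set.mem_iUnion.1 hs
      rw [Set.mem_singleton_iff.1 hq, hbind q]
    · have e1 : P.bind m Set.univ = P.bind m (Set.Iic (y : ℝ)) := by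
        rw [Measure.bind_apply MeasurableSet.univ hmm.aemeasurable,
          Measure.bind_apply measurableSet_Iic hmm.aemeasurable]
        simp_rw [huy]
      rw [e1, hbind y, Measure.restrict_apply MeasurableSet.univ,
        Measure.restrict_apply measurableSet_Iic, Set.univ_inter, Set.inter_comm, hIy]
  have hIic : ∀ q : ℚ, IsUnitField.MassConv P γ (ψ τ) m I ((Set.Iic (q : ℝ)).indicator 1) := by
    intro q
    refine tendsto_of_tendsto_of_tendsto_of_le_of_le tendsto_const_nhds (hm q).2
      (fun n => zero_le) fun n => ?_
    have e1 : ∀ ω, ∫ s, (Set.Iic (q : ℝ)).indicator 1 s ∂(m ω) = (m ω).real (Set.Iic (q : ℝ)) :=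
      fun ω => integral_indicator_one measurableSet_Iic
    simp only
    simp_rw [e1]
    rw [Set.indicator_indicator]
    exact eLpNorm_le_eLpNorm_of_exponent_le (by norm_num)
      (((h.field τ).memLp_partialMass n (htest q).integrable 2).1.sub (hm q).1.1)
  have huniv : IsUnitField.MassConv P γ (ψ τ) m I 1 := by
    have := hIic y
    unfold IsUnitField.MassConv at this ⊢
    rw [Set.indicator_indicator, hIy] at this
    convert this using 5 with n ω
    rw [integral_indicator_one measurableSet_Iic]
    simp [Measure.real, huy]
  intro g hg
  have hgI := hg.indicator hIm
  obtain ⟨L, hLm, hL2, hL⟩ := h.exists_limit τ hgI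
  have hM := fun n => ((h.field τ).memLp_partialMass n hgI.integrable 2).1
  have hconv := IsUnitField.MassConv.of_integrable (h.field τ) hIm hIfin hint huniv hIic hg.meas
    hg.integrable.integrableOn
  have hae := tendstoInMeasure_ae_unique
    (tendstoInMeasure_of_tendsto_eLpNorm (by norm_num) hM hL2.1 hL)
    (tendstoInMeasure_of_tendsto_eLpNorm (by norm_num) hM
      (hint.aestronglyMeasurable_integral hg.meas hg.integrable.integrableOn) hconv)
  refine ⟨(memLp_congr_ae hae).1 hL2, hL.congr fun n => eLpNorm_congr_ae ?_⟩
  filter_upwards [hae] with ω hω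
  simp [hω]

/-- The limiting random measure. -/
theorem exists_limitMeasure (h : HasCorrBound P γ ψ a) (τ : T)
    (hz : ∀ k s, ∀ᵐ ω ∂P, ψ τ k s (γ k ω) ≠ 0) :
    ∃ m : Ω → Measure ℝ, Measurable m ∧ (∀ ω, IsLocallyFiniteMeasure (m ω)) ∧
      (∀ g : ℝ → ℝ, IsTest g → MemLp (fun ω => ∫ s, g s ∂(m ω)) 2 P ∧
        Tendsto (fun n => eLpNorm (partialMass γ (ψ τ) n g
            - fun ω => ∫ s, g s ∂(m ω)) 2 P) atTop (𝓝 0)) ∧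
      ∀ᵐ ω ∂P, (m ω).support = Set.univ := by
  have hP := (h.field τ).isProbabilityMeasure
  choose m hmm hmf hmc hm using fun j : ℤ =>
    h.exists_limitMeasure_Ioc_test τ hz (x := j) (y := j + 1) (by simp)
  simp only [Rat.cast_add, Rat.cast_intCast, Rat.cast_one] at hmc hm
  set ν : Ω → Measure ℝ := fun ω => Measure.sum fun j => m j ω with hν
  have hνm : Measurable ν := Measure.measurable_of_measurable_coe _ fun s hs => by
    simp only [hν, Measure.sum_apply _ hs]
    exact Measurable.tsum fun j => (Measure.measurable_coe hs).comp (hmm j)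
  have hνf : ∀ M ω, ν ω (Set.Icc (-M) M) < ∞ := fun M ω => by
    simp only [hν, Measure.sum_apply _ measurableSet_Icc]
    rw [tsum_eq_sum (s := unitCover M)]
    · exact ENNReal.sum_lt_top.2 fun j _ => by have := hmf j ω; exact measure_lt_top _ _
    · intro j hj
      exact measure_mono_null (t := (Set.Ioc (j : ℝ) (j + 1))ᶜ)
        (fun s hs hs' => hj (mem_unitCover (abs_le.2 hs) hs')) (hmc j ω)
  have hνl : ∀ ω, IsLocallyFiniteMeasure (ν ω) := fun ω =>
    ⟨fun x => ⟨Set.Icc (-(|x| + 1)) (|x| + 1), Icc_mem_nhds (by linarith [neg_abs_le x])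
      (by linarith [le_abs_self x]), hνf _ ω⟩⟩
  have hνint : ∀ g : ℝ → ℝ, IsTest g → ∀ M, (∀ s, M < |s| → g s = 0) → ∀ ω,
      ∫ s, g s ∂(ν ω) = ∑ j ∈ unitCover M, ∫ s, g s ∂(m j ω) := by
    intro g hg M hM ω
    have hgi : Integrable g (ν ω) := by
      obtain ⟨C, hC⟩ := hg.bdd
      have : IntegrableOn g (Set.Icc (-M) M) (ν ω) :=
        Measure.integrableOn_of_bounded (M := C) (hνf M ω).ne hg.meas.aestronglyMeasurable
          (ae_of_all _ hC)
      refine (integrableOn_iff_integrable_of_support_subset fun s hs => ?_).1 this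
      by_contra h
      exact hs (hM s (by simpa [← abs_le] using h))
    rw [hν, integral_sum_measure hgi, tsum_eq_sum (s := unitCover M)]
    intro j hj
    exact integral_eq_zero_of_ae (measure_mono_null (t := (Set.Ioc (j : ℝ) (j + 1))ᶜ)
      (fun s hs hs' => hj (mem_unitCover (not_lt.1 fun h => hs (hM s h)) hs')) (hmc j ω))
  have hmain : ∀ g : ℝ → ℝ, IsTest g → MemLp (fun ω => ∫ s, g s ∂(ν ω)) 2 P ∧
        Tendsto (fun n => eLpNorm (partialMass γ (ψ τ) n g
            - fun ω => ∫ s, g s ∂(ν ω)) 2 P) atTop (𝓝 0) := by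
    intro g hg
    obtain ⟨M, hM⟩ := hg.supp
    simp_rw [hνint g hg M hM]
    refine ⟨memLp_finsetSum _ fun j _ => (hm j g hg).1, ?_⟩
    have hlim : Tendsto (fun n => ∑ j ∈ unitCover M, eLpNorm (partialMass γ (ψ τ) n
        ((Set.Ioc (j : ℝ) (j + 1)).indicator g) - fun ω => ∫ s, g s ∂(m j ω)) 2 P) atTop (𝓝 0) := by
      simpa using tendsto_finsetSum (unitCover M) fun j _ => (hm j g hg).2
    refine tendsto_of_tendsto_of_tendsto_of_le_of_le tendsto_const_nhds hlim
      (fun n => zero_le) fun n => ?_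
    have hgI := fun j : ℤ => hg.indicator (measurableSet_Ioc (a := (j : ℝ)) (b := j + 1))
    refine le_trans (le_of_eq ?_) (eLpNorm_sum_le (fun j _ =>
      ((h.field τ).memLp_partialMass n (hgI j).integrable 2).1.sub (hm j g hg).1.1) (by norm_num))
    congr 1
    ext ω
    simp only [Pi.sub_apply, Finset.sum_apply, Finset.sum_sub_distrib]
    congr 1
    simp only [partialMass]
    rw [← integral_finsetSum _ fun j _ =>
      (h.field τ).integrable_mul_partialField n (hgI j).integrable ω]
    congr 1 with s
    rw [← Finset.sum_mul, sum_unitCover_indicator hM]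
  refine ⟨ν, hνm, hνl, hmain, ?_⟩
  -- One null set serves all rational intervals, and every neighbourhood of a real point contains
  -- such an interval.
  have hpos : ∀ᵐ ω ∂P, ∀ p q : ℚ, p < q → 0 < ν ω (Set.Ioo (p : ℝ) q) := by
    rw [ae_all_iff]; intro p; rw [ae_all_iff]; intro q
    by_cases hpq : p < q
    · have hpq' : (p : ℝ) < q := by exact_mod_cast hpq
      have hg := isTest_indicator (measurableSet_Ioo (a := (p : ℝ)) (b := q))
        (Metric.isBounded_Ioo _ _)
      obtain ⟨h2, hlim⟩ := hmain _ hg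
      have e := h2.1.ae_eq_mk
      have := h.limit_pos τ hz hg (fun s => Set.indicator_nonneg (fun _ _ => zero_le_one) s)
        (by rw [integral_indicator_one measurableSet_Ioo]; simpa using hpq)
        h2.1.stronglyMeasurable_mk.measurable ((memLp_congr_ae e).1 h2)
        (hlim.congr fun n => eLpNorm_congr_ae (by
          filter_upwards [e] with ω hω; simp only [Pi.sub_apply]; rw [hω]))
      filter_upwards [this, e] with ω h1 h2 _
      rw [← h2, integral_indicator_one measurableSet_Ioo] at h1
      exact (ENNReal.toReal_pos_iff.1 h1).1
    · simp [hpq]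
  filter_upwards [hpos] with ω hω
  refine Set.eq_univ_of_forall fun x => (Measure.mem_support_iff_forall x).2 fun U hU => ?_
  obtain ⟨l, u, hx, hlu⟩ := mem_nhds_iff_exists_Ioo_subset.1 hU
  obtain ⟨p, hp1, hp2⟩ := exists_rat_btwn hx.1
  obtain ⟨q, hq1, hq2⟩ := exists_rat_btwn hx.2
  refine (hω p q (by exact_mod_cast hp2.trans hq1)).trans_le (measure_mono ?_)
  exact (Set.Ioo_subset_Ioo hp1.le hq2.le).trans hlu

end HasCorrBound

end RandomEuler

end

/-! ### Infinite products as limit fields, and continuity in the parameter -/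

noncomputable section

namespace RandomEuler

variable {Ω E T : Type*} [MeasurableSpace Ω] [MeasurableSpace E]

theorem eLpNorm_two_sq {P : Measure Ω} (f : Ω → ℝ) :
    eLpNorm f 2 P ^ 2 = ∫⁻ ω, ‖f ω‖ₑ ^ 2 ∂P := by
  have := eLpNorm_nnreal_pow_eq_lintegral (μ := P) (f := f) (p := 2) (by norm_num)
  simpa using this

/-- Cauchy-Schwarz for integrals of a random field against a test function. -/
theorem lintegral_enorm_integral_sq_le {P : Measure Ω} [SFinite P] {g : ℝ → ℝ} {C M : ℝ}
    (hC : ∀ s, |g s| ≤ C) (hM : ∀ s, M < |s| → g s = 0) {D : ℝ → Ω → ℝ}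
    (hD : Measurable (Function.uncurry D)) {d : ℝ≥0∞} (hd : ∀ s, ∫⁻ ω, ‖D s ω‖ₑ ^ 2 ∂P ≤ d) :
    ∫⁻ ω, ‖∫ s, g s * D s ω‖ₑ ^ 2 ∂P
      ≤ (ENNReal.ofReal C * volume (Set.Icc (-M) M)) ^ 2 * d := by
  set ν := volume.restrict (Set.Icc (-M) M) with hν
  have hνu : ν Set.univ = volume (Set.Icc (-M) M) := by simp [hν]
  have hDω : ∀ ω, Measurable fun s => D s ω := fun ω => hD.comp measurable_prodMk_right
  have h1 : ∀ ω, ‖∫ s, g s * D s ω‖ₑ ≤ ENNReal.ofReal C * eLpNorm (fun s => D s ω) 1 ν := by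
    intro ω
    have e : ∫ s, g s * D s ω = ∫ s, g s * D s ω ∂ν := by
      rw [hν, setIntegral_eq_integral_of_forall_compl_eq_zero]
      intro s hs
      rw [hM s (by simpa [← abs_le] using hs), zero_mul]
    rw [e, eLpNorm_one_eq_lintegral_enorm, ← lintegral_const_mul' _ _ ENNReal.ofReal_ne_top]
    refine (enorm_integral_le_lintegral_enorm _).trans (lintegral_mono fun s => ?_)
    rw [enorm_mul]
    gcongr
    rw [Real.enorm_eq_ofReal_abs]
    exact ENNReal.ofReal_le_ofReal (hC s)
  have h2 : ∀ ω, ‖∫ s, g s * D s ω‖ₑ ^ 2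
      ≤ ENNReal.ofReal C ^ 2 * volume (Set.Icc (-M) M) * ∫⁻ s, ‖D s ω‖ₑ ^ 2 ∂ν := by
    intro ω
    have e := eLpNorm_le_eLpNorm_mul_rpow_measure_univ (μ := ν) (p := 1) (q := 2) (by norm_num)
      (hDω ω).aestronglyMeasurable
    have e2 : (ν Set.univ ^ (1 / (1 : ℝ≥0∞).toReal - 1 / (2 : ℝ≥0∞).toReal)) ^ 2
        = volume (Set.Icc (-M) M) := by
      rw [hνu, ← ENNReal.rpow_natCast, ← ENNReal.rpow_mul]
      norm_num
    calc _ ≤ (ENNReal.ofReal C * (eLpNorm (fun s => D s ω) 2 ν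
          * ν Set.univ ^ (1 / (1 : ℝ≥0∞).toReal - 1 / (2 : ℝ≥0∞).toReal))) ^ 2 := by
          gcongr
          exact (h1 ω).trans (by gcongr)
      _ = _ := by
          rw [mul_pow, mul_pow, e2, eLpNorm_two_sq]
          ring
  have hsq : Measurable fun x : ℝ × Ω => ‖D x.1 x.2‖ₑ ^ 2 := hD.enorm.pow_const 2
  have hsq' : Measurable (Function.uncurry fun ω s => ‖D s ω‖ₑ ^ 2) := hsq.comp measurable_swap
  calc _ ≤ ∫⁻ ω, ENNReal.ofReal C ^ 2 * volume (Set.Icc (-M) M) * ∫⁻ s, ‖D s ω‖ₑ ^ 2 ∂ν ∂P :=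
        lintegral_mono h2
    _ = ENNReal.ofReal C ^ 2 * volume (Set.Icc (-M) M) * ∫⁻ ω, ∫⁻ s, ‖D s ω‖ₑ ^ 2 ∂ν ∂P :=
        lintegral_const_mul _ hsq'.lintegral_prod_right
    _ = ENNReal.ofReal C ^ 2 * volume (Set.Icc (-M) M) * ∫⁻ s, ∫⁻ ω, ‖D s ω‖ₑ ^ 2 ∂P ∂ν := by
        rw [lintegral_lintegral_swap hsq'.aemeasurable]
    _ ≤ ENNReal.ofReal C ^ 2 * volume (Set.Icc (-M) M) * ∫⁻ _s, d ∂ν := by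
        gcongr with s
        exact hd s
    _ = _ := by
        rw [lintegral_const, hνu]
        ring

namespace IsUnitField

variable {P : Measure Ω} {γ : ℕ → Ω → E} {ψ : ℕ → ℝ → E → ℝ}

/-- `X` is the limit in `L^2`, uniformly on `ℝ`, of the partial products. -/
structure IsLimitField (P : Measure Ω) (γ : ℕ → Ω → E) (ψ : ℕ → ℝ → E → ℝ) (X : ℝ → Ω → ℝ) :
    Prop where
  meas : Measurable (Function.uncurry X)
  approx : ∃ d : ℕ → ℝ≥0∞, Tendsto d atTop (𝓝 0) ∧
    ∀ n s, ∫⁻ ω, ‖X s ω - partialField γ ψ n s ω‖ₑ ^ 2 ∂P ≤ d n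

theorem IsLimitField.tendsto (h : IsUnitField P γ ψ) {X : ℝ → Ω → ℝ}
    (hX : IsLimitField P γ ψ X) {g : ℝ → ℝ} (hg : IsTest g) :
    MemLp (fun ω => ∫ s, g s * X s ω) 2 P ∧
      Tendsto (fun n => eLpNorm ((fun ω => ∫ s, g s * X s ω) - partialMass γ ψ n g) 2 P)
        atTop (𝓝 0) := by
  have hP := h.isProbabilityMeasure
  obtain ⟨C, hC⟩ := hg.bdd
  obtain ⟨M, hM⟩ := hg.supp
  obtain ⟨d, hd, hXd⟩ := hX.approx
  set K := (ENNReal.ofReal C * volume (Set.Icc (-M) M)) ^ 2 with hK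
  have hKtop : K ≠ ∞ := by
    simp only [hK, Real.volume_Icc]
    finiteness
  have hDm : ∀ n, Measurable (Function.uncurry fun s ω => X s ω - partialField γ ψ n s ω) :=
    fun n => hX.meas.sub (h.measurable_partialField n)
  have hb : ∀ n, ∫⁻ ω, ‖∫ s, g s * (X s ω - partialField γ ψ n s ω)‖ₑ ^ 2 ∂P ≤ K * d n :=
    fun n => lintegral_enorm_integral_sq_le hC hM (hDm n) (hXd n)
  -- A single index with finite error suffices for integrability: `X` differs from a bounded field
  -- by one that is square integrable in (s, ω) over [-M, M] × Ω, so almost surely it is integrable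
  -- in s there.
  obtain ⟨n₀, hn₀⟩ : ∃ n, d n < ∞ := (hd.eventually_lt_const ENNReal.zero_lt_top).exists
  have hint : ∀ᵐ ω ∂P, Integrable fun s => g s * X s ω := by
    have h1 : ∫⁻ s in Set.Icc (-M) M, ∫⁻ ω, ‖X s ω - partialField γ ψ n₀ s ω‖ₑ ^ 2 ∂P < ∞ := by
      refine (lintegral_mono (hXd n₀)).trans_lt ?_
      rw [lintegral_const]
      simp only [Measure.restrict_apply_univ, Real.volume_Icc]
      finiteness
    have hsq : Measurable fun x : ℝ × Ω => ‖X x.1 x.2 - partialField γ ψ n₀ x.1 x.2‖ₑ ^ 2 :=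
      (hDm n₀).enorm.pow_const 2
    rw [lintegral_lintegral_swap hsq.aemeasurable] at h1
    have h2 := ae_lt_top' (hsq.lintegral_prod_left' (μ := volume.restrict (Set.Icc (-M) M))).aemeasurable h1.ne
    filter_upwards [h2] with ω hω
    have hDi : IntegrableOn (fun s => X s ω - partialField γ ψ n₀ s ω) (Set.Icc (-M) M) := by
      have hmem : MemLp (fun s => X s ω - partialField γ ψ n₀ s ω) 2
          (volume.restrict (Set.Icc (-M) M)) := by
        refine ⟨((hDm n₀).comp measurable_prodMk_right).aestronglyMeasurable, ?_⟩
        rw [← eLpNorm_two_sq] at hω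
        exact lt_of_not_ge fun h' => by simp [top_le_iff.1 h'] at hω
      have : IsFiniteMeasure (volume.restrict (Set.Icc (-M) M)) := ⟨by simp⟩
      exact hmem.integrable (by norm_num)
    have h3 : IntegrableOn (fun s => g s * (X s ω - partialField γ ψ n₀ s ω))
        (Set.Icc (-M) M) := by
      refine (Integrable.bdd_mul (c := C) hDi hg.meas.aestronglyMeasurable (ae_of_all _ hC))
    have h4 : Integrable (fun s => g s * (X s ω - partialField γ ψ n₀ s ω)) := by
      refine (integrableOn_iff_integrable_of_support_subset fun s hs => ?_).1 h3
      by_contra h'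
      exact hs (by simp [hM s (by simpa [← abs_le] using h')])
    refine (h4.add (h.integrable_mul_partialField n₀ hg.integrable ω)).congr
      (ae_of_all _ fun s => ?_)
    simp only [Pi.add_apply]
    ring
  have hmeas : AEStronglyMeasurable (fun ω => ∫ s, g s * X s ω) P := by
    have : StronglyMeasurable (fun x : Ω × ℝ => g x.2 * X x.2 x.1) :=
      ((hg.meas.comp measurable_snd).mul (hX.meas.comp measurable_swap)).stronglyMeasurable
    exact (this.integral_prod_right (ν := volume)).aestronglyMeasurable
  have hsub : ∀ n, eLpNorm ((fun ω => ∫ s, g s * X s ω) - partialMass γ ψ n g) 2 P ^ 2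
      ≤ K * d n := fun n => by
    rw [eLpNorm_two_sq]
    refine le_trans (le_of_eq (lintegral_congr_ae ?_)) (hb n)
    filter_upwards [hint] with ω hω
    congr 2
    rw [Pi.sub_apply, partialMass, ← integral_sub hω
      (h.integrable_mul_partialField n hg.integrable ω)]
    congr 1 with s
    ring
  have hlim : Tendsto (fun n => eLpNorm ((fun ω => ∫ s, g s * X s ω)
      - partialMass γ ψ n g) 2 P) atTop (𝓝 0) := by
    have h1 : Tendsto (fun n => (K * d n) ^ (2 : ℝ)⁻¹) atTop (𝓝 0) := by
      have := ((ENNReal.Tendsto.const_mul hd (Or.inr hKtop)).ennrpow_const (2 : ℝ)⁻¹)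
      simpa using this
    refine tendsto_of_tendsto_of_tendsto_of_le_of_le tendsto_const_nhds h1 (fun n => zero_le)
      fun n => ?_
    simp only
    rw [ENNReal.le_rpow_inv_iff (by norm_num)]
    simpa using hsub n
  refine ⟨?_, hlim⟩
  obtain ⟨n, hn⟩ := (hlim.eventually_lt_const ENNReal.zero_lt_top).exists
  have : MemLp ((fun ω => ∫ s, g s * X s ω) - partialMass γ ψ n g) 2 P :=
    ⟨hmeas.sub (h.memLp_partialMass n hg.integrable 2).1, hn⟩
  simpa using this.add (h.memLp_partialMass n hg.integrable 2)

end IsUnitField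

namespace HasCorrBound

variable {P : Measure Ω} {γ : ℕ → Ω → E} {ψ : T → ℕ → ℝ → E → ℝ} {a : ℝ}

theorem tendsto_partialMass_param (h : HasCorrBound P γ ψ a) {l : Filter T}
    [l.IsCountablyGenerated] {τ₀ : T}
    (hbd : ∀ k, ∃ B, ∀ τ s z, ψ τ k s z ≤ B)
    (hlim : ∀ k s z, Tendsto (fun τ => ψ τ k s z) l (𝓝 (ψ τ₀ k s z))) (n : ℕ) {g : ℝ → ℝ}
    (hg : Integrable g) :
    Tendsto (fun τ => eLpNorm (partialMass γ (ψ τ) n g - partialMass γ (ψ τ₀) n g) 2 P) l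
      (𝓝 0) := by
  have hP := (h.field τ₀).isProbabilityMeasure
  have hm := fun τ => (h.field τ).memLp_partialMass n hg 2
  rw [tendsto_eLpNorm_two_iff (fun τ => (hm τ).sub (hm τ₀))]
  choose B hB using hbd
  set B' := ∏ k ∈ Finset.range n, B k with hB'
  have hle : ∀ τ s ω, ‖partialField γ (ψ τ) n s ω‖ ≤ B' := fun τ s ω => by
    rw [Real.norm_of_nonneg ((h.field τ).partialField_nonneg n s ω)]
    exact Finset.prod_le_prod (fun k _ => (h.field τ).nonneg k _ _) (fun k _ => hB k _ _ _)
  have hpt : ∀ ω, Tendsto (fun τ => partialMass γ (ψ τ) n g ω) l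
      (𝓝 (partialMass γ (ψ τ₀) n g ω)) := fun ω => by
    refine tendsto_integral_filter_of_dominated_convergence (fun s => |g s| * B')
      (Eventually.of_forall fun τ =>
        ((h.field τ).integrable_mul_partialField n hg ω).aestronglyMeasurable)
      (Eventually.of_forall fun τ => ae_of_all _ fun s => ?_) (hg.abs.mul_const _)
      (ae_of_all _ fun s => ?_)
    · rw [norm_mul]
      exact mul_le_mul_of_nonneg_left (hle τ s ω) (norm_nonneg _)
    · exact (tendsto_finsetProd _ fun k _ => hlim k s (γ k ω)).const_mul _
  have hbound : ∀ τ ω, |partialMass γ (ψ τ) n g ω| ≤ ∫ s, |g s| * B' := fun τ ω => by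
    rw [← Real.norm_eq_abs]
    refine norm_integral_le_of_norm_le (hg.abs.mul_const _) (ae_of_all _ fun s => ?_)
    rw [norm_mul]
    exact mul_le_mul_of_nonneg_left (hle τ s ω) (norm_nonneg _)
  set A := ∫ s, |g s| * B' with hA
  have := tendsto_integral_filter_of_dominated_convergence (μ := P) (l := l)
    (F := fun τ ω => ((partialMass γ (ψ τ) n g - partialMass γ (ψ τ₀) n g) ω) ^ 2)
    (f := fun _ => (0 : ℝ)) (fun _ => (A + A) ^ 2)
    (Eventually.of_forall fun τ => (((hm τ).sub (hm τ₀)).1.pow 2))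
    (Eventually.of_forall fun τ => ae_of_all _ fun ω => ?_) (integrable_const _)
    (ae_of_all _ fun ω => ?_)
  · simpa using this
  · rw [norm_pow]
    refine pow_le_pow_left₀ (norm_nonneg _) ?_ 2
    exact (norm_sub_le _ _).trans (add_le_add (hbound τ ω) (hbound τ₀ ω))
  · simpa using ((hpt ω).sub_const (partialMass γ (ψ τ₀) n g ω)).pow 2

/-- The masses of the limit fields converge to the limiting mass as the parameter varies. -/
theorem tendsto_limitField (h : HasCorrBound P γ ψ a) {l : Filter T}
    [l.IsCountablyGenerated] {τ₀ : T}
    (hbd : ∀ k, ∃ B, ∀ τ s z, ψ τ k s z ≤ B)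
    (hlim : ∀ k s z, Tendsto (fun τ => ψ τ k s z) l (𝓝 (ψ τ₀ k s z)))
    {X : T → ℝ → Ω → ℝ} (hX : ∀ᶠ τ in l, IsUnitField.IsLimitField P γ (ψ τ) (X τ))
    {g : ℝ → ℝ} (hg : IsTest g) {L : Ω → ℝ} (hL2 : MemLp L 2 P)
    (hL : Tendsto (fun n => eLpNorm (partialMass γ (ψ τ₀) n g - L) 2 P) atTop (𝓝 0)) :
    Tendsto (fun τ => eLpNorm ((fun ω => ∫ s, g s * X τ s ω) - L) 2 P) l (𝓝 0) := by
  refine ENNReal.tendsto_nhds_zero.2 fun ε hε => ?_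
  have hε3 : 0 < ε / 3 := by simpa [pos_iff_ne_zero] using hε.ne'
  -- `N` is uniform in τ. So one `n ≥ N` approximates the limit at `τ₀` and the mass of the limit
  -- field at every τ where it exists; only with `n` fixed is τ sent to its limit.
  obtain ⟨N, hN⟩ := eventually_tailFilter.1
    (ENNReal.tendsto_nhds_zero.1 (h.tendsto_eLpNorm_sub hg) _ hε3)
  obtain ⟨n, hn, hnN⟩ := ((ENNReal.tendsto_nhds_zero.1 hL _ hε3).and
    (eventually_ge_atTop N)).exists
  filter_upwards [hX, ENNReal.tendsto_nhds_zero.1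
    (h.tendsto_partialMass_param hbd hlim n hg.integrable) _ hε3] with τ hXτ hτ
  obtain ⟨h1, h2⟩ := hXτ.tendsto (h.field τ) hg
  have hm := fun τ n => ((h.field τ).memLp_partialMass n hg.integrable 2).1
  have h3 : eLpNorm ((fun ω => ∫ s, g s * X τ s ω) - partialMass γ (ψ τ) n g) 2 P ≤ ε / 3 := by
    have h4 : Tendsto (fun m => eLpNorm ((fun ω => ∫ s, g s * X τ s ω)
        - partialMass γ (ψ τ) m g) 2 P + ε / 3) atTop (𝓝 (0 + ε / 3)) := h2.add_const _
    rw [zero_add] at h4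
    refine ge_of_tendsto h4 ?_
    filter_upwards [eventually_ge_atTop n] with m hmn
    have h5 := hN n m τ hnN hmn
    refine le_trans ?_ (add_le_add_right h5 _)
    rw [show (fun ω => ∫ s, g s * X τ s ω) - partialMass γ (ψ τ) n g
      = ((fun ω => ∫ s, g s * X τ s ω) - partialMass γ (ψ τ) m g)
        + (partialMass γ (ψ τ) m g - partialMass γ (ψ τ) n g) by abel]
    exact eLpNorm_add_le (h1.1.sub (hm τ m)) ((hm τ m).sub (hm τ n)) (by norm_num)
  rw [show (fun ω => ∫ s, g s * X τ s ω) - L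
      = ((fun ω => ∫ s, g s * X τ s ω) - partialMass γ (ψ τ) n g)
        + ((partialMass γ (ψ τ) n g - partialMass γ (ψ τ₀) n g)
        + (partialMass γ (ψ τ₀) n g - L)) by abel, ← ENNReal.add_thirds ε, add_assoc]
  refine (eLpNorm_add_le (h1.1.sub (hm τ n)) (((hm τ n).sub (hm τ₀ n)).add ((hm τ₀ n).sub hL2.1))
    (by norm_num)).trans (add_le_add h3 ?_)
  exact (eLpNorm_add_le ((hm τ n).sub (hm τ₀ n)) ((hm τ₀ n).sub hL2.1)
    (by norm_num)).trans (add_le_add hτ hn)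

end HasCorrBound

end RandomEuler

end

/-! ### Martingale convergence of random products -/

noncomputable section

namespace RandomEuler

variable {Ω E : Type*} [MeasurableSpace Ω] [MeasurableSpace E]

/-- The natural filtration of a sequence of random variables. -/
def seqFiltration {γ : ℕ → Ω → E} (hγ : ∀ k, Measurable (γ k)) :
    Filtration ℕ (inferInstance : MeasurableSpace Ω) where
  seq n := ⨆ k ∈ Set.Iio n, MeasurableSpace.comap (γ k) inferInstance
  mono' _ _ h := biSup_mono fun _ hk => lt_of_lt_of_le hk h
  le' _ := iSup₂_le fun k _ => (hγ k).comap_le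

/-- Almost sure convergence of an `L^2`-bounded product of independent mean-one factors. -/
theorem ae_exists_tendsto_prod {P : Measure Ω} {γ : ℕ → Ω → E} (hind : iIndepFun γ P)
    (hγ : ∀ k, Measurable (γ k)) {D : ℕ → E → ℂ} (hD : ∀ k, Measurable (D k))
    (hbd : ∀ k, ∃ B, ∀ z, ‖D k z‖ ≤ B) (hmean : ∀ k, ∫ ω, D k (γ k ω) ∂P = 1) {R : ℝ}
    (hR : ∀ n, ∏ k ∈ Finset.range n, ∫ ω, ‖D k (γ k ω)‖ ^ 2 ∂P ≤ R) :
    ∀ᵐ ω ∂P, ∃ c : ℂ, Tendsto (fun n => ∏ k ∈ Finset.range n, D k (γ k ω)) atTop (𝓝 c) := by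
  have hP := hind.isProbabilityMeasure
  set A : ℕ → Ω → ℂ := fun n ω => ∏ k ∈ Finset.range n, D k (γ k ω) with hA
  set ℱ := seqFiltration hγ with hℱ
  have hγℱ : ∀ k n, k < n → @Measurable Ω E (ℱ n) _ (γ k) := fun k n hkn =>
    (comap_measurable (γ k)).mono (le_biSup (fun k => MeasurableSpace.comap (γ k) _) hkn) le_rfl
  have hadp : ∀ n, StronglyMeasurable[ℱ n] (A n) := fun n => by
    refine Measurable.stronglyMeasurable ?_
    refine Finset.measurable_fun_prod _ fun k hk => ?_
    exact (hD k).comp (hγℱ k n (Finset.mem_range.1 hk))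
  choose B hB using hbd
  have hAm : ∀ n, AEStronglyMeasurable (A n) P := fun n =>
    ((hadp n).mono (ℱ.le n)).aestronglyMeasurable
  have hAbd : ∀ n, ∀ᵐ ω ∂P, ‖A n ω‖ ≤ ∏ k ∈ Finset.range n, B k := fun n => ae_of_all _ fun ω => by
    simp only [hA]
    rw [norm_prod]
    exact Finset.prod_le_prod (fun k _ => norm_nonneg _) fun k _ => hB k _
  have hAp : ∀ n p, MemLp (A n) p P := fun n p => MemLp.of_bound (hAm n) _ (hAbd n)
  have hint : ∀ n, Integrable (A n) P := fun n => (hAp n 1).integrable le_rfl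
  -- The martingale property on sets of the past: the factor with index `n` is independent of the
  -- earlier ones and has mean one.
  have hset : ∀ n, ∀ S : Set Ω, MeasurableSet[ℱ n] S →
      ∫ ω in S, A n ω ∂P = ∫ ω in S, A (n + 1) ω ∂P := by
    intro n S hS
    have hSm := ℱ.le n S hS
    have hindep : Indep (MeasurableSpace.comap (γ n) inferInstance) (ℱ n) P := by
      have h1 := indep_iSup_of_disjoint (fun k => (hγ k).comap_le) hind
        (S := {n}) (T := Set.Iio n) (by simp)
      rwa [iSup_singleton] at h1
    have hif : IndepFun (S.indicator (A n)) (D n ∘ γ n) P := by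
      rw [IndepFun_iff_Indep]
      refine indep_of_indep_of_le_left (indep_of_indep_of_le_right hindep.symm ?_) ?_
      · exact ((hD n).comp (comap_measurable (γ n))).comap_le
      · exact ((hadp n).measurable.indicator hS).comap_le
    have hm := hif.integral_mul_eq_mul_integral ((hAm n).indicator hSm)
      ((hD n).comp (hγ n)).aestronglyMeasurable
    rw [← integral_indicator hSm, ← integral_indicator hSm]
    have e : (S.indicator fun ω => A (n + 1) ω) = S.indicator (A n) * (D n ∘ γ n) := by
      ext ω
      by_cases hω : ω ∈ S <;> simp [hω, hA, Finset.prod_range_succ]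
    rw [e, hm]
    simp only [Function.comp_apply, hmean, mul_one]
  have hsq : ∀ n, ∫ ω, ‖A n ω‖ ^ 2 ∂P ≤ R := fun n => by
    have := integral_prod_range_comp hind hγ (φ := fun k z => ‖D k z‖ ^ 2)
      (fun k => (hD k).norm.pow_const 2) n
    refine le_trans (le_of_eq ?_) (hR n)
    rw [← this]
    simp [hA, norm_prod, Finset.prod_pow]
  -- `L` will be the real and the imaginary part. Each gives a real martingale whose L¹ norms are
  -- bounded by the L² bound, so Doob's convergence theorem applies.
  have hconv : ∀ L : ℂ →L[ℝ] ℝ, ‖L‖ ≤ 1 →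
      ∀ᵐ ω ∂P, ∃ c : ℝ, Tendsto (fun n => L (A n ω)) atTop (𝓝 c) := by
    intro L hL
    have hmart : Martingale (fun n ω => L (A n ω)) ℱ P := by
      refine martingale_of_setIntegral_eq_succ (fun n => L.continuous.comp_stronglyMeasurable
        (hadp n)) (fun n => L.integrable_comp (hint n)) fun n S hS => ?_
      rw [L.integral_comp_comm (hint n).integrableOn,
        L.integral_comp_comm (hint (n + 1)).integrableOn, hset n S hS]
    have hle : ∀ n, eLpNorm (fun ω => L (A n ω)) 1 P ≤ (Real.toNNReal (√R) : ℝ≥0∞) := fun n => by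
      have h2 : MemLp (fun ω => ‖A n ω‖) 2 P := (hAp n 2).norm
      calc eLpNorm (fun ω => L (A n ω)) 1 P ≤ eLpNorm (fun ω => ‖A n ω‖) 1 P := by
            refine eLpNorm_mono fun ω => ?_
            rw [norm_norm]
            exact (L.le_of_opNorm_le hL _).trans (by simp)
        _ ≤ eLpNorm (fun ω => ‖A n ω‖) 2 P :=
            eLpNorm_le_eLpNorm_of_exponent_le (by norm_num) h2.1
        _ ≤ _ := by
            rw [eLpNorm_two_eq h2]
            exact ENNReal.ofReal_le_ofReal (Real.sqrt_le_sqrt (hsq n))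
    filter_upwards [hmart.submartingale.ae_tendsto_limitProcess hle] with ω hω
    exact ⟨_, hω⟩
  filter_upwards [hconv Complex.reCLM (by simp), hconv Complex.imCLM (by simp)]
    with ω ⟨x, hx⟩ ⟨y, hy⟩
  refine ⟨x + y * Complex.I, ?_⟩
  have h1 := (Complex.continuous_ofReal.tendsto x).comp hx
  have h2 := ((Complex.continuous_ofReal.tendsto y).comp hy).mul_const Complex.I
  refine (h1.add h2).congr fun n => ?_
  change _ = A n ω
  simp [Complex.re_add_im]

end RandomEuler

end

/-! ### Abel summation for sequences of logarithmic density -/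

noncomputable section

namespace RandomEuler

/-- The derivative of `t / log t`. -/
def logWeight (t : ℝ) : ℝ := 1 / Real.log t - 1 / Real.log t ^ 2

/-- A decreasing majorant of `|logWeight|`. -/
def logMajorant (t : ℝ) : ℝ := 1 / Real.log t + 1 / Real.log t ^ 2

theorem hasDerivAt_div_log {t : ℝ} (ht : 1 < t) :
    HasDerivAt (fun t => t / Real.log t) (logWeight t) t := by
  have hl := Real.log_pos ht
  have := (hasDerivAt_id t).div (Real.hasDerivAt_log (by linarith)) hl.ne'
  refine this.congr_deriv ?_
  simp only [logWeight, id]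
  field_simp

theorem hasDerivAt_cos_log_div (u : ℝ) {t : ℝ} (ht : 0 < t) :
    HasDerivAt (fun t => Real.cos (u * Real.log t) / t)
      (-(Real.cos (u * Real.log t) + u * Real.sin (u * Real.log t)) / t ^ 2) t := by
  have h1 := ((Real.hasDerivAt_log ht.ne').const_mul u).cos
  refine (h1.div (hasDerivAt_id t) ht.ne').congr_deriv ?_
  simp only [id]
  field_simp
  ring

theorem hasDerivAt_sin_log (u : ℝ) (hu : u ≠ 0) {t : ℝ} (ht : 0 < t) :
    HasDerivAt (fun t => Real.sin (u * Real.log t) / u) (Real.cos (u * Real.log t) / t) t := by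
  have h1 := (((Real.hasDerivAt_log ht.ne').const_mul u).sin).div_const u
  refine h1.congr_deriv ?_
  field_simp

theorem hasDerivAt_logWeight {t : ℝ} (ht : 1 < t) :
    HasDerivAt logWeight (-(1 / (t * Real.log t ^ 2)) + 2 / (t * Real.log t ^ 3)) t := by
  have hl := Real.log_pos ht
  have h0 := Real.hasDerivAt_log (show t ≠ 0 by linarith)
  have h1 := (h0.fun_inv hl.ne').fun_sub ((h0.fun_pow 2).fun_inv (by positivity))
  have e : logWeight = fun t => (Real.log t)⁻¹ - (Real.log t ^ 2)⁻¹ := by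
    ext t; simp [logWeight]
  rw [e]
  refine h1.congr_deriv ?_
  simp
  field_simp
  ring

theorem hasDerivAt_logMajorant {t : ℝ} (ht : 1 < t) :
    HasDerivAt logMajorant (-(1 / (t * Real.log t ^ 2) + 2 / (t * Real.log t ^ 3))) t := by
  have hl := Real.log_pos ht
  have h0 := Real.hasDerivAt_log (show t ≠ 0 by linarith)
  have h1 := (h0.fun_inv hl.ne').fun_add ((h0.fun_pow 2).fun_inv (by positivity))
  have e : logMajorant = fun t => (Real.log t)⁻¹ + (Real.log t ^ 2)⁻¹ := by
    ext t; simp [logMajorant]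
  rw [e]
  refine h1.congr_deriv ?_
  simp
  field_simp
  ring

theorem logMajorant_nonneg {t : ℝ} (ht : 1 < t) : 0 ≤ logMajorant t := by
  have hl := Real.log_pos ht
  unfold logMajorant
  positivity

theorem abs_logWeight_le {t : ℝ} (ht : 1 < t) : |logWeight t| ≤ logMajorant t := by
  have hl := Real.log_pos ht
  have h1 : 0 ≤ 1 / Real.log t := by positivity
  have h2 : 0 ≤ 1 / Real.log t ^ 2 := by positivity
  unfold logWeight logMajorant
  rw [abs_le]
  constructor <;> linarith

theorem continuousOn_log_Icc {a b : ℝ} (ha : 1 < a) : ContinuousOn Real.log (Set.Icc a b) :=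
  Real.continuousOn_log.mono fun t ht => by
    have : 1 < t := ha.trans_le ht.1
    simp; linarith

theorem log_ne_zero_of_mem {a b : ℝ} (ha : 1 < a) : ∀ t ∈ Set.Icc a b, Real.log t ≠ 0 :=
  fun _ ht => (Real.log_pos (ha.trans_le ht.1)).ne'

theorem ne_zero_of_mem {a b : ℝ} (ha : 1 < a) : ∀ t ∈ Set.Icc a b, t ≠ 0 :=
  fun _ ht => by linarith [ha.trans_le ht.1]

theorem continuousOn_logWeight {a b : ℝ} (ha : 1 < a) : ContinuousOn logWeight (Set.Icc a b) :=
  fun _ ht => (hasDerivAt_logWeight (ha.trans_le ht.1)).continuousAt.continuousWithinAt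

theorem continuousOn_cos_log_div {a b : ℝ} (ha : 1 < a) (u : ℝ) :
    ContinuousOn (fun t => Real.cos (u * Real.log t) / t) (Set.Icc a b) :=
  fun t ht => (hasDerivAt_cos_log_div u
    (by linarith [ht.1] : 0 < t)).continuousAt.continuousWithinAt

/-- Integration by parts with the antiderivative sin(u log t) / u gains a factor 1/|u|. The
derivative of `logWeight` is dominated by minus that of the decreasing `logMajorant`, so the
remaining integral telescopes, and its value at b cancels against the boundary term. -/
theorem abs_integral_cos_log_le {a b u : ℝ} (ha : 1 < a) (hab : a ≤ b) (hu : u ≠ 0) :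
    |∫ t in a..b, Real.cos (u * Real.log t) / t * logWeight t| ≤ 2 * logMajorant a / |u| := by
  have hI : Set.uIcc a b = Set.Icc a b := Set.uIcc_of_le hab
  have hlog := continuousOn_log_Icc (b := b) ha
  have hl0 := log_ne_zero_of_mem (b := b) ha
  have ht0 := ne_zero_of_mem (b := b) ha
  have hsub : Set.Ioo (min a b) (max a b) ⊆ Set.Icc a b := by
    rw [min_eq_left hab, max_eq_right hab]; exact Set.Ioo_subset_Icc_self
  have hwc := continuousOn_logWeight (b := b) ha
  have hcc := continuousOn_cos_log_div (b := b) ha u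
  have hw'c : ContinuousOn (fun t => -(1 / (t * Real.log t ^ 2)) + 2 / (t * Real.log t ^ 3))
      (Set.Icc a b) := by
    refine ContinuousOn.add (ContinuousOn.neg (continuousOn_const.div
      (continuousOn_id.mul (hlog.pow 2)) fun t ht => mul_ne_zero (ht0 t ht) (pow_ne_zero _ (hl0 t ht))))
      (continuousOn_const.div (continuousOn_id.mul (hlog.pow 3)) fun t ht =>
        mul_ne_zero (ht0 t ht) (pow_ne_zero _ (hl0 t ht)))
  have hsc : ContinuousOn (fun t => Real.sin (u * Real.log t) / u) (Set.Icc a b) :=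
    fun t ht => (hasDerivAt_sin_log u hu
      (by linarith [ht.1] : 0 < t)).continuousAt.continuousWithinAt
  have hMc : ContinuousOn (fun t => -(1 / (t * Real.log t ^ 2) + 2 / (t * Real.log t ^ 3)))
      (Set.Icc a b) := by
    refine ContinuousOn.neg (ContinuousOn.add (continuousOn_const.div
      (continuousOn_id.mul (hlog.pow 2)) fun t ht => mul_ne_zero (ht0 t ht) (pow_ne_zero _ (hl0 t ht)))
      (continuousOn_const.div (continuousOn_id.mul (hlog.pow 3)) fun t ht =>
        mul_ne_zero (ht0 t ht) (pow_ne_zero _ (hl0 t ht))))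
  have hmem : ∀ t ∈ Set.uIcc a b, 1 < t := fun t ht => by
    rw [hI] at ht; exact ha.trans_le ht.1
  have hparts := intervalIntegral.integral_mul_deriv_eq_deriv_mul
    (u := logWeight) (v := fun t => Real.sin (u * Real.log t) / u)
    (fun t ht => hasDerivAt_logWeight (hmem t ht))
    (fun t ht => hasDerivAt_sin_log u hu (by linarith [hmem t ht]))
    ((hI ▸ hw'c).intervalIntegrable) ((hI ▸ hcc).intervalIntegrable)
  have hM := intervalIntegral.integral_eq_sub_of_hasDerivAt
    (fun t ht => hasDerivAt_logMajorant (hmem t ht)) ((hI ▸ hMc).intervalIntegrable)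
  have hupos : 0 < |u| := abs_pos.2 hu
  have hs1 : ∀ t, |Real.sin (u * Real.log t) / u| ≤ 1 / |u| := fun t => by
    rw [abs_div]
    exact div_le_div_of_nonneg_right (Real.abs_sin_le_one _) hupos.le
  have hI2 : |∫ t in a..b, (-(1 / (t * Real.log t ^ 2)) + 2 / (t * Real.log t ^ 3)) *
      (Real.sin (u * Real.log t) / u)| ≤ (logMajorant a - logMajorant b) / |u| := by
    have h1 : (logMajorant a - logMajorant b) / |u|
        = ∫ t in a..b, (1 / (t * Real.log t ^ 2) + 2 / (t * Real.log t ^ 3)) * (1 / |u|) := by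
      rw [intervalIntegral.integral_mul_const]
      rw [intervalIntegral.integral_neg] at hM
      rw [show logMajorant a - logMajorant b = -(logMajorant b - logMajorant a) by ring, ← hM]
      ring
    rw [h1, ← Real.norm_eq_abs]
    refine intervalIntegral.norm_integral_le_of_norm_le hab (ae_of_all _ fun t ht => ?_) ?_
    · have ht1 : 1 < t := ha.trans ht.1
      have hl := Real.log_pos ht1
      rw [norm_mul, Real.norm_eq_abs, Real.norm_eq_abs]
      have h3 : 0 ≤ 1 / (t * Real.log t ^ 2) := by positivity
      have h4 : 0 ≤ 2 / (t * Real.log t ^ 3) := by positivity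
      refine mul_le_mul ?_ (hs1 t) (abs_nonneg _) (by positivity)
      rw [abs_le]
      constructor <;> linarith
    · have := ((hI ▸ hMc).intervalIntegrable (μ := volume)).neg.mul_const (1 / |u|)
      simpa using this
  have e1 : ∫ t in a..b, Real.cos (u * Real.log t) / t * logWeight t
      = ∫ t in a..b, logWeight t * (Real.cos (u * Real.log t) / t) := by
    congr 1 with t; ring
  rw [e1, hparts]
  have hb1 : 1 < b := ha.trans_le hab
  have k1 : |logWeight b * (Real.sin (u * Real.log b) / u)| ≤ logMajorant b * (1 / |u|) := by
    rw [abs_mul]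
    exact mul_le_mul (abs_logWeight_le hb1) (hs1 b) (abs_nonneg _) (logMajorant_nonneg hb1)
  have k2 : |logWeight a * (Real.sin (u * Real.log a) / u)| ≤ logMajorant a * (1 / |u|) := by
    rw [abs_mul]
    exact mul_le_mul (abs_logWeight_le ha) (hs1 a) (abs_nonneg _) (logMajorant_nonneg ha)
  calc _ ≤ |logWeight b * (Real.sin (u * Real.log b) / u)
          - logWeight a * (Real.sin (u * Real.log a) / u)|
          + |∫ t in a..b, (-(1 / (t * Real.log t ^ 2)) + 2 / (t * Real.log t ^ 3)) *
      (Real.sin (u * Real.log t) / u)| := abs_sub _ _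
    _ ≤ (logMajorant b * (1 / |u|) + logMajorant a * (1 / |u|))
        + (logMajorant a - logMajorant b) / |u| :=
        add_le_add ((abs_sub _ _).trans (add_le_add k1 k2)) hI2
    _ = _ := by ring

theorem integral_logWeight_le {a b : ℝ} (ha : 1 < a) (hab : a ≤ b) :
    ∫ t in a..b, 1 / t * logWeight t ≤ Real.log (Real.log b) - Real.log (Real.log a) := by
  have hI : Set.uIcc a b = Set.Icc a b := Set.uIcc_of_le hab
  have hlog := continuousOn_log_Icc (b := b) ha
  have hl0 := log_ne_zero_of_mem (b := b) ha
  have ht0 := ne_zero_of_mem (b := b) ha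
  have hwc := continuousOn_logWeight (b := b) ha
  have hc1 : ContinuousOn (fun t : ℝ => 1 / t) (Set.Icc a b) :=
    continuousOn_const.div continuousOn_id ht0
  have hc2 : ContinuousOn (fun t : ℝ => (1 / t) / Real.log t) (Set.Icc a b) := hc1.div hlog hl0
  have hD := intervalIntegral.integral_eq_sub_of_hasDerivAt (a := a) (b := b)
    (f := fun t => Real.log (Real.log t)) (f' := fun t => (1 / t) / Real.log t)
    (fun t ht => by
      rw [hI] at ht
      have := (Real.hasDerivAt_log (ht0 t ht)).log (hl0 t ht)
      simpa using this) ((hI ▸ hc2).intervalIntegrable)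
  rw [← hD]
  refine intervalIntegral.integral_mono_on hab ((hI ▸ hc1.mul hwc).intervalIntegrable)
    ((hI ▸ hc2).intervalIntegrable) fun t ht => ?_
  have ht1 : 1 < t := ha.trans_le ht.1
  have hl := Real.log_pos ht1
  rw [div_eq_mul_one_div (1 / t)]
  refine mul_le_mul_of_nonneg_left ?_ (by positivity)
  unfold logWeight
  have : 0 ≤ 1 / Real.log t ^ 2 := by positivity
  linarith

/-- The error term in `∑_{k ≤ t} c_k ≈ θ t / log t`. -/
def sumError (θ : ℝ) (c : ℕ → ℝ) (t : ℝ) : ℝ :=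
  ∑ k ∈ Finset.Icc 0 ⌊t⌋₊, c k - θ * (t / Real.log t)

/-- Abel summation against cos(u log t) / t; the main term θ t / log t is then integrated by parts
back into the integral of `logWeight`, leaving only error terms. The derivative of the test function
is at most (1 + |u|) / t² in absolute value. -/
theorem abs_sum_sub_integral_le {θ : ℝ} {c : ℕ → ℝ}
    (h : IntegrableOn (fun t => |sumError θ c t| / t ^ 2) (Set.Ioi 2)) {a b : ℝ} (ha : 2 ≤ a)
    (hab : a ≤ b) (u : ℝ) :
    |∑ k ∈ Finset.Ioc ⌊a⌋₊ ⌊b⌋₊, Real.cos (u * Real.log k) / k * c k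
        - θ * ∫ t in a..b, Real.cos (u * Real.log t) / t * logWeight t|
      ≤ |sumError θ c b| / b + |sumError θ c a| / a
        + (1 + |u|) * ∫ t in Set.Ioi a, |sumError θ c t| / t ^ 2 := by
  have ha1 : 1 < a := by linarith
  have hI : Set.uIcc a b = Set.Icc a b := Set.uIcc_of_le hab
  have hlog := continuousOn_log_Icc (b := b) ha1
  have ht0 := ne_zero_of_mem (b := b) ha1
  have hl0 := log_ne_zero_of_mem (b := b) ha1
  have hcc := continuousOn_cos_log_div (b := b) ha1 u
  set φ : ℝ → ℝ := fun t => Real.cos (u * Real.log t) / t with hφ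
  set φ' : ℝ → ℝ := fun t =>
    -(Real.cos (u * Real.log t) + u * Real.sin (u * Real.log t)) / t ^ 2 with hφ'
  have hder : ∀ t ∈ Set.Icc a b, HasDerivAt φ (φ' t) t := fun t ht =>
    hasDerivAt_cos_log_div u (by linarith [ht.1])
  have hφ'c : ContinuousOn φ' (Set.Icc a b) := by
    refine ContinuousOn.div (ContinuousOn.neg (ContinuousOn.add ?_ ?_)) (continuousOn_pow 2)
      fun t ht => pow_ne_zero 2 (ht0 t ht)
    · exact Real.continuous_cos.comp_continuousOn (continuousOn_const.mul hlog)
    · exact continuousOn_const.mul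
        (Real.continuous_sin.comp_continuousOn (continuousOn_const.mul hlog))
  have hdi : IntegrableOn (deriv φ) (Set.Icc a b) :=
    (hφ'c.integrableOn_Icc).congr_fun (fun t ht => (hder t ht).deriv.symm) measurableSet_Icc
  have habel := sum_mul_eq_sub_sub_integral_mul c (f := φ) (by linarith : 0 ≤ a) hab
    (fun t ht => (hder t ht).differentiableAt) hdi
  have hSi : IntegrableOn (fun t => φ' t * ∑ k ∈ Finset.Icc 0 ⌊t⌋₊, c k) (Set.Ioc a b) :=
    (integrableOn_mul_sum_Icc c (by linarith : 0 ≤ a) hφ'c.integrableOn_Icc).mono_set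
      Set.Ioc_subset_Icc_self
  have hLc : ContinuousOn (fun t : ℝ => t / Real.log t) (Set.Icc a b) :=
    continuousOn_id.div hlog hl0
  have hLi : IntegrableOn (fun t => φ' t * (t / Real.log t)) (Set.Ioc a b) :=
    (hφ'c.mul hLc).integrableOn_Icc.mono_set Set.Ioc_subset_Icc_self
  have hEi : IntegrableOn (fun t => φ' t * sumError θ c t) (Set.Ioc a b) := by
    refine (hSi.sub (hLi.const_mul θ)).congr (ae_of_all _ fun t => ?_)
    simp only [Pi.sub_apply, sumError]
    ring
  have hparts := intervalIntegral.integral_mul_deriv_eq_deriv_mul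
    (u := φ) (v := fun t => t / Real.log t) (a := a) (b := b)
    (fun t ht => hder t (hI ▸ ht))
    (fun t ht => hasDerivAt_div_log (by rw [hI] at ht; linarith [ht.1]))
    ((hI ▸ hφ'c).intervalIntegrable)
    ((hI ▸ continuousOn_logWeight (b := b) ha1).intervalIntegrable)
  rw [intervalIntegral.integral_of_le hab (f := fun t => φ' t * (t / Real.log t))] at hparts
  have hsplit : ∫ t in Set.Ioc a b, deriv φ t * ∑ k ∈ Finset.Icc 0 ⌊t⌋₊, c k
      = θ * (∫ t in Set.Ioc a b, φ' t * (t / Real.log t))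
        + ∫ t in Set.Ioc a b, φ' t * sumError θ c t := by
    rw [← integral_const_mul, ← integral_add (hLi.const_mul θ) hEi]
    refine setIntegral_congr_fun measurableSet_Ioc fun t ht => ?_
    simp only [(hder t (Set.Ioc_subset_Icc_self ht)).deriv, sumError]
    ring
  have hSb : ∑ k ∈ Finset.Icc 0 ⌊b⌋₊, c k = θ * (b / Real.log b) + sumError θ c b := by
    simp [sumError]
  have hSa : ∑ k ∈ Finset.Icc 0 ⌊a⌋₊, c k = θ * (a / Real.log a) + sumError θ c a := by
    simp [sumError]
  have hkey : ∑ k ∈ Finset.Ioc ⌊a⌋₊ ⌊b⌋₊, φ k * c k - θ * ∫ t in a..b, φ t * logWeight t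
      = φ b * sumError θ c b - φ a * sumError θ c a
        - ∫ t in Set.Ioc a b, φ' t * sumError θ c t := by
    rw [habel, hsplit, hSb, hSa, hparts]
    ring
  have hφb : ∀ t, 0 < t → |φ t * sumError θ c t| ≤ |sumError θ c t| / t := fun t ht => by
    simp only [hφ]
    rw [abs_mul, abs_div, abs_of_pos ht, div_mul_eq_mul_div]
    exact div_le_div_of_nonneg_right
      (mul_le_of_le_one_left (abs_nonneg _) (Real.abs_cos_le_one _)) ht.le
  have hint : |∫ t in Set.Ioc a b, φ' t * sumError θ c t|
      ≤ (1 + |u|) * ∫ t in Set.Ioi a, |sumError θ c t| / t ^ 2 := by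
    have hIoi : IntegrableOn (fun t => |sumError θ c t| / t ^ 2) (Set.Ioi a) :=
      h.mono_set (Set.Ioi_subset_Ioi ha)
    calc |∫ t in Set.Ioc a b, φ' t * sumError θ c t|
        ≤ ∫ t in Set.Ioc a b, (1 + |u|) * (|sumError θ c t| / t ^ 2) := by
          rw [← Real.norm_eq_abs]
          refine norm_integral_le_of_norm_le ((hIoi.mono_set Set.Ioc_subset_Ioi_self).const_mul _)
            ?_
          refine (ae_restrict_iff' measurableSet_Ioc).2 (ae_of_all _ fun t ht => ?_)
          have ht2 : 0 < t := by linarith [ht.1]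
          simp only [hφ']
          rw [norm_mul, norm_div, norm_neg, norm_pow, Real.norm_eq_abs, Real.norm_eq_abs,
            Real.norm_eq_abs, abs_of_pos ht2, div_mul_eq_mul_div, ← mul_div_assoc]
          refine div_le_div_of_nonneg_right (mul_le_mul_of_nonneg_right ?_ (abs_nonneg _))
            (by positivity)
          refine (abs_add_le _ _).trans (add_le_add (Real.abs_cos_le_one _) ?_)
          rw [abs_mul]
          exact mul_le_of_le_one_right (abs_nonneg _) (Real.abs_sin_le_one _)
      _ = (1 + |u|) * ∫ t in Set.Ioc a b, |sumError θ c t| / t ^ 2 := integral_const_mul _ _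
      _ ≤ _ := by
          refine mul_le_mul_of_nonneg_left ?_ (by positivity)
          refine setIntegral_mono_set hIoi (ae_of_all _ fun t => by positivity)
            (Set.Ioc_subset_Ioi_self.eventuallyLE)
  rw [hkey]
  calc _ ≤ |φ b * sumError θ c b - φ a * sumError θ c a|
        + |∫ t in Set.Ioc a b, φ' t * sumError θ c t| := abs_sub _ _
    _ ≤ _ := add_le_add ((abs_sub _ _).trans (add_le_add (hφb b (by linarith))
        (hφb a (by linarith)))) hint

/-- A sequence with `∑_{k ≤ t} c_k ≈ θ t / log t`, with integrable error. -/
structure HasLogDensity (θ : ℝ) (c : ℕ → ℝ) : Prop where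
  nonneg : ∀ k, 0 ≤ c k
  isLittleO : sumError θ c =o[atTop] fun t : ℝ => t / Real.log t
  integrable : IntegrableOn (fun t => |sumError θ c t| / t ^ 2) (Set.Ioi 2)

namespace HasLogDensity

variable {θ : ℝ} {c : ℕ → ℝ}

theorem tendsto_error_div (h : HasLogDensity θ c) :
    Tendsto (fun t => |sumError θ c t| / t) atTop (𝓝 0) := by
  have h1 : sumError θ c =o[atTop] fun t : ℝ => t := by
    refine h.isLittleO.trans_isBigO (IsBigO.of_bound 1 ?_)
    filter_upwards [eventually_ge_atTop (Real.exp 1)] with t ht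
    have hl : 1 ≤ Real.log t := (Real.le_log_iff_exp_le ((Real.exp_pos 1).trans_le ht)).2 ht
    rw [norm_div, one_mul, Real.norm_of_nonneg (by linarith : 0 ≤ Real.log t)]
    exact div_le_self (norm_nonneg _) hl
  have := h1.tendsto_div_nhds_zero.abs
  rw [abs_zero] at this
  refine this.congr' ?_
  filter_upwards [eventually_gt_atTop 0] with t ht
  rw [abs_div, abs_of_pos ht]

/-- For large t this is the little-o hypothesis. On the remaining bounded range the sums are
monotone in t and log t ≥ log 2, so a crude bound works. -/
theorem exists_error_div_le (h : HasLogDensity θ c) :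
    ∃ C, ∀ t, 2 ≤ t → |sumError θ c t| / t ≤ C := by
  obtain ⟨T, hT⟩ := eventually_atTop.1 (h.tendsto_error_div.eventually_le_const
    (show (0 : ℝ) < 1 by norm_num))
  have hl2 : 0 < Real.log 2 := Real.log_pos (by norm_num)
  refine ⟨max 1 ((∑ k ∈ Finset.Icc 0 ⌊T⌋₊, c k) / 2 + |θ| / Real.log 2), fun t ht => ?_⟩
  rcases le_total T t with hTt | hTt
  · exact (hT t hTt).trans (le_max_left _ _)
  refine le_trans ?_ (le_max_right _ _)
  have hlt : Real.log 2 ≤ Real.log t := Real.log_le_log (by norm_num) ht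
  have hS : ∑ k ∈ Finset.Icc 0 ⌊t⌋₊, c k ≤ ∑ k ∈ Finset.Icc 0 ⌊T⌋₊, c k :=
    Finset.sum_le_sum_of_subset_of_nonneg
      (Finset.Icc_subset_Icc_right (Nat.floor_mono hTt)) fun k _ _ => h.nonneg k
  have hS0 : 0 ≤ ∑ k ∈ Finset.Icc 0 ⌊t⌋₊, c k := Finset.sum_nonneg fun k _ => h.nonneg k
  have h1 : |sumError θ c t| ≤ ∑ k ∈ Finset.Icc 0 ⌊t⌋₊, c k + |θ| * (t / Real.log t) := by
    refine (abs_sub _ _).trans (add_le_add (abs_of_nonneg hS0).le ?_)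
    rw [abs_mul, abs_of_nonneg (div_nonneg (by linarith) (by linarith) : 0 ≤ t / Real.log t)]
  have ht0 : 0 < t := by linarith
  calc |sumError θ c t| / t
      ≤ (∑ k ∈ Finset.Icc 0 ⌊t⌋₊, c k + |θ| * (t / Real.log t)) / t :=
        div_le_div_of_nonneg_right h1 ht0.le
    _ = (∑ k ∈ Finset.Icc 0 ⌊t⌋₊, c k) / t + |θ| / Real.log t := by
        have : Real.log t ≠ 0 := by linarith
        field_simp
    _ ≤ _ := by
        refine add_le_add (div_le_div₀ (hS0.trans hS) hS (by norm_num) ht)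
          (div_le_div_of_nonneg_left (abs_nonneg _) hl2 hlt)

theorem tendsto_tail_integral (h : HasLogDensity θ c) :
    Tendsto (fun a => ∫ t in Set.Ioi a, |sumError θ c t| / t ^ 2) atTop (𝓝 0) := by
  have h1 := intervalIntegral_tendsto_integral_Ioi 2 h.integrable tendsto_id
  have h2 := (tendsto_const_nhds (x := ∫ t in Set.Ioi (2 : ℝ), |sumError θ c t| / t ^ 2)).sub h1
  rw [sub_self] at h2
  refine h2.congr' ?_
  filter_upwards [eventually_ge_atTop 2] with a ha
  have := intervalIntegral.integral_Ioi_sub_Ioi (f := fun t => |sumError θ c t| / t ^ 2)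
    (μ := volume) h.integrable ha
  simp only [id]
  linarith

theorem exists_tail (h : HasLogDensity θ c) (hθ : 0 ≤ θ) :
    ∃ η : ℝ → ℝ, Tendsto η atTop (𝓝 0) ∧ (∃ C, ∀ a, 2 ≤ a → η a ≤ C) ∧
      ∀ a b u : ℝ, 2 ≤ a → a ≤ b → u ≠ 0 →
        |∑ k ∈ Finset.Ioc ⌊a⌋₊ ⌊b⌋₊, Real.cos (u * Real.log k) / k * c k|
          ≤ (1 + |u|) * η a + θ * (2 * logMajorant a / |u|) := by
  set I : ℝ → ℝ := fun a => ∫ t in Set.Ioi a, |sumError θ c t| / t ^ 2 with hI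
  obtain ⟨C, hC⟩ := h.exists_error_div_le
  -- The supremum over all t ≥ a covers the boundary term at `b` as well as the one at `a`, so the
  -- final bound does not depend on `b`.
  set e : ℝ → ℝ := fun a => sSup ((fun t => |sumError θ c t| / t) '' Set.Ici a) with he
  have hbdd : ∀ a, 2 ≤ a → BddAbove ((fun t => |sumError θ c t| / t) '' Set.Ici a) :=
    fun a ha => ⟨C, by rintro _ ⟨t, ht, rfl⟩; exact hC t (ha.trans ht)⟩
  have hle : ∀ a t, 2 ≤ a → a ≤ t → |sumError θ c t| / t ≤ e a := fun a t ha hat =>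
    le_csSup (hbdd a ha) ⟨t, hat, rfl⟩
  have he0 : Tendsto e atTop (𝓝 0) := by
    refine tendsto_order.2 ⟨fun x hx => ?_, fun x hx => ?_⟩
    · filter_upwards [eventually_ge_atTop 2] with a ha
      refine hx.trans_le (le_trans ?_ (hle a a ha le_rfl))
      have : (0 : ℝ) < a := by linarith
      positivity
    · obtain ⟨T, hT⟩ := eventually_atTop.1 (h.tendsto_error_div.eventually_le_const
        (show (0 : ℝ) < x / 2 by linarith))
      filter_upwards [eventually_ge_atTop T] with a ha
      refine lt_of_le_of_lt (csSup_le (Set.Nonempty.image _ ⟨a, Set.self_mem_Ici⟩) ?_)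
        (show x / 2 < x by linarith)
      rintro _ ⟨t, ht, rfl⟩
      exact hT t (ha.trans ht)
  refine ⟨fun a => 2 * e a + I a, ?_, ⟨2 * C + I 2, fun a ha => ?_⟩, fun a b u ha hab hu => ?_⟩
  · simpa using (he0.const_mul 2).add h.tendsto_tail_integral
  · refine add_le_add (mul_le_mul_of_nonneg_left ?_ (by norm_num)) ?_
    · refine csSup_le (Set.Nonempty.image _ ⟨a, Set.self_mem_Ici⟩) ?_
      rintro _ ⟨t, ht, rfl⟩
      exact hC t (ha.trans ht)
    · exact setIntegral_mono_set h.integrable (ae_of_all _ fun t => by positivity)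
        (Set.Ioi_subset_Ioi ha).eventuallyLE
  · have h1 := abs_sum_sub_integral_le h.integrable ha hab u
    have h2 := abs_integral_cos_log_le (by linarith : 1 < a) hab hu
    have h3 := hle a b ha hab
    have h4 := hle a a ha le_rfl
    have h5 : 0 ≤ e a := le_trans (by have : (0 : ℝ) < a := by linarith
                                      positivity) h4
    set A := ∑ k ∈ Finset.Ioc ⌊a⌋₊ ⌊b⌋₊, Real.cos (u * Real.log k) / k * c k
    set B := ∫ t in a..b, Real.cos (u * Real.log t) / t * logWeight t
    have h6 : |θ * B| ≤ θ * (2 * logMajorant a / |u|) := by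
      rw [abs_mul, abs_of_nonneg hθ]
      exact mul_le_mul_of_nonneg_left h2 hθ
    have h7 : |A| ≤ |A - θ * B| + |θ * B| := by
      have := abs_add_le (A - θ * B) (θ * B)
      simpa using this
    have h8 : 0 ≤ |u| * e a := mul_nonneg (abs_nonneg _) h5
    change |A| ≤ (1 + |u|) * (2 * e a + I a) + _
    have h9 : |A - θ * B| ≤ e a + e a + (1 + |u|) * I a := h1.trans
      (by simp only [hI]; linarith)
    nlinarith

/-- The non-oscillating case u = 0, an estimate of Mertens type; only the upper bound is needed. -/
theorem exists_sum_div_le (h : HasLogDensity θ c) (hθ : 0 ≤ θ) :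
    ∃ C, ∀ y : ℝ, 2 ≤ y →
      ∑ k ∈ Finset.Ioc 2 ⌊y⌋₊, c k / k ≤ θ * Real.log (Real.log y) + C := by
  obtain ⟨C, hC⟩ := h.exists_error_div_le
  set I := ∫ t in Set.Ioi (2 : ℝ), |sumError θ c t| / t ^ 2 with hI
  refine ⟨2 * C + I - θ * Real.log (Real.log 2), fun y hy => ?_⟩
  have h1 := (abs_le.1 (abs_sum_sub_integral_le h.integrable le_rfl hy 0)).2
  have h2 := mul_le_mul_of_nonneg_left (integral_logWeight_le (by norm_num : (1 : ℝ) < 2) hy) hθ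
  simp only [zero_mul, Real.cos_zero, abs_zero, add_zero, one_mul] at h1
  rw [show ⌊(2 : ℝ)⌋₊ = 2 by norm_num] at h1
  have h3 := hC y hy
  have h4 := hC 2 le_rfl
  have h5 : ∑ k ∈ Finset.Ioc 2 ⌊y⌋₊, 1 / (k : ℝ) * c k = ∑ k ∈ Finset.Ioc 2 ⌊y⌋₊, c k / k :=
    Finset.sum_congr rfl fun k _ => by ring
  rw [h5] at h1
  linarith

/-- The partial sums of `c` are O(n), which makes its Dirichlet series converge absolutely to the
right of 1. -/
theorem summable_div_rpow (h : HasLogDensity θ c) {r : ℝ} (hr : 1 < r) :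
    Summable fun n : ℕ => c n / (n : ℝ) ^ r := by
  obtain ⟨C, hC⟩ := h.exists_error_div_le
  have hl2 : 0 < Real.log 2 := Real.log_pos (by norm_num)
  have hO : (fun n => ∑ k ∈ Finset.Icc 1 n, ‖((c k : ℝ) : ℂ)‖)
      =O[atTop] fun n => (n : ℝ) ^ (1 : ℝ) := by
    refine IsBigO.of_bound (C + |θ| / Real.log 2) ?_
    filter_upwards [eventually_ge_atTop 2] with n hn
    have hn' : (2 : ℝ) ≤ n := by exact_mod_cast hn
    have hn0 : (0 : ℝ) < n := by linarith
    have hlt : Real.log 2 ≤ Real.log n := Real.log_le_log (by norm_num) hn'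
    have e1 : ∀ k, ‖((c k : ℝ) : ℂ)‖ = c k := fun k => by simp [abs_of_nonneg (h.nonneg k)]
    simp_rw [e1]
    rw [Real.rpow_one, Real.norm_of_nonneg (Finset.sum_nonneg fun k _ => h.nonneg k),
      Real.norm_of_nonneg hn0.le]
    have h1 := hC n hn'
    rw [div_le_iff₀ hn0] at h1
    have h2 := le_abs_self (sumError θ c n)
    simp only [sumError, Nat.floor_natCast] at h1 h2
    have h3 : ∑ k ∈ Finset.Icc 1 n, c k ≤ ∑ k ∈ Finset.Icc 0 n, c k :=
      Finset.sum_le_sum_of_subset_of_nonneg (Finset.Icc_subset_Icc_left (by norm_num))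
        fun k _ _ => h.nonneg k
    have h4 : θ * (n / Real.log n) ≤ |θ| / Real.log 2 * n := by
      calc θ * (n / Real.log n) ≤ |θ| * (n / Real.log 2) := by
            refine mul_le_mul (le_abs_self _) (div_le_div_of_nonneg_left hn0.le hl2 hlt)
              (div_nonneg hn0.le (by linarith)) (abs_nonneg _)
        _ = _ := by ring
    linarith
  have hs := LSeriesSummable_of_sum_norm_bigO hO zero_le_one (s := (r : ℂ)) (by simpa using hr)
  have hs' := hs.norm
  refine (summable_nat_add_iff 1).1 (((summable_nat_add_iff 1).2 hs').congr fun n => ?_)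
  rw [LSeries.term_of_ne_zero (Nat.succ_ne_zero n), norm_div, Complex.norm_natCast_cpow_of_pos
    (Nat.succ_pos n)]
  simp [abs_of_nonneg (h.nonneg _)]

end HasLogDensity

end RandomEuler

end

/-! ### Oscillating sums over primes, uniformly in a decreasing weight -/

noncomputable section

namespace RandomEuler

/-- The `k`-th prime, counted from zero. -/
def nthPrime (k : ℕ) : ℕ := Nat.nth Nat.Prime k

theorem prime_nthPrime (k : ℕ) : (nthPrime k).Prime :=
  Nat.nth_mem_of_infinite Nat.infinite_setOfPred_prime k

theorem strictMono_nthPrime : StrictMono nthPrime :=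
  Nat.nth_strictMono Nat.infinite_setOfPred_prime

theorem two_le_nthPrime (k : ℕ) : 2 ≤ nthPrime k := (prime_nthPrime k).two_le

theorem tendsto_nthPrime : Tendsto nthPrime atTop atTop := strictMono_nthPrime.tendsto_atTop

theorem exists_nthPrime {p : ℕ} (hp : p.Prime) : ∃ k, nthPrime k = p :=
  ⟨_, Nat.nth_count hp⟩

theorem nthPrime_lt_iff {k N : ℕ} : nthPrime k < N ↔ k < Nat.count Nat.Prime N := by
  rw [← not_le, ← not_le, not_iff_not]
  exact (Nat.count_le_iff_le_nth Nat.infinite_setOfPred_prime).symm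

theorem sum_Ico_nthPrime {F : ℕ → ℝ} (hF : ∀ j, ¬ j.Prime → F j = 0) (n m : ℕ) :
    ∑ k ∈ Finset.Ico n m, F (nthPrime k) = ∑ j ∈ Finset.Ico (nthPrime n) (nthPrime m), F j := by
  have hinj : Set.InjOn nthPrime (Finset.Ico n m) := strictMono_nthPrime.injective.injOn
  rw [← Finset.sum_image (f := F) hinj]
  refine Finset.sum_subset (fun j hj => ?_) fun j hj hj' => hF j fun hp => hj' ?_
  · obtain ⟨k, hk, rfl⟩ := Finset.mem_image.1 hj
    rw [Finset.mem_Ico] at hk ⊢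
    exact ⟨strictMono_nthPrime.monotone hk.1, strictMono_nthPrime hk.2⟩
  · obtain ⟨k, rfl⟩ := exists_nthPrime hp
    rw [Finset.mem_Ico, strictMono_nthPrime.le_iff_le, strictMono_nthPrime.lt_iff_lt,
      ← Finset.mem_Ico] at hj
    exact Finset.mem_image_of_mem _ hj

/-- Abel's inequality. -/
theorem sum_Ico_mul_le_of_antitone {a w : ℕ → ℝ} {B : ℝ} (hB : 0 ≤ B) (hw : Antitone w)
    (hw0 : ∀ k, 0 ≤ w k) (hw1 : ∀ k, w k ≤ 1) {n m : ℕ} (hnm : n ≤ m)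
    (h : ∀ j, n ≤ j → j ≤ m → ∑ k ∈ Finset.Ico n j, a k ≤ B) :
    ∑ k ∈ Finset.Ico n m, a k * w k ≤ B := by
  -- Summation by parts as an induction: the partial sum counts with the current weight, and the
  -- weight lost so far costs at most `B` per unit.
  have key : ∀ j, n ≤ j → j ≤ m →
      ∑ k ∈ Finset.Ico n j, a k * w k ≤ (∑ k ∈ Finset.Ico n j, a k) * w j + B * (1 - w j) := by
    intro j hj
    induction j, hj using Nat.le_induction with
    | base =>
      intro _
      simp only [Finset.Ico_self, Finset.sum_empty, zero_mul, zero_add]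
      exact mul_nonneg hB (by linarith [hw1 n])
    | succ j hj ih =>
      intro hjm
      have h1 := ih (by omega)
      have h2 := h (j + 1) (by omega) hjm
      have h3 := hw (Nat.le_succ j)
      rw [Finset.sum_Ico_succ_top hj] at h2 ⊢
      rw [Finset.sum_Ico_succ_top hj]
      simp only [Nat.succ_eq_add_one] at h3
      nlinarith [mul_le_mul_of_nonneg_right h2 (sub_nonneg.2 h3)]
  have h1 := key m hnm le_rfl
  have h2 := mul_le_mul_of_nonneg_right (h m hnm le_rfl) (hw0 m)
  linarith

namespace HasLogDensity

variable {θ : ℝ} {c : ℕ → ℝ}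

/-- The weights to be used are p^(-τ); Abel's inequality removes them, so the bound does not see τ.
The base point `nthPrime n - 1` turns the range p_n ≤ p < p_j into the half-open range of Abel
summation, and `3 ≤ nthPrime n` keeps it at least 2. -/
theorem exists_sum_nthPrime_tail (h : HasLogDensity θ c) (hθ : 0 ≤ θ)
    (hc : ∀ j, ¬ j.Prime → c j = 0) :
    ∃ η : ℝ → ℝ, Tendsto η atTop (𝓝 0) ∧ (∃ C, ∀ a, 2 ≤ a → η a ≤ C) ∧
      ∀ (w : ℕ → ℝ), Antitone w → (∀ k, 0 ≤ w k) → (∀ k, w k ≤ 1) →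
      ∀ (n m : ℕ) (u : ℝ), 3 ≤ nthPrime n → n ≤ m → u ≠ 0 →
        |∑ k ∈ Finset.Ico n m,
            Real.cos (u * Real.log (nthPrime k)) / nthPrime k * c (nthPrime k) * w k|
          ≤ (1 + |u|) * η (nthPrime n - 1 : ℝ)
            + θ * (2 * logMajorant (nthPrime n - 1 : ℝ) / |u|) := by
  obtain ⟨η, hη, hηb, hηt⟩ := h.exists_tail hθ
  refine ⟨η, hη, hηb, fun w hw hw0 hw1 n m u hn hnm hu => ?_⟩
  have hn' : (3 : ℝ) ≤ nthPrime n := by exact_mod_cast hn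
  have key : ∀ j, n ≤ j → |∑ k ∈ Finset.Ico n j,
      Real.cos (u * Real.log (nthPrime k)) / nthPrime k * c (nthPrime k)|
      ≤ (1 + |u|) * η (nthPrime n - 1 : ℝ)
            + θ * (2 * logMajorant (nthPrime n - 1 : ℝ) / |u|) := fun j hj => by
    have hp : nthPrime n ≤ nthPrime j := strictMono_nthPrime.monotone hj
    have hp' : (nthPrime n : ℝ) ≤ nthPrime j := by exact_mod_cast hp
    have h1 := hηt (nthPrime n - 1) (nthPrime j - 1) u (by linarith) (by linarith) hu
    rw [sum_Ico_nthPrime (F := fun j => Real.cos (u * Real.log j) / j * c j)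
      (fun j hj => by simp [hc j hj]) n j]
    have e : ∀ i, 1 ≤ nthPrime i → ⌊(nthPrime i - 1 : ℝ)⌋₊ = nthPrime i - 1 := fun i hi => by
      rw [← Nat.cast_one, ← Nat.cast_sub hi, Nat.floor_natCast]
    rw [e n (by omega), e j (by omega)] at h1
    have e2 : Finset.Ico (nthPrime n) (nthPrime j) = Finset.Ioc (nthPrime n - 1) (nthPrime j - 1) := by
      ext i; simp only [Finset.mem_Ico, Finset.mem_Ioc]; omega
    rwa [e2]
  have hB := (abs_nonneg _).trans (key n le_rfl)
  rw [abs_le]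
  constructor
  · have := sum_Ico_mul_le_of_antitone hB hw hw0 hw1 hnm
      (a := fun k => -(Real.cos (u * Real.log (nthPrime k)) / nthPrime k * c (nthPrime k)))
      fun j hj _ => by
        rw [Finset.sum_neg_distrib]
        exact (neg_le_abs _).trans (key j hj)
    simp only [neg_mul, Finset.sum_neg_distrib] at this
    linarith
  · exact sum_Ico_mul_le_of_antitone hB hw hw0 hw1 hnm fun j hj _ => (le_abs_self _).trans (key j hj)

/-- Split at Y = exp(max(1, 1/|u|)). Up to Y the cosine is bounded by one and the Mertens estimate
gives θ log log Y, which is θ log(1/|u|) up to a constant as long as |u| ≤ U. Beyond Y the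
oscillation takes over: `logMajorant` is at most 2|u| there, so the factor 1/|u| is absorbed. -/
theorem exists_sum_nthPrime_le (h : HasLogDensity θ c) (hθ : 0 ≤ θ)
    (hc : ∀ j, ¬ j.Prime → c j = 0) (U : ℝ) :
    ∃ C, ∀ (w : ℕ → ℝ), Antitone w → (∀ k, 0 ≤ w k) → (∀ k, w k ≤ 1) →
      ∀ (n m : ℕ) (u : ℝ), u ≠ 0 → |u| ≤ U →
        ∑ k ∈ Finset.Ico n m,
            Real.cos (u * Real.log (nthPrime k)) / nthPrime k * c (nthPrime k) * w k
          ≤ θ * Real.log (1 / |u|) + C := by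
  obtain ⟨η, hη, ⟨Cη, hCη⟩, hηt⟩ := h.exists_sum_nthPrime_tail hθ hc
  obtain ⟨C, hC⟩ := h.exists_sum_div_le hθ
  set V := max 1 U with hV
  have hV1 : 1 ≤ V := le_max_left _ _
  refine ⟨c 2 / 2 + θ * (Real.log 2 + Real.log V) + |C| + (1 + V) * |Cη| + 4 * θ, fun w hw hw0 hw1 n m u hu hU => ?_⟩
  have hupos : 0 < |u| := abs_pos.2 hu
  set ℓ := max 1 (1 / |u|) with hℓ
  have hℓ1 : 1 ≤ ℓ := le_max_left _ _
  have hℓu : 1 / |u| ≤ ℓ := le_max_right _ _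
  have hℓV : ℓ ≤ V * (1 / |u|) := by
    refine max_le ?_ (le_mul_of_one_le_left (by positivity) hV1)
    rw [mul_one_div, le_div_iff₀ hupos, one_mul]
    exact hU.trans (le_max_right _ _)
  have hlogℓ : Real.log ℓ ≤ Real.log V + Real.log (1 / |u|) := by
    rw [← Real.log_mul (by positivity) (by positivity)]
    exact Real.log_le_log (by positivity) hℓV
  set Y := Real.exp ℓ with hY
  have hY2 : 2 ≤ Y := by
    have := Real.add_one_le_exp ℓ
    linarith
  -- The number of primes up to ⌈Y⌉, which is the index of the first prime beyond it.
  set N := Nat.count Nat.Prime (⌈Y⌉₊ + 1) with hN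
  have hA : ∀ k, 0 ≤ c (nthPrime k) / nthPrime k := fun k => div_nonneg (h.nonneg _) (by positivity)
  -- the primes up to `Y`
  have hsmall : ∑ k ∈ Finset.range N, c (nthPrime k) / nthPrime k
      ≤ c 2 / 2 + (θ * (Real.log 2 + Real.log ℓ) + |C|) := by
    have hceil : (⌈Y⌉₊ : ℝ) ≤ 2 * Y := by
      have := (Nat.ceil_lt_add_one (by linarith : 0 ≤ Y)).le
      linarith
    have hceil2 : (2 : ℝ) ≤ ⌈Y⌉₊ := hY2.trans (Nat.le_ceil _)
    have h1 := hC ⌈Y⌉₊ hceil2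
    rw [Nat.floor_natCast] at h1
    have h2 : Real.log (Real.log ⌈Y⌉₊) ≤ Real.log 2 + Real.log ℓ := by
      rw [← Real.log_mul (by norm_num) (by positivity)]
      refine Real.log_le_log (Real.log_pos (by linarith)) ?_
      calc Real.log ⌈Y⌉₊ ≤ Real.log (2 * Y) := Real.log_le_log (by linarith) hceil
        _ = Real.log 2 + ℓ := by rw [Real.log_mul (by norm_num) (by positivity), hY, Real.log_exp]
        _ ≤ 2 * ℓ := by linarith [Real.log_two_lt_d9]
    have hinj : Set.InjOn nthPrime (Finset.range N) := strictMono_nthPrime.injective.injOn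
    have h3 : ∑ k ∈ Finset.range N, c (nthPrime k) / nthPrime k
        ≤ ∑ j ∈ insert 2 (Finset.Ioc 2 ⌈Y⌉₊), c j / j := by
      rw [← Finset.sum_image (f := fun j : ℕ => c j / j) hinj]
      refine Finset.sum_le_sum_of_subset_of_nonneg (fun j hj => ?_)
        fun j _ _ => div_nonneg (h.nonneg _) (by positivity)
      obtain ⟨k, hk, rfl⟩ := Finset.mem_image.1 hj
      have := nthPrime_lt_iff.2 (Finset.mem_range.1 hk)
      have := two_le_nthPrime k
      simp only [Finset.mem_insert, Finset.mem_Ioc]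
      omega
    rw [Finset.sum_insert (by simp)] at h3
    have h4 := mul_le_mul_of_nonneg_left h2 hθ
    have h5 := le_abs_self C
    push_cast at h3
    linarith
  -- the primes beyond `Y`
  have hlarge : ∀ n m, N ≤ n → n ≤ m → ∑ k ∈ Finset.Ico n m,
      Real.cos (u * Real.log (nthPrime k)) / nthPrime k * c (nthPrime k) * w k
      ≤ (1 + V) * |Cη| + 4 * θ := by
    intro n m hn hnm
    have hp : ⌈Y⌉₊ + 1 ≤ nthPrime n := by
      by_contra hlt
      have := nthPrime_lt_iff.1 (not_le.1 hlt)
      omega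
    have hp' : (⌈Y⌉₊ + 1 : ℝ) ≤ nthPrime n := by exact_mod_cast hp
    have hYa : Y ≤ nthPrime n - 1 := by linarith [Nat.le_ceil Y]
    have h3 : 3 ≤ nthPrime n := by
      have : (3 : ℝ) ≤ nthPrime n := by linarith
      exact_mod_cast this
    have h1 := (le_abs_self _).trans (hηt w hw hw0 hw1 n m u h3 hnm hu)
    have hla : ℓ ≤ Real.log (nthPrime n - 1) := by
      rw [Real.le_log_iff_exp_le (by linarith)]
      exact hYa
    have h2 : logMajorant (nthPrime n - 1) ≤ 2 * |u| := by
      have hi : 1 / ℓ ≤ |u| := by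
        rw [div_le_iff₀ (by positivity)]
        calc (1 : ℝ) = |u| * (1 / |u|) := by field_simp
          _ ≤ _ := mul_le_mul_of_nonneg_left hℓu hupos.le
      have h5 : 1 / Real.log (nthPrime n - 1) ≤ 1 / ℓ :=
        one_div_le_one_div_of_le (by positivity) hla
      have h6 : 1 / Real.log (nthPrime n - 1) ^ 2 ≤ 1 / Real.log (nthPrime n - 1) := by
        refine one_div_le_one_div_of_le (by linarith) ?_
        nlinarith
      unfold logMajorant
      linarith
    have h4 : 2 * logMajorant (nthPrime n - 1) / |u| ≤ 4 := by
      rw [div_le_iff₀ hupos]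
      linarith
    have h5 := mul_le_mul_of_nonneg_left h4 hθ
    have h6 : (1 + |u|) * η (nthPrime n - 1 : ℝ) ≤ (1 + V) * |Cη| :=
      (mul_le_mul_of_nonneg_left ((hCη _ (by linarith)).trans (le_abs_self _))
        (by positivity)).trans (mul_le_mul_of_nonneg_right
          (by linarith [hU.trans (le_max_right 1 U)]) (abs_nonneg _))
    linarith
  have hC0 : 0 ≤ (1 + V) * |Cη| + 4 * θ := by positivity
  have hterm : ∀ k, Real.cos (u * Real.log (nthPrime k)) / nthPrime k * c (nthPrime k) * w k
      ≤ c (nthPrime k) / nthPrime k := fun k => by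
    have h1 : Real.cos (u * Real.log (nthPrime k)) / nthPrime k * c (nthPrime k) * w k
      = (Real.cos (u * Real.log (nthPrime k)) * w k) * (c (nthPrime k) / nthPrime k) := by ring
    rw [h1]
    refine mul_le_of_le_one_left (hA k) ?_
    calc _ ≤ 1 * w k := mul_le_mul_of_nonneg_right (Real.cos_le_one _) (hw0 k)
      _ ≤ 1 := by linarith [hw1 k]
  have hfirst : ∀ n m, m ≤ N → ∑ k ∈ Finset.Ico n m,
      Real.cos (u * Real.log (nthPrime k)) / nthPrime k * c (nthPrime k) * w k
      ≤ c 2 / 2 + (θ * (Real.log 2 + Real.log ℓ) + |C|) := fun n m hm => by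
    refine (Finset.sum_le_sum fun k _ => hterm k).trans ?_
    refine (Finset.sum_le_sum_of_subset_of_nonneg (fun k hk => ?_) fun k _ _ => hA k).trans hsmall
    simp only [Finset.mem_Ico, Finset.mem_range] at hk ⊢
    omega
  have hfin : c 2 / 2 + (θ * (Real.log 2 + Real.log ℓ) + |C|) + ((1 + V) * |Cη| + 4 * θ) ≤
      θ * Real.log (1 / |u|) +
      (c 2 / 2 + θ * (Real.log 2 + Real.log V) + |C| + (1 + V) * |Cη| + 4 * θ) := by
    have := mul_le_mul_of_nonneg_left hlogℓ hθ
    linarith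
  refine le_trans ?_ hfin
  rcases le_total m N with hmN | hmN
  · linarith [hfirst n m hmN]
  rcases le_total N n with hNn | hNn
  · rcases le_total m n with hmn | hmn
    · rw [Finset.Ico_eq_empty_of_le hmn, Finset.sum_empty]
      have := hsmall.trans' (Finset.sum_nonneg fun k _ => hA k)
      linarith
    · have := hsmall.trans' (Finset.sum_nonneg fun k _ => hA k)
      linarith [hlarge n m hNn hmn]
  · rw [← Finset.sum_Ico_consecutive _ hNn hmN]
    exact add_le_add (hfirst n N le_rfl) (hlarge N m le_rfl hmN)

end HasLogDensity

end RandomEuler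

end

/-! ### Random power series on the unit circle and their mean square -/

noncomputable section

namespace RandomEuler

/-- The unit circle, as a subtype of `ℂ`. -/
abbrev UnitCircle : Type := Metric.sphere (0 : ℂ) 1

theorem UnitCircle.norm_coe (z : UnitCircle) : ‖(z : ℂ)‖ = 1 :=
  mem_sphere_zero_iff_norm.1 z.2

/-- Since z times its conjugate is 1, the conjugate of z disappears from the last mixed term. When q
is a power series in z without constant term, all three mixed terms involve positive powers of z
only, and average to zero over the circle. -/
theorem norm_one_add_sq {z : ℂ} (hz : ‖z‖ = 1) (d q : ℂ) :
    ‖1 + (z * d + z * q)‖ ^ 2 = 1 + ‖d‖ ^ 2 + ‖q‖ ^ 2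
      + ((2 * d * z).re + ((2 * (z * q)).re + (2 * (starRingEnd ℂ) d * q).re)) := by
  have hz2 : z.re * z.re + z.im * z.im = 1 := by
    rw [← Complex.normSq_apply, ← Complex.sq_norm, hz, one_pow]
  simp only [Complex.sq_norm, Complex.normSq_apply, Complex.add_re, Complex.add_im, Complex.mul_re,
    Complex.mul_im, Complex.one_re, Complex.one_im, Complex.conj_re, Complex.conj_im,
    Complex.re_ofNat, Complex.im_ofNat]
  linear_combination (d.re ^ 2 + d.im ^ 2 + q.re ^ 2 + q.im ^ 2 + 2 * d.re * q.re
    + 2 * d.im * q.im) * hz2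

/-- The power series `∑_{j ≥ 1} d_{j-1} z^j`. -/
def powerTail (d : ℕ → ℂ) (z : ℂ) : ℂ := ∑' j : ℕ, z ^ (j + 1) * d j

theorem norm_powerTail_term (d : ℕ → ℂ) (z : UnitCircle) (j : ℕ) :
    ‖(z : ℂ) ^ (j + 1) * d j‖ = ‖d j‖ := by
  rw [norm_mul, norm_pow, z.norm_coe, one_pow, one_mul]

theorem summable_powerTail {d : ℕ → ℂ} (hd : Summable fun j => ‖d j‖) (z : UnitCircle) :
    Summable fun j => (z : ℂ) ^ (j + 1) * d j :=
  Summable.of_norm (by simpa only [norm_powerTail_term] using hd)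

theorem norm_powerTail_le {d : ℕ → ℂ} (hd : Summable fun j => ‖d j‖) (z : UnitCircle) :
    ‖powerTail d z‖ ≤ ∑' j, ‖d j‖ :=
  tsum_of_norm_bounded hd.hasSum fun j => (norm_powerTail_term d z j).le

theorem continuous_powerTail {d : ℕ → ℂ} (hd : Summable fun j => ‖d j‖) :
    Continuous fun z : UnitCircle => powerTail d z :=
  continuous_tsum (fun j => by fun_prop) hd fun j z => (norm_powerTail_term d z j).le

theorem powerTail_eq {d : ℕ → ℂ} (hd : Summable fun j => ‖d j‖) (z : UnitCircle) :
    powerTail d z = z * d 0 + z * powerTail (fun j => d (j + 1)) z := by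
  unfold powerTail
  rw [(summable_powerTail hd z).tsum_eq_zero_add, ← tsum_mul_left]
  simp [pow_succ', mul_assoc]

variable {Ω : Type*} [MeasurableSpace Ω]

/-- A random point of the circle all of whose moments vanish. -/
structure IsCentered (P : Measure Ω) (γ : Ω → UnitCircle) : Prop where
  meas : Measurable γ
  moment : ∀ j : ℕ, ∫ ω, (γ ω : ℂ) ^ (j + 1) ∂P = 0

namespace IsCentered

variable {P : Measure Ω} [IsProbabilityMeasure P] {γ : Ω → UnitCircle}

theorem integrable_comp (h : IsCentered P γ) {F : Type*} [NormedAddCommGroup F]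
    [SecondCountableTopology F]
    {φ : UnitCircle → F} (hφ : Continuous φ) : Integrable (fun ω => φ (γ ω)) P := by
  obtain ⟨C, hC⟩ := (isCompact_univ (X := UnitCircle)).exists_bound_of_continuousOn
    hφ.continuousOn
  exact Integrable.of_bound (hφ.comp_aestronglyMeasurable h.meas.aestronglyMeasurable) C
    (ae_of_all _ fun ω => hC _ (Set.mem_univ _))

theorem integral_pow_mul_powerTail (h : IsCentered P γ) {d : ℕ → ℂ}
    (hd : Summable fun j => ‖d j‖) (i : ℕ) :
    ∫ ω, (γ ω : ℂ) ^ i * powerTail d (γ ω) ∂P = 0 := by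
  have e : ∀ ω, (γ ω : ℂ) ^ i * powerTail d (γ ω)
      = ∑' j, (γ ω : ℂ) ^ (i + j + 1) * d j := fun ω => by
    rw [powerTail, ← tsum_mul_left]
    congr 1 with j
    ring
  have hn : ∀ j ω, ‖(γ ω : ℂ) ^ (i + j + 1) * d j‖ = ‖d j‖ := fun j ω => by
    rw [norm_mul, norm_pow, (γ ω).norm_coe, one_pow, one_mul]
  simp_rw [e]
  rw [← integral_tsum_of_summable_integral_norm]
  · simp [integral_mul_const, h.moment]
  · exact fun j => h.integrable_comp (φ := fun z => (z : ℂ) ^ (i + j + 1) * d j) (by fun_prop)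
  · simpa [hn] using hd

theorem integral_re_pow_mul_powerTail (h : IsCentered P γ) {d : ℕ → ℂ}
    (hd : Summable fun j => ‖d j‖) (i : ℕ) (c : ℂ) :
    ∫ ω, (c * ((γ ω : ℂ) ^ i * powerTail d (γ ω))).re ∂P = 0 := by
  have hc : Continuous fun z : UnitCircle => c * ((z : ℂ) ^ i * powerTail d z) :=
    continuous_const.mul ((continuous_subtype_val.pow i).mul (continuous_powerTail hd))
  have := Complex.reCLM.integral_comp_comm (h.integrable_comp hc)
  simp only [Complex.reCLM_apply] at this
  rw [this, integral_const_mul, h.integral_pow_mul_powerTail hd, mul_zero, Complex.zero_re]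

theorem integral_re_pow (h : IsCentered P γ) (i : ℕ) (c : ℂ) :
    ∫ ω, (c * (γ ω : ℂ) ^ (i + 1)).re ∂P = 0 := by
  have hc : Continuous fun z : UnitCircle => c * (z : ℂ) ^ (i + 1) :=
    continuous_const.mul (continuous_subtype_val.pow _)
  have := Complex.reCLM.integral_comp_comm (h.integrable_comp hc)
  simp only [Complex.reCLM_apply] at this
  rw [this, integral_const_mul, h.moment, mul_zero, Complex.zero_re]

/-- The mean square of `1 + ∑_{j ≥ 1} d_{j-1} γ^j`. -/
theorem integral_norm_sq (h : IsCentered P γ) {d : ℕ → ℂ} (hd : Summable fun j => ‖d j‖) :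
    ∫ ω, ‖1 + powerTail d (γ ω)‖ ^ 2 ∂P
      = 1 + ‖d 0‖ ^ 2 + ∫ ω, ‖powerTail (fun j => d (j + 1)) (γ ω)‖ ^ 2 ∂P := by
  have hd' : Summable fun j => ‖d (j + 1)‖ := (summable_nat_add_iff (f := fun j => ‖d j‖) 1).2 hd
  have hc := continuous_powerTail hd'
  have hm := fun i => h.integral_re_pow_mul_powerTail hd' i
  have hsplit := fun ω => powerTail_eq hd (γ ω)
  obtain ⟨Q, hQ⟩ : ∃ Q : UnitCircle → ℂ, ∀ z : UnitCircle,
      powerTail (fun j => d (j + 1)) z = Q z := ⟨_, fun _ => rfl⟩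
  simp only [hQ] at hc hm hsplit ⊢
  have e : ∀ ω, ‖1 + powerTail d (γ ω)‖ ^ 2 = 1 + ‖d 0‖ ^ 2 + ‖Q (γ ω)‖ ^ 2
      + ((2 * d 0 * (γ ω : ℂ) ^ (0 + 1)).re + ((2 * ((γ ω : ℂ) ^ 1 * Q (γ ω))).re
        + (2 * (starRingEnd ℂ) (d 0) * ((γ ω : ℂ) ^ 0 * Q (γ ω))).re)) := fun ω => by
    rw [hsplit, norm_one_add_sq (γ ω).norm_coe, pow_zero, one_mul, zero_add, pow_one]
  simp_rw [e]
  have hi : ∀ (c : ℂ) (q : UnitCircle → ℂ), Continuous q →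
      Integrable (fun ω => (c * q (γ ω)).re) P := fun c q hq =>
    h.integrable_comp (Complex.continuous_re.comp (continuous_const.mul hq))
  have i1 := hi (2 * d 0) (fun z => (z : ℂ) ^ (0 + 1)) (by fun_prop)
  have i2 := hi 2 (fun z => (z : ℂ) ^ 1 * Q z) (by fun_prop)
  have i3 := hi (2 * (starRingEnd ℂ) (d 0)) (fun z => (z : ℂ) ^ 0 * Q z) (by fun_prop)
  have i4 : Integrable (fun ω => ‖Q (γ ω)‖ ^ 2) P :=
    h.integrable_comp (hc.norm.pow 2)
  have i5 : Integrable (fun ω => 1 + ‖d 0‖ ^ 2 + ‖Q (γ ω)‖ ^ 2) P := (integrable_const _).add i4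
  have i6 : Integrable (fun ω => (2 * ((γ ω : ℂ) ^ 1 * Q (γ ω))).re
      + (2 * (starRingEnd ℂ) (d 0) * ((γ ω : ℂ) ^ 0 * Q (γ ω))).re) P := i2.add i3
  have i7 : Integrable (fun ω => (2 * d 0 * (γ ω : ℂ) ^ (0 + 1)).re
      + ((2 * ((γ ω : ℂ) ^ 1 * Q (γ ω))).re
      + (2 * (starRingEnd ℂ) (d 0) * ((γ ω : ℂ) ^ 0 * Q (γ ω))).re)) P := i1.add i6
  rw [integral_add i5 i7, integral_add (integrable_const _) i4, integral_add i1 i6,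
    integral_add i2 i3,
    h.integral_re_pow, hm, hm]
  simp

theorem integral_norm_powerTail_sq_le (h : IsCentered P γ) {d : ℕ → ℂ}
    (hd : Summable fun j => ‖d j‖) :
    ∫ ω, ‖powerTail d (γ ω)‖ ^ 2 ∂P ≤ (∑' j, ‖d j‖) ^ 2 := by
  have hc := continuous_powerTail hd
  have e : ∫ _ω, (∑' j, ‖d j‖) ^ 2 ∂P = (∑' j, ‖d j‖) ^ 2 := by simp
  rw [← e]
  exact integral_mono (h.integrable_comp (hc.norm.pow 2)) (integrable_const _) fun ω => pow_le_pow_left₀ (norm_nonneg _) (norm_powerTail_le hd _) 2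

theorem one_le_integral_norm_sq (h : IsCentered P γ) {d : ℕ → ℂ}
    (hd : Summable fun j => ‖d j‖) : 1 ≤ ∫ ω, ‖1 + powerTail d (γ ω)‖ ^ 2 ∂P := by
  rw [h.integral_norm_sq hd]
  have : 0 ≤ ∫ ω, ‖powerTail (fun j => d (j + 1)) (γ ω)‖ ^ 2 ∂P :=
    integral_nonneg fun ω => by positivity
  nlinarith [sq_nonneg ‖d 0‖]

theorem integral_norm_sq_le (h : IsCentered P γ) {d : ℕ → ℂ} (hd : Summable fun j => ‖d j‖)
    {A r : ℝ} (hA : ‖d 0‖ ≤ A) (hr : ∑' j, ‖d (j + 1)‖ ≤ r) :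
    ∫ ω, ‖1 + powerTail d (γ ω)‖ ^ 2 ∂P ≤ 1 + A ^ 2 + r ^ 2 := by
  rw [h.integral_norm_sq hd]
  have h1 := h.integral_norm_powerTail_sq_le ((summable_nat_add_iff (f := fun j => ‖d j‖) 1).2 hd)
  have h2 : ‖d 0‖ ^ 2 ≤ A ^ 2 := pow_le_pow_left₀ (norm_nonneg _) hA 2
  have h3 : (∑' j, ‖d (j + 1)‖) ^ 2 ≤ r ^ 2 :=
    pow_le_pow_left₀ (tsum_nonneg fun j => norm_nonneg _) hr 2
  linarith

end IsCentered

end RandomEuler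

end

/-! ### Two-point correlation of random power series -/

noncomputable section

namespace RandomEuler

theorem re_mul_re_eq {z : ℂ} (hz : ‖z‖ = 1) (a b : ℂ) :
    (a * z).re * (b * z).re = ((a * b * z ^ 2).re + (a * (starRingEnd ℂ) b).re) / 2 := by
  have hz2 : z.re * z.re + z.im * z.im = 1 := by
    rw [← Complex.normSq_apply, ← Complex.sq_norm, hz, one_pow]
  simp only [sq, Complex.mul_re, Complex.mul_im, Complex.conj_re, Complex.conj_im]
  linear_combination (a.re * b.re + a.im * b.im) / 2 * hz2

/-- The delicate term A²r is split by the inequality of arithmetic and geometric means into A⁴ and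
r²; the others only need powers of 1 + A + r. Cubes of A and squares of r are the quantities that
will be summable over the primes. -/
theorem corr_error_le {A r : ℝ} (hA0 : 0 ≤ A) (hr0 : 0 ≤ r) :
    4 * A * (2 * A * r + r ^ 2) + (2 * r + 2 * A * r + r ^ 2) ^ 2
      + 2 * A ^ 2 * ((A ^ 2 + r ^ 2) * (2 + A ^ 2 + r ^ 2))
      ≤ 16 * (1 + A + r) ^ 4 * (A ^ 3 + r ^ 2) := by
  obtain ⟨q, hq⟩ : ∃ q, q = 1 + A + r := ⟨_, rfl⟩
  rw [← hq]
  have hq1 : 1 ≤ q := by linarith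
  have hA3 : 0 ≤ A ^ 3 := by positivity
  have hr2 : 0 ≤ r ^ 2 := by positivity
  have hqq : q ≤ q ^ 2 := by nlinarith
  have hAq : A ≤ q ^ 2 := by linarith
  have hAq2 : A ^ 2 ≤ q ^ 2 := pow_le_pow_left₀ hA0 (by linarith) 2
  set S := q ^ 2 * (A ^ 3 + r ^ 2) with hS
  have hS0 : 0 ≤ S := by positivity
  have a1 : A * A ^ 3 ≤ q ^ 2 * A ^ 3 := mul_le_mul_of_nonneg_right hAq hA3
  have a2 : A * r ^ 2 ≤ q ^ 2 * r ^ 2 := mul_le_mul_of_nonneg_right hAq hr2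
  have a3 : r ^ 2 ≤ q ^ 2 * r ^ 2 := le_mul_of_one_le_left hr2 (by linarith)
  have a4 : A ^ 2 * r ^ 2 ≤ q ^ 2 * r ^ 2 := mul_le_mul_of_nonneg_right hAq2 hr2
  have a5 : 0 ≤ q ^ 2 * A ^ 3 := by positivity
  have hS' : S = q ^ 2 * A ^ 3 + q ^ 2 * r ^ 2 := by rw [hS]; ring
  have k1 : 8 * (A ^ 2 * r) ≤ 4 * (A * A ^ 3) + 4 * r ^ 2 := by nlinarith [sq_nonneg (A ^ 2 - r)]
  have k2 : (2 * r + 2 * A * r + r ^ 2) ^ 2 ≤ 4 * S := by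
    have : 2 * r + 2 * A * r + r ^ 2 ≤ 2 * q * r := by rw [hq]; nlinarith
    calc _ ≤ (2 * q * r) ^ 2 := pow_le_pow_left₀ (by positivity) this 2
      _ = 4 * (q ^ 2 * r ^ 2) := by ring
      _ ≤ _ := by linarith
  have k3 : 2 + A ^ 2 + r ^ 2 ≤ 2 * q ^ 2 := by rw [hq]; nlinarith [mul_nonneg hA0 hr0]
  have k4 : A ^ 2 * (A ^ 2 + r ^ 2) ≤ S := by
    calc _ = A * A ^ 3 + A ^ 2 * r ^ 2 := by ring
      _ ≤ _ := by linarith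
  have k5 : 2 * A ^ 2 * ((A ^ 2 + r ^ 2) * (2 + A ^ 2 + r ^ 2)) ≤ 4 * (q ^ 2 * S) := by
    calc _ = 2 * ((A ^ 2 * (A ^ 2 + r ^ 2)) * (2 + A ^ 2 + r ^ 2)) := by ring
      _ ≤ 2 * (S * (2 * q ^ 2)) :=
        mul_le_mul_of_nonneg_left (mul_le_mul k4 k3 (by positivity) hS0) (by norm_num)
      _ = _ := by ring
  have k6 : S ≤ q ^ 2 * S := le_mul_of_one_le_left hS0 (by linarith)
  have k7 : 16 * q ^ 4 * (A ^ 3 + r ^ 2) = 16 * (q ^ 2 * S) := by rw [hS]; ring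
  have k8 : 4 * A * (2 * A * r + r ^ 2) = 8 * (A ^ 2 * r) + 4 * (A * r ^ 2) := by ring
  rw [k7, k8]
  linarith

variable {Ω : Type*} [MeasurableSpace Ω]

namespace IsCentered

variable {P : Measure Ω} [IsProbabilityMeasure P] {γ : Ω → UnitCircle}

/-- The leading term of the correlation of two random power series. -/
theorem abs_integral_mul_sub_le (h : IsCentered P γ) {b b' : ℕ → ℂ}
    (hb : Summable fun j => ‖b j‖) (hb' : Summable fun j => ‖b' j‖) {A r : ℝ}
    (hA : ‖b 0‖ ≤ A) (hA' : ‖b' 0‖ ≤ A) (hr : ∑' j, ‖b (j + 1)‖ ≤ r)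
    (hr' : ∑' j, ‖b' (j + 1)‖ ≤ r) :
    |∫ ω, (‖1 + powerTail b (γ ω)‖ ^ 2 - ∫ ω', ‖1 + powerTail b (γ ω')‖ ^ 2 ∂P) *
        (‖1 + powerTail b' (γ ω)‖ ^ 2 - ∫ ω', ‖1 + powerTail b' (γ ω')‖ ^ 2 ∂P) ∂P
      - 2 * (b 0 * (starRingEnd ℂ) (b' 0)).re|
      ≤ 4 * A * (2 * A * r + r ^ 2) + (2 * r + 2 * A * r + r ^ 2) ^ 2 := by
  have hA0 : 0 ≤ A := (norm_nonneg _).trans hA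
  have hr0 : 0 ≤ r := (tsum_nonneg fun j => norm_nonneg _).trans hr
  -- the decomposition of each factor
  have dec : ∀ d : ℕ → ℂ, Summable (fun j => ‖d j‖) → ‖d 0‖ ≤ A → ∑' j, ‖d (j + 1)‖ ≤ r →
      ∃ (Q : UnitCircle → ℂ) (Y : UnitCircle → ℝ), Continuous Q ∧ Continuous Y ∧
        (∀ z, ‖Q z‖ ≤ r) ∧ (∀ z, |Y z| ≤ 2 * A * r + r ^ 2) ∧
        (∀ (i : ℕ) (c : ℂ), ∫ ω, (c * ((γ ω : ℂ) ^ i * Q (γ ω))).re ∂P = 0) ∧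
        ∀ z : UnitCircle, ‖1 + powerTail d z‖ ^ 2 - ∫ ω', ‖1 + powerTail d (γ ω')‖ ^ 2 ∂P
          = (2 * d 0 * z).re + ((2 * Q z * z).re + Y z) := by
    intro d hd hdA hdr
    have hd' : Summable fun j => ‖d (j + 1)‖ := (summable_nat_add_iff (f := fun j => ‖d j‖) 1).2 hd
    have hc := continuous_powerTail hd'
    have hm := fun i c => h.integral_re_pow_mul_powerTail hd' i c
    have hN := h.integral_norm_sq hd
    have hsplit := powerTail_eq hd
    have hQr := fun z => (norm_powerTail_le hd' z).trans hdr
    have hρ := (h.integral_norm_powerTail_sq_le hd').trans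
      (pow_le_pow_left₀ (tsum_nonneg fun j => norm_nonneg _) hdr 2)
    obtain ⟨Q, hQ⟩ : ∃ Q : UnitCircle → ℂ, ∀ z : UnitCircle,
      powerTail (fun j => d (j + 1)) z = Q z := ⟨_, fun _ => rfl⟩
    simp only [hQ] at hc hm hN hsplit hQr hρ
    have hρ0 : 0 ≤ ∫ ω, ‖Q (γ ω)‖ ^ 2 ∂P := integral_nonneg fun ω => by positivity
    refine ⟨Q, fun z => ‖Q z‖ ^ 2 - ∫ ω, ‖Q (γ ω)‖ ^ 2 ∂P + (2 * (starRingEnd ℂ) (d 0) * Q z).re,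
      hc, ?_, hQr, fun z => ?_, hm, fun z => ?_⟩
    · exact ((hc.norm.pow 2).sub continuous_const).add
        (Complex.continuous_re.comp (continuous_const.mul hc))
    · have h1 : |(2 * (starRingEnd ℂ) (d 0) * Q z).re| ≤ 2 * A * r := by
        refine (Complex.abs_re_le_norm _).trans ?_
        rw [norm_mul, norm_mul, RCLike.norm_conj]
        have : ‖(2 : ℂ)‖ = 2 := by simp
        rw [this]
        exact mul_le_mul (mul_le_mul_of_nonneg_left hdA (by norm_num)) (hQr z) (norm_nonneg _)
          (by positivity)
      have h2 : |‖Q z‖ ^ 2 - ∫ ω, ‖Q (γ ω)‖ ^ 2 ∂P| ≤ r ^ 2 :=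
        abs_sub_le_of_nonneg_of_le (by positivity)
          (pow_le_pow_left₀ (norm_nonneg _) (hQr z) 2) hρ0 hρ
      linarith [abs_add_le (‖Q z‖ ^ 2 - ∫ ω, ‖Q (γ ω)‖ ^ 2 ∂P) (2 * (starRingEnd ℂ) (d 0) * Q z).re]
    · rw [hN, hsplit, norm_one_add_sq z.norm_coe, show 2 * Q z * (z : ℂ) = 2 * (z * Q z) by ring]
      ring
  obtain ⟨Q, Y, hQc, hYc, hQr, hY, hQm, hQ⟩ := dec b hb hA hr
  obtain ⟨Q', Y', hQc', hYc', hQr', hY', hQm', hQ'⟩ := dec b' hb' hA' hr'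
  have hlin : ∀ (c : ℂ) (K : ℝ), ‖c‖ ≤ K → ∀ z : UnitCircle, |(2 * c * z).re| ≤ 2 * K :=
    fun c K hc z => by
      refine (Complex.abs_re_le_norm _).trans ?_
      rw [norm_mul, norm_mul, z.norm_coe, mul_one, show ‖(2 : ℂ)‖ = 2 by simp]
      linarith
  -- the error term
  set Z : UnitCircle → ℝ := fun z => (2 * b 0 * z).re * Y' z + Y z * (2 * b' 0 * z).re
    + ((2 * Q z * z).re + Y z) * ((2 * Q' z * z).re + Y' z) with hZ
  have hXc : ∀ c : UnitCircle → ℂ, Continuous c → Continuous fun z : UnitCircle => (2 * c z * z).re :=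
    fun c hc => Complex.continuous_re.comp ((continuous_const.mul hc).mul continuous_subtype_val)
  have hZc : Continuous Z := ((hXc _ continuous_const).mul hYc').add
    (hYc.mul (hXc _ continuous_const)) |>.add (((hXc _ hQc).add hYc).mul ((hXc _ hQc').add hYc'))
  have hT0 : 0 ≤ 2 * A * r + r ^ 2 := by positivity
  have hZb : ∀ z, |Z z| ≤ 4 * A * (2 * A * r + r ^ 2) + (2 * r + 2 * A * r + r ^ 2) ^ 2 := by
    intro z
    have h1 : |(2 * b 0 * z).re * Y' z| ≤ 2 * A * (2 * A * r + r ^ 2) := by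
      rw [abs_mul]
      exact mul_le_mul (hlin _ _ hA z) (hY' z) (abs_nonneg _) (by positivity)
    have h2 : |Y z * (2 * b' 0 * z).re| ≤ 2 * A * (2 * A * r + r ^ 2) := by
      rw [mul_comm, abs_mul]
      exact mul_le_mul (hlin _ _ hA' z) (hY z) (abs_nonneg _) (by positivity)
    have h3 : |(2 * Q z * z).re + Y z| ≤ 2 * r + 2 * A * r + r ^ 2 := by
      have := hlin _ _ (hQr z) z
      linarith [abs_add_le (2 * Q z * z).re (Y z), hY z]
    have h4 : |(2 * Q' z * z).re + Y' z| ≤ 2 * r + 2 * A * r + r ^ 2 := by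
      have := hlin _ _ (hQr' z) z
      linarith [abs_add_le (2 * Q' z * z).re (Y' z), hY' z]
    have h5 : |((2 * Q z * z).re + Y z) * ((2 * Q' z * z).re + Y' z)|
        ≤ (2 * r + 2 * A * r + r ^ 2) ^ 2 := by
      rw [abs_mul, sq]
      exact mul_le_mul h3 h4 (abs_nonneg _) (by positivity)
    have h6 := abs_add_le ((2 * b 0 * z).re * Y' z + Y z * (2 * b' 0 * z).re)
      (((2 * Q z * z).re + Y z) * ((2 * Q' z * z).re + Y' z))
    have h7 := abs_add_le ((2 * b 0 * z).re * Y' z) (Y z * (2 * b' 0 * z).re)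
    simp only [hZ]
    linarith
  -- the terms with vanishing mean
  set V : UnitCircle → ℝ := fun z => (2 * (b 0 * b' 0) * (z : ℂ) ^ (1 + 1)).re
    + ((2 * b 0 * ((z : ℂ) ^ 2 * Q' z)).re + (2 * (starRingEnd ℂ) (b 0) * ((z : ℂ) ^ 0 * Q' z)).re
    + ((2 * b' 0 * ((z : ℂ) ^ 2 * Q z)).re + (2 * (starRingEnd ℂ) (b' 0) * ((z : ℂ) ^ 0 * Q z)).re))
    with hV
  have hrec : ∀ (c : ℂ) (q : UnitCircle → ℂ), Continuous q →
      Integrable (fun ω => (c * q (γ ω)).re) P := fun c q hq =>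
    h.integrable_comp (Complex.continuous_re.comp (continuous_const.mul hq))
  have i1 := hrec (2 * (b 0 * b' 0)) (fun z => (z : ℂ) ^ (1 + 1)) (continuous_subtype_val.pow _)
  have i2 := hrec (2 * b 0) (fun z => (z : ℂ) ^ 2 * Q' z) ((continuous_subtype_val.pow _).mul hQc')
  have i3 := hrec (2 * (starRingEnd ℂ) (b 0)) (fun z => (z : ℂ) ^ 0 * Q' z)
    ((continuous_subtype_val.pow _).mul hQc')
  have i4 := hrec (2 * b' 0) (fun z => (z : ℂ) ^ 2 * Q z) ((continuous_subtype_val.pow _).mul hQc)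
  have i5 := hrec (2 * (starRingEnd ℂ) (b' 0)) (fun z => (z : ℂ) ^ 0 * Q z)
    ((continuous_subtype_val.pow _).mul hQc)
  have hVi : Integrable (fun ω => V (γ ω)) P := i1.add ((i2.add i3).add (i4.add i5))
  have hV0 : ∫ ω, V (γ ω) ∂P = 0 := by
    simp only [hV]
    have e1 := integral_add i1 ((i2.add i3).add (i4.add i5))
    have e2 := integral_add (i2.add i3) (i4.add i5)
    have e3 := integral_add i2 i3
    have e4 := integral_add i4 i5
    simp only [Pi.add_apply] at e1 e2 e3 e4
    rw [e1, e2, e3, e4, h.integral_re_pow, hQm', hQm', hQm, hQm]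
    simp
  have hpt : ∀ ω, (‖1 + powerTail b (γ ω)‖ ^ 2 - ∫ ω', ‖1 + powerTail b (γ ω')‖ ^ 2 ∂P) *
        (‖1 + powerTail b' (γ ω)‖ ^ 2 - ∫ ω', ‖1 + powerTail b' (γ ω')‖ ^ 2 ∂P)
      = 2 * (b 0 * (starRingEnd ℂ) (b' 0)).re + V (γ ω) + Z (γ ω) := fun ω => by
    rw [hQ, hQ']
    simp only [hV, hZ]
    -- The product of the two linear terms yields the main term. The products of a linear term with
    -- the part 2 Re(Q z) of the other factor have size A r, which is not O(A³ + r²); they cannot be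
    -- estimated and must be seen to have mean zero, which is why they belong to `V` and not to `Z`.
    have e1 := re_mul_re_eq (γ ω).norm_coe (2 * b 0) (2 * b' 0)
    have e2 := re_mul_re_eq (γ ω).norm_coe (2 * b 0) (2 * Q' (γ ω))
    have e3 := re_mul_re_eq (γ ω).norm_coe (2 * b' 0) (2 * Q (γ ω))
    have f : ∀ u v : ℂ, (2 * u * (starRingEnd ℂ) (2 * v)).re = 4 * (u * (starRingEnd ℂ) v).re :=
      fun u v => by simp [Complex.mul_re]; ring
    have g : ∀ u v w : ℂ, (2 * u * (2 * v) * w).re = 2 * (2 * u * (w * v)).re :=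
      fun u v w => by simp [Complex.mul_re]; ring
    have k : ∀ u v w : ℂ, (2 * (starRingEnd ℂ) u * (w ^ 0 * v)).re
        = 2 * (u * (starRingEnd ℂ) v).re :=
      fun u v w => by simp [Complex.mul_re]; ring
    have l : (2 * (b 0 * b' 0) * (γ ω : ℂ) ^ (1 + 1)).re
        = (2 * b 0 * ((γ ω : ℂ) ^ 2 * b' 0)).re := by
      congr 1; ring
    rw [f, g] at e1 e2 e3
    rw [k, k, l]
    linear_combination e1 + e2 + e3
  simp_rw [hpt]
  have hZi := h.integrable_comp hZc
  have hCVi : Integrable (fun ω => 2 * (b 0 * (starRingEnd ℂ) (b' 0)).re + V (γ ω)) P :=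
    (integrable_const _).add hVi
  rw [integral_add hCVi hZi, integral_add (integrable_const _) hVi, hV0]
  simp only [integral_const, probReal_univ, one_smul, add_zero, add_sub_cancel_left]
  have e : ∫ _ω : Ω, 4 * A * (2 * A * r + r ^ 2) + (2 * r + 2 * A * r + r ^ 2) ^ 2 ∂P
      = 4 * A * (2 * A * r + r ^ 2) + (2 * r + 2 * A * r + r ^ 2) ^ 2 := by simp
  rw [← e, ← Real.norm_eq_abs]
  exact norm_integral_le_of_norm_le (integrable_const _) (ae_of_all _ fun ω => hZb _)

/-- The normalising means lie between 1 and 1 + A² + r². Dividing by them does not increase the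
covariance error, and alters the main term, itself at most 2A², by a relative error of at most N N'
- 1. -/
theorem abs_corr_sub_le (h : IsCentered P γ) {b b' : ℕ → ℂ}
    (hb : Summable fun j => ‖b j‖) (hb' : Summable fun j => ‖b' j‖) {A r : ℝ}
    (hA : ‖b 0‖ ≤ A) (hA' : ‖b' 0‖ ≤ A) (hr : ∑' j, ‖b (j + 1)‖ ≤ r)
    (hr' : ∑' j, ‖b' (j + 1)‖ ≤ r) :
    |∫ ω, (‖1 + powerTail b (γ ω)‖ ^ 2 / ∫ ω', ‖1 + powerTail b (γ ω')‖ ^ 2 ∂P) *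
        (‖1 + powerTail b' (γ ω)‖ ^ 2 / ∫ ω', ‖1 + powerTail b' (γ ω')‖ ^ 2 ∂P) ∂P - 1
      - 2 * (b 0 * (starRingEnd ℂ) (b' 0)).re|
      ≤ 16 * (1 + A + r) ^ 4 * (A ^ 3 + r ^ 2) := by
  have hA0 : 0 ≤ A := (norm_nonneg _).trans hA
  have hr0 : 0 ≤ r := (tsum_nonneg fun j => norm_nonneg _).trans hr
  have key := h.abs_integral_mul_sub_le hb hb' hA hA' hr hr'
  have hN := h.one_le_integral_norm_sq hb
  have hN' := h.one_le_integral_norm_sq hb'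
  have hNu := h.integral_norm_sq_le hb hA hr
  have hNu' := h.integral_norm_sq_le hb' hA' hr'
  have hFc : ∀ d : ℕ → ℂ, Summable (fun j => ‖d j‖) →
      Continuous fun z : UnitCircle => ‖1 + powerTail d z‖ ^ 2 := fun d hd =>
    (continuous_const.add (continuous_powerTail hd)).norm.pow 2
  have iF := h.integrable_comp (hFc b hb)
  have iF' := h.integrable_comp (hFc b' hb')
  have iFF := h.integrable_comp ((hFc b hb).mul (hFc b' hb'))
  set F : Ω → ℝ := fun ω => ‖1 + powerTail b (γ ω)‖ ^ 2 with hF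
  set F' : Ω → ℝ := fun ω => ‖1 + powerTail b' (γ ω)‖ ^ 2 with hF'
  set N := ∫ ω, F ω ∂P with hNdef
  set N' := ∫ ω, F' ω ∂P with hNdef'
  have e1 : ∫ ω, (F ω - N) * (F' ω - N') ∂P = (∫ ω, F ω * F' ω ∂P) - N * N' := by
    have e : ∀ ω, (F ω - N) * (F' ω - N') = F ω * F' ω - (N * F' ω + N' * F ω - N * N') :=
      fun ω => by ring
    have i1 : Integrable (fun ω => N * F' ω + N' * F ω) P := (iF'.const_mul N).add (iF.const_mul N')
    have i2 : Integrable (fun ω => N * F' ω + N' * F ω - N * N') P := i1.sub (integrable_const _)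
    have iFF' : Integrable (fun ω => F ω * F' ω) P := iFF
    simp_rw [e]
    rw [integral_sub iFF' i2, integral_sub i1 (integrable_const _),
      integral_add (iF'.const_mul N) (iF.const_mul N'), integral_const_mul, integral_const_mul]
    simp only [integral_const, probReal_univ, one_smul, ← hNdef, ← hNdef']
    ring
  have e2 : ∫ ω, F ω / N * (F' ω / N') ∂P = (∫ ω, F ω * F' ω ∂P) / (N * N') := by
    rw [← integral_div]
    congr 1 with ω
    rw [div_mul_div_comm]
  change |∫ ω, (F ω - N) * (F' ω - N') ∂P - 2 * (b 0 * (starRingEnd ℂ) (b' 0)).re| ≤ _ at key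
  change |∫ ω, F ω / N * (F' ω / N') ∂P - 1 - 2 * (b 0 * (starRingEnd ℂ) (b' 0)).re| ≤ _
  rw [e1] at key
  rw [e2]
  set I := ∫ ω, F ω * F' ω ∂P
  have hρ : |2 * (b 0 * (starRingEnd ℂ) (b' 0)).re| ≤ 2 * A ^ 2 := by
    rw [abs_mul, abs_two]
    refine mul_le_mul_of_nonneg_left ((Complex.abs_re_le_norm _).trans ?_) (by norm_num)
    rw [norm_mul, RCLike.norm_conj, sq]
    exact mul_le_mul hA hA' (norm_nonneg _) hA0
  set ρ := 2 * (b 0 * (starRingEnd ℂ) (b' 0)).re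
  have hNN : 1 ≤ N * N' := by nlinarith
  have hNNu : N * N' - 1 ≤ (A ^ 2 + r ^ 2) * (2 + A ^ 2 + r ^ 2) := by
    have := mul_le_mul hNu hNu' (by linarith) (by positivity)
    nlinarith
  have e3 : I / (N * N') - 1 - ρ = (I - N * N' - ρ) / (N * N') - ρ * ((N * N' - 1) / (N * N')) := by
    have : N * N' ≠ 0 := by linarith
    field_simp
    ring
  have h1 : |(I - N * N' - ρ) / (N * N')|
      ≤ 4 * A * (2 * A * r + r ^ 2) + (2 * r + 2 * A * r + r ^ 2) ^ 2 := by
    rw [abs_div, abs_of_pos (by linarith : 0 < N * N')]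
    exact (div_le_self (abs_nonneg _) hNN).trans key
  have h2 : |ρ * ((N * N' - 1) / (N * N'))| ≤ 2 * A ^ 2 * ((A ^ 2 + r ^ 2) * (2 + A ^ 2 + r ^ 2)) := by
    rw [abs_mul]
    refine mul_le_mul hρ ?_ (abs_nonneg _) (by positivity)
    rw [abs_of_nonneg (div_nonneg (by linarith) (by linarith))]
    exact (div_le_self (by linarith) hNN).trans hNNu
  rw [e3]
  exact (abs_sub _ _).trans ((add_le_add h1 h2).trans (corr_error_le hA0 hr0))

end IsCentered

end RandomEuler

end

/-! ### From correlations of single factors to correlations of products -/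

noncomputable section

namespace RandomEuler

theorem sum_Ico_le_tsum_add {e : ℕ → ℝ} (he : Summable e) (he0 : ∀ k, 0 ≤ e k) (n m : ℕ) :
    ∑ k ∈ Finset.Ico n m, e k ≤ ∑' k, e (k + n) := by
  rw [Finset.sum_Ico_eq_sum_range]
  simp_rw [add_comm n]
  exact ((summable_nat_add_iff n).2 he).sum_le_tsum _ fun k _ => he0 _

/-- log(1 + y) ≥ 1 - 1/(1 + y) = y - y²/(1 + y), and 1 + y ≥ 1/2. -/
theorem exp_sub_two_mul_sq_le {y : ℝ} (hy : |y| ≤ 1 / 2) : Real.exp (y - 2 * y ^ 2) ≤ 1 + y := by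
  obtain ⟨h1, h2⟩ := abs_le.1 hy
  have h0 : 0 < 1 + y := by linarith
  rw [← Real.le_log_iff_exp_le h0]
  refine le_trans ?_ (Real.one_sub_inv_le_log_of_pos h0)
  rw [← sub_nonneg]
  have : 1 - (1 + y)⁻¹ - (y - 2 * y ^ 2) = y ^ 2 * (1 + 2 * y) / (1 + y) := by
    field_simp
    ring
  rw [this]
  exact div_nonneg (mul_nonneg (sq_nonneg y) (by linarith)) h0.le

variable {Ω E T : Type*} [MeasurableSpace Ω] [MeasurableSpace E]

/-- Bounds for the products of correlations from bounds for sums of their leading terms. -/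
theorem hasCorrBound_of_factorCorr {P : Measure Ω} {γ : ℕ → Ω → E} {ψ : T → ℕ → ℝ → E → ℝ}
    (hfield : ∀ τ, IsUnitField P γ (ψ τ)) {x : T → ℕ → ℝ → ℝ → ℝ} {e y₂ : ℕ → ℝ}
    (he : Summable e) (hy₂ : Summable y₂) {a : ℝ} (ha : a < 1)
    (h1 : ∀ τ k s s', |factorCorr P γ (ψ τ) k s s' - 1 - x τ k s s'| ≤ e k)
    (h2 : ∀ τ k s s', (factorCorr P γ (ψ τ) k s s' - 1) ^ 2 ≤ y₂ k)
    (h3 : ∀ M, ∃ C, ∀ τ n m s s', |s| ≤ M → |s'| ≤ M → s ≠ s' →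
      ∑ k ∈ Finset.Ico n m, x τ k s s' ≤ a * Real.log (1 / |s - s'|) + C)
    (h4 : ∀ s s', s ≠ s' → ∃ δ : ℕ → ℝ, Tendsto δ atTop (𝓝 0) ∧
      ∀ᶠ n in atTop, ∀ m τ, n ≤ m → |∑ k ∈ Finset.Ico n m, x τ k s s'| ≤ δ n) :
    HasCorrBound P γ ψ a where
  field := hfield
  exp_lt := ha
  le_rpow M := by
    rcases isEmpty_or_nonempty T with hT | ⟨⟨τ₀⟩⟩
    · exact ⟨0, fun τ => hT.elim τ⟩
    have he0 : ∀ k, 0 ≤ e k := fun k => (abs_nonneg _).trans (h1 τ₀ k 0 0)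
    obtain ⟨C, hC⟩ := h3 M
    refine ⟨Real.exp (C + ∑' k, e k), fun τ n m s s' hs hs' hne => ?_⟩
    have hpos : 0 < |s - s'| := abs_pos.2 (sub_ne_zero.2 hne)
    calc blockCorr P γ (ψ τ) n m s s'
        ≤ ∏ k ∈ Finset.Ico n m, Real.exp (x τ k s s' + e k) := by
          refine Finset.prod_le_prod (fun k _ => (hfield τ).factorCorr_nonneg k s s') fun k _ => ?_
          have := (abs_le.1 (h1 τ k s s')).2
          linarith [Real.add_one_le_exp (x τ k s s' + e k)]
      _ = Real.exp (∑ k ∈ Finset.Ico n m, x τ k s s' + ∑ k ∈ Finset.Ico n m, e k) := by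
          rw [← Real.exp_sum, Finset.sum_add_distrib]
      _ ≤ Real.exp ((a * Real.log (1 / |s - s'|) + C) + ∑' k, e k) :=
          Real.exp_le_exp.2 (add_le_add (hC τ n m s s' hs hs' hne)
            (he.sum_le_tsum _ fun k _ => he0 k))
      _ = _ := by
          rw [Real.rpow_def_of_pos hpos, ← Real.exp_add, one_div, Real.log_inv]
          congr 1
          ring
  tendsto_one s s' hne := by
    rcases isEmpty_or_nonempty T with hT | ⟨⟨τ₀⟩⟩
    · have : IsEmpty (ℕ × ℕ × T) := ⟨fun q => hT.elim q.2.2⟩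
      rw [(tailFilter T).filter_eq_bot_of_isEmpty]
      exact tendsto_bot
    have he0 : ∀ k, 0 ≤ e k := fun k => (abs_nonneg _).trans (h1 τ₀ k 0 0)
    have hy0 : ∀ k, 0 ≤ y₂ k := fun k => (sq_nonneg _).trans (h2 τ₀ k 0 0)
    obtain ⟨δ, hδ, hδt⟩ := h4 s s' hne
    have hfst : Tendsto (fun q : ℕ × ℕ × T => q.1) (tailFilter T) atTop :=
      tendsto_comap.mono_left inf_le_left
    have hR := tendsto_sum_nat_add e
    have hG := tendsto_sum_nat_add y₂
    have hup : Tendsto (fun q : ℕ × ℕ × T => Real.exp (δ q.1 + ∑' k, e (k + q.1)))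
        (tailFilter T) (𝓝 1) := by
      have := (Real.continuous_exp.tendsto _).comp ((hδ.add hR).comp hfst)
      simp only [add_zero, Real.exp_zero] at this
      exact this
    have hlo : Tendsto (fun q : ℕ × ℕ × T =>
        Real.exp (-(δ q.1 + ∑' k, e (k + q.1)) - 2 * ∑' k, y₂ (k + q.1)))
        (tailFilter T) (𝓝 1) := by
      have := (Real.continuous_exp.tendsto _).comp
        (((hδ.add hR).neg.sub (hG.const_mul 2)).comp hfst)
      simp only [add_zero, neg_zero, mul_zero, sub_zero, Real.exp_zero] at this
      exact this
    have hsum : ∀ᶠ q in tailFilter T, |∑ k ∈ Finset.Ico q.1 q.2.1,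
        (factorCorr P γ (ψ q.2.2) k s s' - 1)| ≤ δ q.1 + ∑' k, e (k + q.1) := by
      obtain ⟨N, hN⟩ := eventually_atTop.1 hδt
      refine eventually_tailFilter.2 ⟨N, fun n m τ hn hnm => ?_⟩
      have e1 : ∑ k ∈ Finset.Ico n m, (factorCorr P γ (ψ τ) k s s' - 1)
          = ∑ k ∈ Finset.Ico n m, x τ k s s'
            + ∑ k ∈ Finset.Ico n m, (factorCorr P γ (ψ τ) k s s' - 1 - x τ k s s') := by
        rw [← Finset.sum_add_distrib]
        exact Finset.sum_congr rfl fun k _ => by ring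
      change |∑ k ∈ Finset.Ico n m, (factorCorr P γ (ψ τ) k s s' - 1)| ≤ _
      rw [e1]
      refine (abs_add_le _ _).trans (add_le_add (hN n hn m τ hnm) ?_)
      exact (Finset.abs_sum_le_sum_abs _ _).trans ((Finset.sum_le_sum fun k _ => h1 τ k s s').trans
        (sum_Ico_le_tsum_add he he0 n m))
    -- With y_k the correlation of the k-th field minus one, the product lies between exp of the sum
    -- of y_k - 2 y_k² and exp of the sum of y_k. The lower bound needs |y_k| ≤ 1/2, which holds
    -- uniformly in τ as soon as `y₂ k ≤ 1/4`.
    refine tendsto_of_tendsto_of_tendsto_of_le_of_le' hlo hup ?_ ?_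
    · obtain ⟨N₁, hN₁⟩ := eventually_tailFilter.1 hsum
      obtain ⟨N₂, hN₂⟩ := eventually_atTop.1 (hy₂.tendsto_atTop_zero.eventually_le_const
        (show (0 : ℝ) < 1 / 4 by norm_num))
      refine eventually_tailFilter.2 ⟨max N₁ N₂, fun n m τ hn hnm => ?_⟩
      have hs := (abs_le.1 (hN₁ n m τ ((le_max_left _ _).trans hn) hnm)).1
      have hq : ∑ k ∈ Finset.Ico n m, (factorCorr P γ (ψ τ) k s s' - 1) ^ 2 ≤ ∑' k, y₂ (k + n) :=
        (Finset.sum_le_sum fun k _ => h2 τ k s s').trans (sum_Ico_le_tsum_add hy₂ hy0 n m)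
      simp only at hs ⊢
      calc _ ≤ Real.exp (∑ k ∈ Finset.Ico n m, ((factorCorr P γ (ψ τ) k s s' - 1)
              - 2 * (factorCorr P γ (ψ τ) k s s' - 1) ^ 2)) := by
            rw [Real.exp_le_exp, Finset.sum_sub_distrib, ← Finset.mul_sum]
            linarith
        _ ≤ _ := by
            rw [Real.exp_sum]
            refine Finset.prod_le_prod (fun k _ => (Real.exp_pos _).le) fun k hk => ?_
            have hk' : N₂ ≤ k := (le_max_right _ _).trans (hn.trans (Finset.mem_Ico.1 hk).1)
            have := exp_sub_two_mul_sq_le (y := factorCorr P γ (ψ τ) k s s' - 1) (by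
              refine abs_le_of_sq_le_sq ?_ (by norm_num)
              exact (h2 τ k s s').trans ((hN₂ k hk').trans (by norm_num)))
            linarith
    · refine hsum.mono fun q hq => ?_
      refine le_trans ?_ (Real.exp_le_exp.2 ((le_abs_self _).trans hq))
      rw [Real.exp_sum]
      refine Finset.prod_le_prod (fun k _ => (hfield _).factorCorr_nonneg k s s') fun k _ => ?_
      linarith [Real.add_one_le_exp (factorCorr P γ (ψ q.2.2) k s s' - 1)]

end RandomEuler

end

/-! ### Coefficients of the Euler factors and their summability -/

noncomputable section

namespace RandomEuler

/-- The coefficients of the Euler factor at the `k`-th prime, on the line `(1 + τ) / 2 + i s`. -/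
def eulerCoef (f : ℕ → ℂ) (τ : NNReal) (k : ℕ) (s : ℝ) (j : ℕ) : ℂ :=
  f (nthPrime k ^ (j + 1)) / (nthPrime k : ℂ) ^ (((j : ℂ) + 1) *
    (((1 / 2 * (1 + (τ : ℝ)) : ℝ) : ℂ) + s * Complex.I))

/-- A majorant of the coefficients of the Euler factor at the `k`-th prime. -/
def coefBound (f : ℕ → ℂ) (k j : ℕ) : ℝ :=
  ‖f (nthPrime k ^ (j + 1))‖ / (nthPrime k : ℝ) ^ (((j : ℝ) + 1) / 2)

/-- A majorant of the coefficients of the Euler factor at the `k`-th prime, after the first. -/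
def restBound (f : ℕ → ℂ) (k : ℕ) : ℝ := ∑' j, coefBound f k (j + 1)

variable {f : ℕ → ℂ}

theorem nthPrime_pos (k : ℕ) : (0 : ℝ) < nthPrime k := by exact_mod_cast (prime_nthPrime k).pos

theorem one_lt_nthPrime (k : ℕ) : (1 : ℝ) < nthPrime k := by exact_mod_cast (prime_nthPrime k).one_lt

theorem coefBound_nonneg (k j : ℕ) : 0 ≤ coefBound f k j := by unfold coefBound; positivity

theorem restBound_nonneg (k : ℕ) : 0 ≤ restBound f k := tsum_nonneg fun _ => coefBound_nonneg _ _

theorem norm_eulerCoef (τ : NNReal) (k : ℕ) (s : ℝ) (j : ℕ) :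
    ‖eulerCoef f τ k s j‖
      = ‖f (nthPrime k ^ (j + 1))‖ / (nthPrime k : ℝ) ^ (((j : ℝ) + 1) * (1 / 2 * (1 + (τ : ℝ)))) := by
  rw [eulerCoef, norm_div, Complex.norm_natCast_cpow_of_pos (prime_nthPrime k).pos]
  congr 2
  simp [Complex.mul_re]

theorem norm_eulerCoef_le (τ : NNReal) (k : ℕ) (s : ℝ) (j : ℕ) :
    ‖eulerCoef f τ k s j‖ ≤ coefBound f k j := by
  rw [norm_eulerCoef, coefBound]
  have h := one_lt_nthPrime k
  have hτ := τ.coe_nonneg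
  refine div_le_div_of_nonneg_left (norm_nonneg _) (by positivity)
    (Real.rpow_le_rpow_of_exponent_le h.le ?_)
  have : (0 : ℝ) ≤ ((j : ℝ) + 1) * τ := by positivity
  nlinarith

theorem continuous_eulerCoef (k j : ℕ) :
    Continuous fun x : NNReal × ℝ => eulerCoef f x.1 k x.2 j := by
  have hp : (nthPrime k : ℂ) ≠ 0 := by exact_mod_cast (prime_nthPrime k).ne_zero
  unfold eulerCoef
  refine continuous_const.div (Continuous.const_cpow (by fun_prop) (Or.inl hp)) fun x => ?_
  simp [Complex.cpow_eq_zero_iff, hp]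

/-- The two lines together contribute p^(-1-τ). It is written as 1/p times the damping p^(-τ), the
decreasing weight that Abel's inequality removes. -/
theorem eulerCoef_mul_conj_re (τ : NNReal) (k : ℕ) (s s' : ℝ) :
    (eulerCoef f τ k s 0 * (starRingEnd ℂ) (eulerCoef f τ k s' 0)).re
      = Real.cos ((s - s') * Real.log (nthPrime k)) / nthPrime k * ‖f (nthPrime k)‖ ^ 2
        * (nthPrime k : ℝ) ^ (-(τ : ℝ)) := by
  have hp := nthPrime_pos k
  have hpc : (nthPrime k : ℂ) ≠ 0 := by exact_mod_cast (prime_nthPrime k).ne_zero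
  set L := Real.log (nthPrime k) with hL
  have e : ∀ s : ℝ, eulerCoef f τ k s 0 = f (nthPrime k) * (((nthPrime k : ℝ) ^
      (-(1 / 2 * (1 + (τ : ℝ)))) : ℝ) : ℂ) * Complex.exp (((-(s * L) : ℝ) : ℂ) * Complex.I) := by
    intro s
    rw [eulerCoef, Real.rpow_def_of_pos hp, Complex.ofReal_exp, mul_assoc, ← Complex.exp_add,
      div_eq_mul_inv, ← Complex.cpow_neg, Complex.cpow_def_of_ne_zero hpc,
      ← Complex.natCast_log, ← hL]
    simp only [zero_add, pow_one, CharP.cast_eq_zero, one_mul]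
    congr 2
    push_cast
    ring
  set R := (nthPrime k : ℝ) ^ (-(1 / 2 * (1 + (τ : ℝ)))) with hR
  have hRR : R * R = (nthPrime k : ℝ)⁻¹ * (nthPrime k : ℝ) ^ (-(τ : ℝ)) := by
    rw [hR, ← Real.rpow_add hp, ← Real.rpow_neg_one, ← Real.rpow_add hp]
    congr 1
    ring
  have e2 : eulerCoef f τ k s 0 * (starRingEnd ℂ) (eulerCoef f τ k s' 0)
      = ((‖f (nthPrime k)‖ ^ 2 * (R * R) : ℝ) : ℂ)
        * Complex.exp (((-((s - s') * L) : ℝ) : ℂ) * Complex.I) := by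
    rw [e, e, map_mul, map_mul, ← Complex.exp_conj, Complex.conj_ofReal, map_mul, Complex.conj_I,
      Complex.conj_ofReal]
    have e3 : Complex.exp (((-((s - s') * L) : ℝ) : ℂ) * Complex.I)
        = Complex.exp (((-(s * L) : ℝ) : ℂ) * Complex.I)
          * Complex.exp (((-(s' * L) : ℝ) : ℂ) * -Complex.I) := by
      rw [← Complex.exp_add]
      congr 1
      push_cast
      ring
    rw [e3]
    push_cast
    rw [← Complex.mul_conj']
    ring
  rw [e2, Complex.re_ofReal_mul, Complex.exp_ofReal_mul_I_re, Real.cos_neg, hRR]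
  field_simp

/-- A Cauchy-Schwarz inequality for sums. -/
theorem summable_and_tsum_sq_le {v c q : ℕ → ℝ} (hv : ∀ i, 0 ≤ v i) (hc : ∀ i, 0 ≤ c i)
    (hq : ∀ i, 0 ≤ q i) (h : ∀ i, v i ^ 2 ≤ c i * q i) (hcs : Summable c) (hqs : Summable q) :
    Summable v ∧ (∑' i, v i) ^ 2 ≤ (∑' i, c i) * ∑' i, q i := by
  have hle : ∀ u : Finset ℕ, ∑ i ∈ u, v i ≤ √((∑' i, c i) * ∑' i, q i) := fun u => by
    refine Real.le_sqrt_of_sq_le ?_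
    refine (Finset.sum_sq_le_sum_mul_sum_of_sq_le_mul u (fun i _ => hc i) (fun i _ => hq i)
      fun i _ => h i).trans ?_
    exact mul_le_mul (hcs.sum_le_tsum _ fun i _ => hc i) (hqs.sum_le_tsum _ fun i _ => hq i)
      (Finset.sum_nonneg fun i _ => hq i) (tsum_nonneg hc)
  refine ⟨summable_of_sum_le hv hle, ?_⟩
  have h0 : 0 ≤ (∑' i, c i) * ∑' i, q i := mul_nonneg (tsum_nonneg hc) (tsum_nonneg hq)
  calc _ ≤ √((∑' i, c i) * ∑' i, q i) ^ 2 :=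
        pow_le_pow_left₀ (tsum_nonneg hv) (Real.tsum_le_of_sum_le hv hle) 2
    _ = _ := Real.sq_sqrt h0

/-- The ratio of the geometric majorant of the coefficients. -/
def coefRatio : ℝ := 2 ^ (-(1 / 2) : ℝ)

theorem coefRatio_pos : 0 < coefRatio := by unfold coefRatio; positivity

theorem coefRatio_lt_one : coefRatio < 1 :=
  Real.rpow_lt_one_of_one_lt_of_neg (by norm_num) (by norm_num)

theorem summable_coefRatio : Summable fun i => coefRatio ^ i :=
  summable_geometric_of_lt_one coefRatio_pos.le coefRatio_lt_one

/-- Half of the available power of p is left to the summability hypothesis; the other half is at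
most a geometric weight, because p ≥ 2. This is the input for Cauchy-Schwarz over the exponents. -/
theorem coefBound_sq_le (f : ℕ → ℂ) (k i : ℕ) : coefBound f k (i + 2) ^ 2
    ≤ ‖f (nthPrime k ^ (i + 3))‖ ^ 2 / (nthPrime k : ℝ) ^ (((i : ℝ) + 3) / 2) * coefRatio ^ i := by
  have hp := nthPrime_pos k
  have hp2 : (2 : ℝ) ≤ nthPrime k := by exact_mod_cast two_le_nthPrime k
  have e1 : coefBound f k (i + 2) ^ 2 = ‖f (nthPrime k ^ (i + 3))‖ ^ 2
      / (nthPrime k : ℝ) ^ (((i : ℝ) + 3) / 2) * (nthPrime k : ℝ) ^ (-(((i : ℝ) + 3) / 2)) := by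
    rw [coefBound, div_pow, Real.rpow_neg hp.le, ← div_eq_mul_inv, div_div]
    congr 1
    rw [sq]
    push_cast
    ring_nf
  rw [e1]
  refine mul_le_mul_of_nonneg_left ?_ (by positivity)
  calc (nthPrime k : ℝ) ^ (-(((i : ℝ) + 3) / 2)) ≤ 2 ^ (-(((i : ℝ) + 3) / 2)) :=
        Real.rpow_le_rpow_of_nonpos (by norm_num) hp2 (by
          have : (0 : ℝ) ≤ i := Nat.cast_nonneg i
          linarith)
    _ ≤ 2 ^ (-(1 / 2) * (i : ℝ)) := Real.rpow_le_rpow_of_exponent_le (by norm_num) (by linarith)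
    _ = _ := by rw [Real.rpow_mul (by norm_num), Real.rpow_natCast, coefRatio]

namespace SummabilityCondition

theorem tsum_nthPrime_ne_top (h : SummabilityCondition f) :
    ∑' k : ℕ, (ENNReal.ofReal (‖f (nthPrime k)‖ ^ 3 / (nthPrime k : ℝ) ^ (3 / 2 : ℝ))
      + ENNReal.ofReal (‖f (nthPrime k ^ 2)‖ ^ 2 / (nthPrime k : ℝ) ^ 2)
      + ∑' i : ℕ, ENNReal.ofReal
          (‖f (nthPrime k ^ (i + 3))‖ ^ 2 / (nthPrime k : ℝ) ^ (((i : ℝ) + 3) / 2))) ≠ ⊤ := by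
  refine (lt_of_le_of_lt ?_ h).ne
  exact ENNReal.tsum_comp_le_tsum_of_injective
    (f := fun k => (⟨nthPrime k, prime_nthPrime k⟩ : Nat.Primes))
    (fun a b hab => strictMono_nthPrime.injective (congrArg Subtype.val hab)) _

theorem summable_first (h : SummabilityCondition f) : Summable fun k => coefBound f k 0 ^ 3 := by
  have h1 := ENNReal.summable_toReal (ne_top_of_le_ne_top h.tsum_nthPrime_ne_top
    (ENNReal.tsum_le_tsum fun k => (le_self_add.trans le_self_add)))
  refine h1.congr fun k => ?_
  rw [ENNReal.toReal_ofReal (by positivity), coefBound, div_pow, ← Real.rpow_mul_natCast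
    (nthPrime_pos k).le]
  norm_num

theorem summable_second (h : SummabilityCondition f) : Summable fun k => coefBound f k 1 ^ 2 := by
  have h1 := ENNReal.summable_toReal (ne_top_of_le_ne_top h.tsum_nthPrime_ne_top
    (ENNReal.tsum_le_tsum fun k => (le_add_self.trans le_self_add)))
  refine h1.congr fun k => ?_
  rw [ENNReal.toReal_ofReal (by positivity), coefBound, div_pow, ← Real.rpow_mul_natCast
    (nthPrime_pos k).le]
  norm_num

theorem higher (h : SummabilityCondition f) :
    (∀ k, Summable fun i : ℕ =>
      ‖f (nthPrime k ^ (i + 3))‖ ^ 2 / (nthPrime k : ℝ) ^ (((i : ℝ) + 3) / 2)) ∧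
    Summable fun k => ∑' i : ℕ,
      ‖f (nthPrime k ^ (i + 3))‖ ^ 2 / (nthPrime k : ℝ) ^ (((i : ℝ) + 3) / 2) := by
  have h1 := ne_top_of_le_ne_top h.tsum_nthPrime_ne_top
    (ENNReal.tsum_le_tsum fun k => le_add_self)
  have h2 : ∀ k i : ℕ, (ENNReal.ofReal
      (‖f (nthPrime k ^ (i + 3))‖ ^ 2 / (nthPrime k : ℝ) ^ (((i : ℝ) + 3) / 2))).toReal
      = ‖f (nthPrime k ^ (i + 3))‖ ^ 2 / (nthPrime k : ℝ) ^ (((i : ℝ) + 3) / 2) :=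
    fun k i => ENNReal.toReal_ofReal (by positivity)
  refine ⟨fun k => ?_, ?_⟩
  · have := ENNReal.summable_toReal (ENNReal.ne_top_of_tsum_ne_top h1 k)
    simpa only [h2] using this
  · have := ENNReal.summable_toReal h1
    simp only [ENNReal.tsum_toReal_eq (fun _ => ENNReal.ofReal_ne_top), h2] at this
    exact this

theorem summable_coefBound (h : SummabilityCondition f) (k : ℕ) :
    Summable fun j => coefBound f k j := by
  have := (summable_and_tsum_sq_le (fun i => coefBound_nonneg k (i + 2)) (fun i => by positivity)
    (fun i => pow_nonneg coefRatio_pos.le i) (coefBound_sq_le f k) (h.higher.1 k)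
    summable_coefRatio).1
  exact (summable_nat_add_iff (f := fun j => coefBound f k j) 2).1 this

theorem summable_norm_eulerCoef (h : SummabilityCondition f) (τ : NNReal) (k : ℕ) (s : ℝ) :
    Summable fun j => ‖eulerCoef f τ k s j‖ :=
  (h.summable_coefBound k).of_nonneg_of_le (fun _ => norm_nonneg _) (norm_eulerCoef_le τ k s)

theorem tsum_norm_eulerCoef_le (h : SummabilityCondition f) (τ : NNReal) (k : ℕ) (s : ℝ) :
    ∑' j, ‖eulerCoef f τ k s (j + 1)‖ ≤ restBound f k :=
  ((summable_nat_add_iff (f := fun j => ‖eulerCoef f τ k s j‖) 1).2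
    (h.summable_norm_eulerCoef τ k s)).tsum_le_tsum (fun j => norm_eulerCoef_le τ k s (j + 1))
    ((summable_nat_add_iff (f := fun j => coefBound f k j) 1).2 (h.summable_coefBound k))

/-- The square p² is separated from the higher powers by (x + y)² ≤ 2x² + 2y². For p² the hypothesis
applies directly; for the higher powers Cauchy-Schwarz against the geometric weight bounds the
square of the sum. -/
theorem summable_restBound_sq (h : SummabilityCondition f) :
    Summable fun k => restBound f k ^ 2 := by
  set c : ℕ → ℕ → ℝ := fun k i =>
    ‖f (nthPrime k ^ (i + 3))‖ ^ 2 / (nthPrime k : ℝ) ^ (((i : ℝ) + 3) / 2) with hc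
  have hcs : Summable fun k => ∑' i, c k i := h.higher.2
  refine Summable.of_nonneg_of_le (fun k => sq_nonneg _) (fun k => ?_)
    ((h.summable_second.mul_left 2).add ((hcs.mul_right (∑' i, coefRatio ^ i)).mul_left 2))
  have h1 := (summable_and_tsum_sq_le (fun i => coefBound_nonneg k (i + 2)) (fun i => by positivity)
    (fun i => pow_nonneg coefRatio_pos.le i) (coefBound_sq_le f k) (h.higher.1 k)
    summable_coefRatio).2
  have h2 : restBound f k = coefBound f k 1 + ∑' i, coefBound f k (i + 2) := by
    unfold restBound
    rw [((summable_nat_add_iff (f := fun j => coefBound f k j) 1).2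
      (h.summable_coefBound k)).tsum_eq_zero_add]
  rw [h2]
  nlinarith [sq_nonneg (coefBound f k 1 - ∑' i, coefBound f k (i + 2))]

theorem exists_coefBound_le (h : SummabilityCondition f) : ∃ K, 0 ≤ K ∧ ∀ k, coefBound f k 0 ≤ K := by
  obtain ⟨K, hK⟩ := h.summable_first.tendsto_atTop_zero.bddAbove_range
  have hK' : ∀ k, coefBound f k 0 ^ 3 ≤ K := fun k => hK ⟨k, rfl⟩
  refine ⟨K + 1, ?_, fun k => ?_⟩
  · have := hK' 0
    have := pow_nonneg (coefBound_nonneg (f := f) 0 0) 3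
    linarith
  · by_contra hlt
    have h0 := coefBound_nonneg (f := f) k 0
    have h1 : 1 ≤ coefBound f k 0 := by
      have := hK' k
      have := pow_nonneg h0 3
      linarith
    have := hK' k
    have h2 : coefBound f k 0 ≤ coefBound f k 0 ^ 3 := le_self_pow₀ h1 (by norm_num)
    linarith

theorem exists_restBound_le (h : SummabilityCondition f) : ∃ K, 0 ≤ K ∧ ∀ k, restBound f k ≤ K := by
  obtain ⟨K, hK⟩ := h.summable_restBound_sq.tendsto_atTop_zero.bddAbove_range
  have hK' : ∀ k, restBound f k ^ 2 ≤ K := fun k => hK ⟨k, rfl⟩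
  exact ⟨√K, Real.sqrt_nonneg _, fun k => Real.le_sqrt_of_sq_le (hK' k)⟩

/-- Geometric decay of the coefficients gives the Euler factor, as a power series in α(p), a radius
of convergence larger than one. This is used only to control its zeros. -/
theorem exists_geometric (h : SummabilityCondition f) (k : ℕ) :
    ∃ C, ∀ j, coefBound f k j ≤ C * √coefRatio ^ j := by
  set ρ := √coefRatio with hρ
  have hρ0 : 0 < ρ := Real.sqrt_pos.2 coefRatio_pos
  obtain ⟨K, hK⟩ := (h.higher.1 k).tendsto_atTop_zero.bddAbove_range
  have hK' : ∀ i : ℕ, ‖f (nthPrime k ^ (i + 3))‖ ^ 2 / (nthPrime k : ℝ) ^ (((i : ℝ) + 3) / 2) ≤ K :=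
    fun i => hK ⟨i, rfl⟩
  have h1 : ∀ i, coefBound f k (i + 2) ≤ √K * ρ ^ i := fun i => by
    have e : (√K * ρ ^ i) ^ 2 = K * coefRatio ^ i := by
      rw [mul_pow, Real.sq_sqrt ((by positivity : (0 : ℝ) ≤ _).trans (hK' 0)), ← pow_mul,
        mul_comm i, pow_mul, hρ, Real.sq_sqrt coefRatio_pos.le]
    refine (le_abs_self _).trans (abs_le_of_sq_le_sq ?_ (by positivity))
    rw [e]
    exact (coefBound_sq_le f k i).trans
      (mul_le_mul_of_nonneg_right (hK' i) (pow_nonneg coefRatio_pos.le i))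
  -- One summand for each of the cases j = 0, j = 1 and j ≥ 2; the powers of ρ in the denominators
  -- undo the index shift.
  refine ⟨coefBound f k 0 + coefBound f k 1 / ρ + √K / ρ ^ 2, fun j => ?_⟩
  have c0 := coefBound_nonneg (f := f) k 0
  have c1 : 0 ≤ coefBound f k 1 / ρ := div_nonneg (coefBound_nonneg k 1) hρ0.le
  have c2 : 0 ≤ √K / ρ ^ 2 := by positivity
  match j with
  | 0 => rw [pow_zero, mul_one]; linarith
  | 1 =>
    rw [pow_one]
    have : coefBound f k 1 = coefBound f k 1 / ρ * ρ := by field_simp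
    nlinarith
  | i + 2 =>
    refine (h1 i).trans ?_
    have : √K * ρ ^ i = √K / ρ ^ 2 * ρ ^ (i + 2) := by rw [pow_add]; field_simp
    rw [this]
    exact mul_le_mul_of_nonneg_right (by linarith) (by positivity)

end SummabilityCondition

end RandomEuler

end

/-! ### The normalised Euler factors as mean-one fields -/

noncomputable section

namespace RandomEuler

/-- The Euler factor at the `k`-th prime as a function of the value of the random function. -/
def eulerSeries (f : ℕ → ℂ) (τ : NNReal) (k : ℕ) (s : ℝ) (z : UnitCircle) : ℂ :=
  1 + powerTail (eulerCoef f τ k s) z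

variable {Ω : Type*} [MeasurableSpace Ω]

/-- The mean square of the Euler factor at the `k`-th prime. -/
def eulerNorm (P : Measure Ω) (γ : ℕ → Ω → UnitCircle) (f : ℕ → ℂ) (τ : NNReal) (k : ℕ) (s : ℝ) :
    ℝ :=
  ∫ ω, ‖eulerSeries f τ k s (γ k ω)‖ ^ 2 ∂P

/-- The normalised square of the Euler factor at the `k`-th prime. -/
def eulerField (P : Measure Ω) (γ : ℕ → Ω → UnitCircle) (f : ℕ → ℂ) (τ : NNReal) (k : ℕ) (s : ℝ)
    (z : UnitCircle) : ℝ :=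
  ‖eulerSeries f τ k s z‖ ^ 2 / eulerNorm P γ f τ k s

variable {P : Measure Ω} {γ : ℕ → Ω → UnitCircle} {f : ℕ → ℂ} {θ : ℝ}

namespace SummabilityCondition

theorem norm_eulerSeries_le (h : SummabilityCondition f) (τ : NNReal) (k : ℕ) (s : ℝ)
    (z : UnitCircle) : ‖eulerSeries f τ k s z‖ ≤ 1 + ∑' j, coefBound f k j := by
  refine (norm_add_le _ _).trans ?_
  rw [norm_one]
  refine add_le_add le_rfl ((norm_powerTail_le (h.summable_norm_eulerCoef τ k s) z).trans ?_)
  exact (h.summable_norm_eulerCoef τ k s).tsum_le_tsum (norm_eulerCoef_le τ k s)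
    (h.summable_coefBound k)

theorem norm_eulerSeries_sq_le (h : SummabilityCondition f) (τ : NNReal) (k : ℕ) (s : ℝ)
    (z : UnitCircle) : ‖eulerSeries f τ k s z‖ ^ 2 ≤ (1 + ∑' j, coefBound f k j) ^ 2 :=
  pow_le_pow_left₀ (norm_nonneg _) (h.norm_eulerSeries_le τ k s z) 2

theorem continuous_eulerSeries (h : SummabilityCondition f) (k : ℕ) :
    Continuous fun x : NNReal × ℝ × UnitCircle => eulerSeries f x.1 k x.2.1 x.2.2 := by
  have h1 : Continuous fun x : NNReal × ℝ × UnitCircle => (x.2.2 : ℂ) := by fun_prop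
  have h2 : ∀ j, Continuous fun x : NNReal × ℝ × UnitCircle => eulerCoef f x.1 k x.2.1 j := fun j =>
    (continuous_eulerCoef k j).comp (f := fun x : NNReal × ℝ × UnitCircle => (x.1, x.2.1))
      (by fun_prop)
  have h3 : Continuous fun x : NNReal × ℝ × UnitCircle =>
      ∑' j, (x.2.2 : ℂ) ^ (j + 1) * eulerCoef f x.1 k x.2.1 j := by
    refine continuous_tsum (fun j => (h1.pow (j + 1)).mul (h2 j)) (h.summable_coefBound k)
      fun j x => ?_
    rw [norm_powerTail_term]
    exact norm_eulerCoef_le _ _ _ _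
  exact continuous_const.add h3

theorem continuous_eulerSeries_right (h : SummabilityCondition f) (τ : NNReal) (k : ℕ) (s : ℝ) :
    Continuous (eulerSeries f τ k s) :=
  (h.continuous_eulerSeries k).comp (f := fun z => (τ, s, z)) (by fun_prop)

theorem continuous_eulerNorm (h : SummabilityCondition f) [IsProbabilityMeasure P]
    (hγ : ∀ k, IsCentered P (γ k)) (k : ℕ) :
    Continuous fun x : NNReal × ℝ => eulerNorm P γ f x.1 k x.2 := by
  refine continuous_of_dominated (bound := fun _ => (1 + ∑' j, coefBound f k j) ^ 2)
    (fun x => ?_) (fun x => ae_of_all _ fun ω => ?_) (integrable_const _)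
    (ae_of_all _ fun ω => ?_)
  · exact (((h.continuous_eulerSeries_right x.1 k x.2).norm.pow 2).measurable.comp
      (hγ k).meas).aestronglyMeasurable
  · rw [Real.norm_of_nonneg (by positivity)]
    exact h.norm_eulerSeries_sq_le _ _ _ _
  · exact ((h.continuous_eulerSeries k).comp
      (f := fun x : NNReal × ℝ => (x.1, x.2, γ k ω)) (by fun_prop)).norm.pow 2

theorem one_le_eulerNorm (h : SummabilityCondition f) [IsProbabilityMeasure P]
    (hγ : ∀ k, IsCentered P (γ k)) (τ : NNReal) (k : ℕ) (s : ℝ) :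
    1 ≤ eulerNorm P γ f τ k s :=
  (hγ k).one_le_integral_norm_sq (h.summable_norm_eulerCoef τ k s)

theorem continuous_eulerField (h : SummabilityCondition f) [IsProbabilityMeasure P]
    (hγ : ∀ k, IsCentered P (γ k)) (k : ℕ) :
    Continuous fun x : NNReal × ℝ × UnitCircle => eulerField P γ f x.1 k x.2.1 x.2.2 := by
  have h1 : Continuous fun x : NNReal × ℝ × UnitCircle => eulerNorm P γ f x.1 k x.2.1 :=
    (h.continuous_eulerNorm hγ k).comp (f := fun x : NNReal × ℝ × UnitCircle => (x.1, x.2.1))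
      (by fun_prop)
  refine Continuous.div ((h.continuous_eulerSeries k).norm.pow 2) h1 fun x => ?_
  have := h.one_le_eulerNorm hγ x.1 k x.2.1
  exact (by linarith : (0 : ℝ) < eulerNorm P γ f x.1 k x.2.1).ne'

/-- The denominator is at least one, and the numerator is largest on the critical line, so the bound
is free of τ, as the passage τ → 0 requires. -/
theorem eulerField_le (h : SummabilityCondition f) [IsProbabilityMeasure P]
    (hγ : ∀ k, IsCentered P (γ k)) (τ : NNReal) (k : ℕ) (s : ℝ) (z : UnitCircle) :
    eulerField P γ f τ k s z ≤ (1 + ∑' j, coefBound f k j) ^ 2 :=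
  (div_le_self (by positivity) (h.one_le_eulerNorm hγ τ k s)).trans
    (h.norm_eulerSeries_sq_le τ k s z)

theorem isUnitField_eulerField (h : SummabilityCondition f) [IsProbabilityMeasure P]
    (hind : iIndepFun γ P) (hγ : ∀ k, IsCentered P (γ k)) (τ : NNReal) :
    IsUnitField P γ (eulerField P γ f τ) where
  indep := hind
  meas_var k := (hγ k).meas
  meas k := ((h.continuous_eulerField hγ k).comp (f := fun x : ℝ × UnitCircle => (τ, x.1, x.2))
    (by fun_prop)).measurable
  nonneg k s z := div_nonneg (by positivity) (zero_le_one.trans (h.one_le_eulerNorm hγ τ k s))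
  bdd k := ⟨_, fun s z => h.eulerField_le hγ τ k s z⟩
  mean k s := by
    have := h.one_le_eulerNorm hγ τ k s
    unfold eulerField
    rw [integral_div]
    exact div_self (by change eulerNorm P γ f τ k s ≠ 0; linarith)

end SummabilityCondition

theorem ClassP.hasLogDensity (h : ClassP (θ : ℂ) fun n => ((‖f n‖ ^ 2 : ℝ) : ℂ)) :
    HasLogDensity θ fun j => if j.Prime then ‖f j‖ ^ 2 else 0 := by
  have e : ∀ t, primeSumError (θ : ℂ) (fun n => ((‖f n‖ ^ 2 : ℝ) : ℂ)) t
      = ((sumError θ (fun j => if j.Prime then ‖f j‖ ^ 2 else 0) t : ℝ) : ℂ) := fun t => by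
    rw [primeSumError, sumError, ← Finset.sum_filter]
    push_cast
    rfl
  refine ⟨fun k => by positivity, ?_, ?_⟩
  · refine IsLittleO.of_norm_left (h.1.norm_left.congr_left fun t => ?_)
    rw [e, Complex.norm_real]
  · refine h.2.congr_fun (fun t _ => ?_) measurableSet_Ioi
    simp only [e, Complex.norm_real, Real.norm_eq_abs]

theorem tendsto_logMajorant : Tendsto logMajorant atTop (𝓝 0) := by
  have h1 : Tendsto (fun t => (Real.log t)⁻¹) atTop (𝓝 0) :=
    tendsto_inv_atTop_zero.comp Real.tendsto_log_atTop
  have := h1.add (h1.pow 2)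
  simp only [ne_eq, OfNat.ofNat_ne_zero, not_false_eq_true, zero_pow, add_zero] at this
  refine this.congr fun t => ?_
  simp [logMajorant]

/-- The correlation bounds for the factors of the random Euler product. -/
theorem hasCorrBound_eulerField [IsProbabilityMeasure P] (hind : iIndepFun γ P)
    (hγ : ∀ k, IsCentered P (γ k)) (h : SummabilityCondition f)
    (hd : HasLogDensity θ fun j => if j.Prime then ‖f j‖ ^ 2 else 0)
    (hθ : 0 ≤ θ) (hθ1 : θ < 1 / 2) : HasCorrBound P γ (eulerField P γ f) (2 * θ) := by
  set c : ℕ → ℝ := fun j => if j.Prime then ‖f j‖ ^ 2 else 0 with hc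
  have hcp : ∀ k, c (nthPrime k) = ‖f (nthPrime k)‖ ^ 2 := fun k => if_pos (prime_nthPrime k)
  have hc0 : ∀ j, ¬ j.Prime → c j = 0 := fun j hj => if_neg hj
  obtain ⟨K, hK0, hK⟩ := h.exists_coefBound_le
  obtain ⟨K', hK0', hK'⟩ := h.exists_restBound_le
  set D := 16 * (1 + K + K') ^ 4 with hD
  have hD0 : 0 ≤ D := by positivity
  set e : ℕ → ℝ := fun k => D * (coefBound f k 0 ^ 3 + restBound f k ^ 2) with he
  have hes : Summable e := (h.summable_first.add h.summable_restBound_sq).mul_left D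
  have he0 : ∀ k, 0 ≤ e k := fun k => mul_nonneg hD0
    (add_nonneg (pow_nonneg (coefBound_nonneg k 0) 3) (sq_nonneg _))
  set w : NNReal → ℕ → ℝ := fun τ k => (nthPrime k : ℝ) ^ (-(τ : ℝ)) with hw
  have hwa : ∀ τ, Antitone (w τ) := fun τ k l hkl =>
    Real.rpow_le_rpow_of_nonpos (nthPrime_pos k)
      (by exact_mod_cast strictMono_nthPrime.monotone hkl) (neg_nonpos.2 τ.coe_nonneg)
  have hw0 : ∀ τ k, 0 ≤ w τ k := fun τ k => Real.rpow_nonneg (nthPrime_pos k).le _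
  have hw1 : ∀ τ k, w τ k ≤ 1 := fun τ k =>
    Real.rpow_le_one_of_one_le_of_nonpos (one_lt_nthPrime k).le (neg_nonpos.2 τ.coe_nonneg)
  set x : NNReal → ℕ → ℝ → ℝ → ℝ := fun τ k s s' =>
    2 * (eulerCoef f τ k s 0 * (starRingEnd ℂ) (eulerCoef f τ k s' 0)).re with hx
  -- The main terms add up to twice a weighted prime sum. The factor 2 turns the bound θ log(1/|u|)
  -- into the exponent 2θ, and θ < 1/2 is what makes the singularity integrable.
  have hxs : ∀ τ n m s s', ∑ k ∈ Finset.Ico n m, x τ k s s' = 2 * ∑ k ∈ Finset.Ico n m,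
      Real.cos ((s - s') * Real.log (nthPrime k)) / nthPrime k * c (nthPrime k) * w τ k :=
    fun τ n m s s' => by
      rw [Finset.mul_sum]
      refine Finset.sum_congr rfl fun k _ => ?_
      simp only [hx, eulerCoef_mul_conj_re, hcp, hw]
  have hxb : ∀ τ k s s', |x τ k s s'| ≤ 2 * coefBound f k 0 ^ 2 := fun τ k s s' => by
    simp only [hx]
    rw [abs_mul, abs_two]
    refine mul_le_mul_of_nonneg_left ((Complex.abs_re_le_norm _).trans ?_) (by norm_num)
    rw [norm_mul, RCLike.norm_conj, sq]
    exact mul_le_mul (norm_eulerCoef_le _ _ _ _) (norm_eulerCoef_le _ _ _ _) (norm_nonneg _)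
      (coefBound_nonneg k 0)
  have hcorr : ∀ τ k s s', |factorCorr P γ (eulerField P γ f τ) k s s' - 1 - x τ k s s'| ≤ e k := by
    intro τ k s s'
    have hA0 := coefBound_nonneg (f := f) k 0
    have hr0 := restBound_nonneg (f := f) k
    refine ((hγ k).abs_corr_sub_le (h.summable_norm_eulerCoef τ k s)
      (h.summable_norm_eulerCoef τ k s') (norm_eulerCoef_le τ k s 0) (norm_eulerCoef_le τ k s' 0)
      (h.tsum_norm_eulerCoef_le τ k s) (h.tsum_norm_eulerCoef_le τ k s')).trans ?_
    refine mul_le_mul_of_nonneg_right (mul_le_mul_of_nonneg_left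
      (pow_le_pow_left₀ (by positivity) ?_ 4) (by norm_num)) (by positivity)
    linarith [hK k, hK' k]
  -- The choice of `y₂`: the square of correlation minus one is at most twice the squares of main
  -- term and error. The main term squared is at most 4A⁴ ≤ 4K A³, and the error squared at most the
  -- total of `e` times `e k`.
  refine hasCorrBound_of_factorCorr (h.isUnitField_eulerField hind hγ) (x := x) (e := e)
    (y₂ := fun k => 8 * K * coefBound f k 0 ^ 3 + 2 * (∑' i, e i) * e k) hes ?_ (by linarith) hcorr
    ?_ ?_ ?_
  · exact (h.summable_first.mul_left _).add (hes.mul_left _)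
  · intro τ k s s'
    have h1 := hcorr τ k s s'
    have h2 := hxb τ k s s'
    have h3 : e k ≤ ∑' i, e i := hes.le_tsum k fun i _ => he0 i
    have hA0 := coefBound_nonneg (f := f) k 0
    have h4 : x τ k s s' ^ 2 ≤ 4 * K * coefBound f k 0 ^ 3 := by
      rw [← sq_abs]
      calc _ ≤ (2 * coefBound f k 0 ^ 2) ^ 2 := pow_le_pow_left₀ (abs_nonneg _) h2 2
        _ = 4 * (coefBound f k 0 * coefBound f k 0 ^ 3) := by ring
        _ ≤ 4 * (K * coefBound f k 0 ^ 3) :=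
          mul_le_mul_of_nonneg_left (mul_le_mul_of_nonneg_right (hK k) (by positivity)) (by norm_num)
        _ = _ := by ring
    have h5 : (factorCorr P γ (eulerField P γ f τ) k s s' - 1 - x τ k s s') ^ 2
        ≤ (∑' i, e i) * e k := by
      rw [← sq_abs, sq]
      exact mul_le_mul (h1.trans h3) h1 (abs_nonneg _) ((he0 k).trans h3)
    nlinarith [sq_nonneg (factorCorr P γ (eulerField P γ f τ) k s s' - 1 - 2 * x τ k s s')]
  · intro M
    obtain ⟨C, hC⟩ := hd.exists_sum_nthPrime_le hθ hc0 (M + M)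
    refine ⟨2 * C, fun τ n m s s' hs hs' hne => ?_⟩
    have := hC (w τ) (hwa τ) (hw0 τ) (hw1 τ) n m (s - s') (sub_ne_zero.2 hne)
      ((abs_sub _ _).trans (add_le_add hs hs'))
    rw [hxs]
    linarith
  · intro s s' hne
    obtain ⟨η, hη, -, hηt⟩ := hd.exists_sum_nthPrime_tail hθ hc0
    have hp : Tendsto (fun n => (nthPrime n - 1 : ℝ)) atTop atTop :=
      tendsto_atTop_add_const_right _ _ (tendsto_natCast_atTop_atTop.comp tendsto_nthPrime)
    refine ⟨fun n => 2 * ((1 + |s - s'|) * η (nthPrime n - 1 : ℝ)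
      + θ * (2 * logMajorant (nthPrime n - 1 : ℝ) / |s - s'|)), ?_, ?_⟩
    · have h1 := ((hη.comp hp).const_mul (1 + |s - s'|)).add
        ((((tendsto_logMajorant.comp hp).const_mul 2).div_const |s - s'|).const_mul θ)
      have h2 := h1.const_mul 2
      simp only [mul_zero, zero_div, add_zero] at h2
      exact h2
    · filter_upwards [tendsto_nthPrime.eventually_ge_atTop 3] with n hn m τ hnm
      rw [hxs, abs_mul, abs_two]
      exact mul_le_mul_of_nonneg_left (hηt (w τ) (hwa τ) (hw0 τ) (hw1 τ) n m (s - s') hn hnm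
        (sub_ne_zero.2 hne)) (by norm_num)

end RandomEuler

end

/-! ### The uniform law on the circle and zeros of Euler factors -/

noncomputable section

namespace RandomEuler

theorem measurable_circleMap : Measurable fun u : ℝ => Complex.exp (2 * Real.pi * u * Complex.I) := by
  fun_prop

theorem integral_pow_uniformCircle (j : ℕ) : ∫ z, z ^ (j + 1) ∂uniformCircle = 0 := by
  rw [uniformCircle, integral_map measurable_circleMap.aemeasurable
    (by fun_prop : Measurable fun z : ℂ => z ^ (j + 1)).aestronglyMeasurable,
    ← intervalIntegral.integral_of_le zero_le_one]
  have hc : 2 * Real.pi * Complex.I * ((j + 1 : ℕ) : ℂ) ≠ 0 :=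
    mul_ne_zero Complex.two_pi_I_ne_zero (Nat.cast_ne_zero.2 (Nat.succ_ne_zero j))
  have e : ∀ u : ℝ, Complex.exp (2 * Real.pi * u * Complex.I) ^ (j + 1)
      = Complex.exp (2 * Real.pi * Complex.I * ((j + 1 : ℕ) : ℂ) * u) := fun u => by
    rw [← Complex.exp_nat_mul]
    congr 1
    ring
  simp_rw [e]
  rw [integral_exp_mul_complex hc]
  have : Complex.exp (2 * Real.pi * Complex.I * ((j + 1 : ℕ) : ℂ)) = 1 := by
    rw [mul_comm]
    exact Complex.exp_nat_mul_two_pi_mul_I (j + 1)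
  rw [Complex.ofReal_one, mul_one, this, Complex.ofReal_zero, mul_zero, Complex.exp_zero, sub_self,
    zero_div]

theorem uniformCircle_singleton (z : ℂ) : uniformCircle {z} = 0 := by
  rw [uniformCircle, Measure.map_apply measurable_circleMap (measurableSet_singleton z),
    Measure.restrict_apply (measurable_circleMap (measurableSet_singleton z))]
  refine Set.Subsingleton.measure_zero (fun u hu v hv => ?_) _
  obtain ⟨hu, hu'⟩ := hu
  obtain ⟨hv, hv'⟩ := hv
  simp only [Set.mem_preimage, Set.mem_singleton_iff] at hu hv
  obtain ⟨n, hn⟩ := Complex.exp_eq_exp_iff_exists_int.1 (hu.trans hv.symm)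
  have h1 : ((u : ℝ) : ℂ) = ((v + n : ℝ) : ℂ) := by
    have h2 : (2 * Real.pi * Complex.I) * (u : ℂ) = (2 * Real.pi * Complex.I) * ((v + n : ℝ) : ℂ) := by
      push_cast
      linear_combination hn
    exact mul_left_cancel₀ Complex.two_pi_I_ne_zero h2
  have h2 : u = v + n := by exact_mod_cast h1
  have h3 : (n : ℝ) < 1 := by linarith [hu'.2, hv'.1]
  have h4 : (-1 : ℝ) < n := by linarith [hu'.1, hv'.2]
  have h5 : n < 1 := by exact_mod_cast h3
  have h6 : -1 < n := by exact_mod_cast h4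
  obtain rfl : n = 0 := by omega
  simpa using h2

theorem ae_norm_eq_one_uniformCircle : ∀ᵐ z ∂uniformCircle, ‖z‖ = 1 := by
  rw [uniformCircle, ae_map_iff measurable_circleMap.aemeasurable
    (measurableSet_eq_fun measurable_norm measurable_const)]
  refine ae_of_all _ fun u => ?_
  have : 2 * Real.pi * u * Complex.I = ((2 * Real.pi * u : ℝ) : ℂ) * Complex.I := by push_cast; ring
  rw [this, Complex.norm_exp_ofReal_mul_I]

/-- A power series with constant term `1` and radius of convergence larger than `1` has finitely
many zeros on the unit circle. -/
theorem finite_zeros_powerTail {d : ℕ → ℂ} {C ρ : ℝ} (hρ0 : 0 < ρ) (hρ1 : ρ < 1)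
    (hd : ∀ j, ‖d j‖ ≤ C * ρ ^ j) : {z : ℂ | ‖z‖ = 1 ∧ 1 + powerTail d z = 0}.Finite := by
  by_contra hinf
  -- With 1 < R < 1/ρ the series is analytic on the disc of radius R, which contains the closed unit
  -- disc. Infinitely many zeros on the circle would accumulate inside it, and the identity theorem
  -- would contradict the value 1 at the origin.
  obtain ⟨R, hR1, hR⟩ : ∃ R : ℝ, 1 < R ∧ R * ρ < 1 := by
    obtain ⟨R, h1, h2⟩ := exists_between ((one_lt_inv₀ hρ0).2 hρ1)
    exact ⟨R, h1, by rwa [← lt_div_iff₀ hρ0, one_div]⟩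
  have hR0 : 0 < R := by linarith
  have hdiff : DifferentiableOn ℂ (fun z => 1 + powerTail d z) (Metric.ball 0 R) := by
    refine (differentiableOn_const 1).add ?_
    refine Complex.differentiableOn_tsum_of_summable_norm (u := fun j => R * C * (R * ρ) ^ j)
      ((summable_geometric_of_lt_one (by positivity) hR).mul_left _)
      (fun j => by fun_prop) Metric.isOpen_ball fun j z hz => ?_
    have hz' : ‖z‖ ≤ R := (mem_ball_zero_iff.1 hz).le
    rw [norm_mul, norm_pow]
    calc ‖z‖ ^ (j + 1) * ‖d j‖ ≤ R ^ (j + 1) * (C * ρ ^ j) :=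
          mul_le_mul (pow_le_pow_left₀ (norm_nonneg _) hz' _) (hd j) (norm_nonneg _) (by positivity)
      _ = _ := by rw [mul_pow, pow_succ]; ring
  have han := hdiff.analyticOnNhd Metric.isOpen_ball
  obtain ⟨x, hx, hacc⟩ := Set.Infinite.exists_accPt_of_subset_isCompact hinf
    (isCompact_closedBall (0 : ℂ) 1) fun z hz => by simpa using hz.1.le
  have hfreq : ∃ᶠ z in 𝓝[≠] x, 1 + powerTail d z = 0 :=
    (accPt_iff_frequently_nhdsNE.1 hacc).mono fun z hz => hz.2
  have hball : Metric.closedBall (0 : ℂ) 1 ⊆ Metric.ball 0 R := Metric.closedBall_subset_ball hR1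
  have h0 := han.eqOn_zero_of_preconnected_of_frequently_eq_zero
    (convex_ball (0 : ℂ) R).isPreconnected (hball hx) hfreq (Metric.mem_ball_self hR0)
  simp [powerTail] at h0

variable {Ω : Type*} [MeasurableSpace Ω] {P : Measure Ω} {γ : ℕ → Ω → UnitCircle} {f : ℕ → ℂ}

theorem isCentered_of_map {γ : Ω → UnitCircle} (hγ : Measurable γ)
    (hmap : P.map (fun ω => (γ ω : ℂ)) = uniformCircle) : IsCentered P γ where
  meas := hγ
  moment j := by
    have := integral_pow_uniformCircle j
    rwa [← hmap, integral_map (φ := fun ω => (γ ω : ℂ))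
      (measurable_subtype_coe.comp hγ).aemeasurable
      (by fun_prop : Measurable fun z : ℂ => z ^ (j + 1)).aestronglyMeasurable] at this

/-- The zeros on the circle are finite in number, and the uniform law has no atoms. -/
theorem SummabilityCondition.ae_eulerField_ne_zero (h : SummabilityCondition f)
    [IsProbabilityMeasure P] (hγ : ∀ k, Measurable (γ k))
    (hmap : ∀ k, P.map (fun ω => (γ k ω : ℂ)) = uniformCircle) (τ : NNReal) (k : ℕ) (s : ℝ) :
    ∀ᵐ ω ∂P, eulerField P γ f τ k s (γ k ω) ≠ 0 := by
  obtain ⟨C, hC⟩ := h.exists_geometric k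
  have hfin := finite_zeros_powerTail (d := eulerCoef f τ k s) (Real.sqrt_pos.2 coefRatio_pos)
    (by rw [Real.sqrt_lt' one_pos, one_pow]; exact coefRatio_lt_one) fun j =>
      (norm_eulerCoef_le τ k s j).trans (hC j)
  have hnull : P ((fun ω => (γ k ω : ℂ)) ⁻¹'
      {z : ℂ | ‖z‖ = 1 ∧ 1 + powerTail (eulerCoef f τ k s) z = 0}) = 0 := by
    rw [← Measure.map_apply (f := fun ω => (γ k ω : ℂ)) (measurable_subtype_coe.comp (hγ k))
      hfin.measurableSet, hmap]
    exact (measure_null_iff_singleton (Set.Finite.countable hfin)).2 fun z _ => uniformCircle_singleton z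
  filter_upwards [measure_eq_zero_iff_ae_notMem.1 hnull] with ω hω hzero
  have hN := h.one_le_eulerNorm (fun k => isCentered_of_map (hγ k) (hmap k)) τ k s
  have : ‖eulerSeries f τ k s (γ k ω)‖ ^ 2 = 0 := by
    rcases div_eq_zero_iff.1 hzero with h1 | h1
    · exact h1
    · linarith
  exact hω ⟨(γ k ω).norm_coe, norm_eq_zero.1 (pow_eq_zero_iff (two_ne_zero) |>.1 this)⟩

end RandomEuler

end

/-! ### The infinite Euler product off the critical line -/

noncomputable section

namespace RandomEuler

variable {Ω : Type*} [MeasurableSpace Ω]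

theorem IsUnitField.measurable_partialField_right {E : Type*} [MeasurableSpace E] {P : Measure Ω}
    {γ : ℕ → Ω → E} {ψ : ℕ → ℝ → E → ℝ} (h : IsUnitField P γ ψ) (n : ℕ) (s : ℝ) :
    Measurable (partialField γ ψ n s) :=
  (h.measurable_partialField n).comp (measurable_prodMk_left (x := s))

/-- The product of the Euler factors over all primes, as a limit along the integers. -/
def eulerLimit (γ : ℕ → Ω → UnitCircle) (f : ℕ → ℂ) (τ : NNReal) (s : ℝ) (ω : Ω) : ℂ :=
  limUnder atTop (fun N : ℕ =>
    ∏ k ∈ Finset.range (Nat.count Nat.Prime (N + 1)), eulerSeries f τ k s (γ k ω))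

/-- The normalised square of `eulerLimit`. -/
def eulerLimitField (P : Measure Ω) (γ : ℕ → Ω → UnitCircle) (f : ℕ → ℂ) (τ : NNReal) (s : ℝ)
    (ω : Ω) : ℝ :=
  ‖eulerLimit γ f τ s ω‖ ^ 2 / ∫ ω', ‖eulerLimit γ f τ s ω'‖ ^ 2 ∂P

theorem prod_one_add_le_exp {q : ℕ → ℝ} (hq : Summable q) (hq0 : ∀ k, 0 ≤ q k) {a : ℕ → ℝ}
    (ha0 : ∀ k, 0 ≤ a k) (ha : ∀ k, a k ≤ 1 + q k) (n m : ℕ) :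
    ∏ k ∈ Finset.Ico n m, a k ≤ Real.exp (∑' k, q (k + n)) := by
  calc ∏ k ∈ Finset.Ico n m, a k ≤ ∏ k ∈ Finset.Ico n m, Real.exp (q k) :=
        Finset.prod_le_prod (fun k _ => ha0 k) fun k _ =>
          (ha k).trans (by linarith [Real.add_one_le_exp (q k)])
    _ = Real.exp (∑ k ∈ Finset.Ico n m, q k) := (Real.exp_sum _ _).symm
    _ ≤ _ := Real.exp_le_exp.2 (sum_Ico_le_tsum_add hq hq0 n m)

theorem tendsto_count_prime : Tendsto (fun N => Nat.count Nat.Prime (N + 1)) atTop atTop := by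
  refine tendsto_atTop_mono' (f₁ := fun N => Nat.count Nat.Prime N) _
    (Eventually.of_forall fun N => Nat.count_monotone _ (Nat.le_succ N)) ?_
  refine tendsto_atTop_atTop.2 fun b => ⟨nthPrime b, fun N hN => ?_⟩
  rw [← Nat.count_nth_of_infinite Nat.infinite_setOfPred_prime b]
  exact Nat.count_monotone _ hN

variable {P : Measure Ω} {γ : ℕ → Ω → UnitCircle} {f : ℕ → ℂ} {θ : ℝ}

namespace SummabilityCondition

variable [IsProbabilityMeasure P]

theorem integral_eulerSeries (h : SummabilityCondition f) (hγ : ∀ k, IsCentered P (γ k))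
    (τ : NNReal) (k : ℕ) (s : ℝ) : ∫ ω, eulerSeries f τ k s (γ k ω) ∂P = 1 := by
  have hs := h.summable_norm_eulerCoef τ k s
  have h1 := (hγ k).integral_pow_mul_powerTail hs 0
  simp only [pow_zero, one_mul] at h1
  have h2 := (hγ k).integrable_comp (continuous_powerTail hs)
  unfold eulerSeries
  rw [integral_add (integrable_const _) h2, h1]
  simp

/-- For τ > 0 the series of |f(p)|² / p^(1+τ) converges. So the mean squares, and even the diagonal
correlations, where the cosine brings no cancellation, have convergent products, uniformly in s. -/
theorem exists_summable_bound (h : SummabilityCondition f) (hγ : ∀ k, IsCentered P (γ k))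
    (hd : HasLogDensity θ fun j => if j.Prime then ‖f j‖ ^ 2 else 0) {τ : NNReal} (hτ : 0 < τ) :
    ∃ q : ℕ → ℝ, Summable q ∧ (∀ k, 0 ≤ q k) ∧ (∀ k s, eulerNorm P γ f τ k s ≤ 1 + q k) ∧
      ∀ k s, factorCorr P γ (eulerField P γ f τ) k s s ≤ 1 + q k := by
  obtain ⟨K, hK0, hK⟩ := h.exists_coefBound_le
  obtain ⟨K', hK0', hK'⟩ := h.exists_restBound_le
  set A : ℕ → ℝ := fun k => ‖f (nthPrime k)‖ ^ 2 / (nthPrime k : ℝ) ^ (1 + (τ : ℝ)) with hA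
  have hAs : Summable A := by
    have h1 := hd.summable_div_rpow (r := 1 + (τ : ℝ)) (by simpa using hτ)
    refine (h1.comp_injective strictMono_nthPrime.injective).congr fun k => ?_
    simp [hA, prime_nthPrime]
  have hA0 : ∀ k, 0 ≤ A k := fun k => by positivity
  have hAc : ∀ k s, ‖eulerCoef f τ k s 0‖ ^ 2 = A k := fun k s => by
    rw [norm_eulerCoef, div_pow, ← Real.rpow_mul_natCast (nthPrime_pos k).le]
    simp only [hA]
    norm_num
    congr 2
    ring
  set D := 16 * (1 + K + K') ^ 4 with hD
  have hD0 : 0 ≤ D := by positivity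
  set e : ℕ → ℝ := fun k => D * (coefBound f k 0 ^ 3 + restBound f k ^ 2) with he
  have hes : Summable e := (h.summable_first.add h.summable_restBound_sq).mul_left D
  have he0 : ∀ k, 0 ≤ e k := fun k => mul_nonneg hD0
    (add_nonneg (pow_nonneg (coefBound_nonneg k 0) 3) (sq_nonneg _))
  refine ⟨fun k => 2 * A k + restBound f k ^ 2 + e k,
    ((hAs.mul_left 2).add h.summable_restBound_sq).add hes, fun k => ?_, fun k s => ?_, fun k s => ?_⟩
  · have := hA0 k
    have := he0 k
    positivity
  · have := (hγ k).integral_norm_sq_le (h.summable_norm_eulerCoef τ k s) le_rfl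
      (h.tsum_norm_eulerCoef_le τ k s)
    rw [hAc] at this
    change eulerNorm P γ f τ k s ≤ _ at this
    linarith [hA0 k, he0 k]
  · have hB0 := coefBound_nonneg (f := f) k 0
    have hr0 := restBound_nonneg (f := f) k
    have h1 := (hγ k).abs_corr_sub_le (h.summable_norm_eulerCoef τ k s)
      (h.summable_norm_eulerCoef τ k s) (norm_eulerCoef_le τ k s 0) (norm_eulerCoef_le τ k s 0)
      (h.tsum_norm_eulerCoef_le τ k s) (h.tsum_norm_eulerCoef_le τ k s)
    have h2 : 16 * (1 + coefBound f k 0 + restBound f k) ^ 4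
        * (coefBound f k 0 ^ 3 + restBound f k ^ 2) ≤ e k := by
      refine mul_le_mul_of_nonneg_right (mul_le_mul_of_nonneg_left
        (pow_le_pow_left₀ (by positivity) ?_ 4) (by norm_num)) (by positivity)
      linarith [hK k, hK' k]
    have h3 := (abs_le.1 (h1.trans h2)).2
    rw [Complex.mul_conj', ← Complex.ofReal_pow, Complex.ofReal_re, hAc] at h3
    change factorCorr P γ (eulerField P γ f τ) k s s - 1 - 2 * A k ≤ e k at h3
    have := sq_nonneg (restBound f k)
    linarith

theorem ae_exists_tendsto (h : SummabilityCondition f) (hind : iIndepFun γ P)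
    (hγ : ∀ k, IsCentered P (γ k))
    (hd : HasLogDensity θ fun j => if j.Prime then ‖f j‖ ^ 2 else 0) {τ : NNReal} (hτ : 0 < τ)
    (s : ℝ) : ∀ᵐ ω ∂P, Tendsto (fun n => ∏ k ∈ Finset.range n, eulerSeries f τ k s (γ k ω)) atTop
      (𝓝 (eulerLimit γ f τ s ω)) := by
  obtain ⟨q, hq, hq0, hqN, -⟩ := h.exists_summable_bound hγ hd hτ
  have h1 := ae_exists_tendsto_prod hind (fun k => (hγ k).meas)
    (D := fun k z => eulerSeries f τ k s z)
    (fun k => (h.continuous_eulerSeries_right τ k s).measurable)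
    (fun k => ⟨_, h.norm_eulerSeries_le τ k s⟩) (fun k => h.integral_eulerSeries hγ τ k s)
    (R := Real.exp (∑' k, q (k + 0))) fun n => by
      rw [Finset.range_eq_Ico]
      exact prod_one_add_le_exp hq hq0
        (fun k => zero_le_one.trans (h.one_le_eulerNorm hγ τ k s)) (fun k => hqN k s) 0 n
  filter_upwards [h1] with ω ⟨c, hc⟩
  -- `eulerLimit` follows the prime counts, which tend to infinity, so it picks up the limit over
  -- all numbers of factors.
  have : eulerLimit γ f τ s ω = c := (hc.comp tendsto_count_prime).limUnder_eq
  rwa [this]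

omit [IsProbabilityMeasure P] in
theorem measurable_eulerSeries_comp (h : SummabilityCondition f) (hγ : ∀ k, IsCentered P (γ k))
    (τ : NNReal) (k : ℕ) : Measurable fun x : ℝ × Ω => eulerSeries f τ k x.1 (γ k x.2) := by
  have hc : Continuous fun y : ℝ × UnitCircle => eulerSeries f τ k y.1 y.2 :=
    (h.continuous_eulerSeries k).comp (f := fun y : ℝ × UnitCircle => (τ, y.1, y.2)) (by fun_prop)
  have hg : Measurable fun x : ℝ × Ω => (x.1, γ k x.2) :=
    measurable_fst.prodMk ((hγ k).meas.comp measurable_snd)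
  have hm := hc.measurable
  generalize eulerSeries f τ k = F at hm ⊢
  exact hm.comp hg

omit [IsProbabilityMeasure P] in
theorem measurable_eulerLimit (h : SummabilityCondition f) (hγ : ∀ k, IsCentered P (γ k))
    (τ : NNReal) : Measurable (Function.uncurry (eulerLimit γ f τ)) := by
  have : StronglyMeasurable fun x : ℝ × Ω => limUnder atTop (fun N : ℕ =>
      ∏ k ∈ Finset.range (Nat.count Nat.Prime (N + 1)), eulerSeries f τ k x.1 (γ k x.2)) := by
    refine StronglyMeasurable.limUnder fun N => ?_
    refine (Finset.measurable_fun_prod _ fun k _ => ?_).stronglyMeasurable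
    exact h.measurable_eulerSeries_comp hγ τ k
  exact this.measurable

/-- The increment from n to m factors has second moment equal to the diagonal correlation over [0,
n) times the one over [n, m) minus one, which is small uniformly in s; Fatou's lemma carries this to
m = ∞. It remains to see that the mean square of the infinite product is the limit of the finite
mean squares. -/
theorem isLimitField (h : SummabilityCondition f) (hind : iIndepFun γ P)
    (hγ : ∀ k, IsCentered P (γ k))
    (hd : HasLogDensity θ fun j => if j.Prime then ‖f j‖ ^ 2 else 0) {τ : NNReal} (hτ : 0 < τ) :
    IsUnitField.IsLimitField P γ (eulerField P γ f τ) (eulerLimitField P γ f τ) := by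
  obtain ⟨q, hq, hq0, hqN, hqκ⟩ := h.exists_summable_bound hγ hd hτ
  have hfield := h.isUnitField_eulerField hind hγ τ
  set ψ := eulerField P γ f τ with hψ
  have hmeas := h.measurable_eulerLimit hγ τ
  set d : ℕ → ℝ := fun n => Real.exp (∑' k, q (k + 0)) * (Real.exp (∑' k, q (k + n)) - 1) with hdn
  have hd0 : Tendsto d atTop (𝓝 0) := by
    have := ((((Real.continuous_exp.tendsto _).comp (tendsto_sum_nat_add q)).sub_const 1).const_mul
      (Real.exp (∑' k, q (k + 0))))
    simp only [Real.exp_zero, sub_self, mul_zero] at this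
    exact this
  have hmemLp : ∀ n s, MemLp (partialField γ ψ n s) 2 P := fun n s => by
    obtain ⟨B, hB0, hB⟩ := hfield.exists_partialField_le n
    refine MemLp.of_bound (hfield.measurable_partialField_right n s).aestronglyMeasurable B (ae_of_all _ fun ω => ?_)
    rw [Real.norm_of_nonneg (hfield.partialField_nonneg _ _ _)]
    exact hB _ _
  have hsq : ∀ n m s, n ≤ m →
      ∫⁻ ω, ‖partialField γ ψ m s ω - partialField γ ψ n s ω‖ₑ ^ 2 ∂P ≤ ENNReal.ofReal (d n) := by
    intro n m s hnm
    have hi : ∀ a b, Integrable (fun ω => partialField γ ψ a s ω * partialField γ ψ b s ω) P :=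
      fun a b => (hmemLp a s).integrable_mul (hmemLp b s)
    have e1 : ∫ ω, (partialField γ ψ m s ω - partialField γ ψ n s ω) ^ 2 ∂P
        = blockCorr P γ ψ 0 n s s * (blockCorr P γ ψ n m s s - 1) := by
      have e : ∀ ω, (partialField γ ψ m s ω - partialField γ ψ n s ω) ^ 2
          = partialField γ ψ m s ω * partialField γ ψ m s ω
            - 2 * (partialField γ ψ m s ω * partialField γ ψ n s ω)
            + partialField γ ψ n s ω * partialField γ ψ n s ω := fun ω => by ring
      have i2 : Integrable (fun ω => partialField γ ψ m s ω * partialField γ ψ m s ω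
            - 2 * (partialField γ ψ m s ω * partialField γ ψ n s ω)) P :=
        (hi m m).sub ((hi m n).const_mul 2)
      simp_rw [e]
      rw [integral_add i2 (hi n n), integral_sub (hi m m) ((hi m n).const_mul 2),
        integral_const_mul, hfield.integral_partialField_mul le_rfl,
        hfield.integral_partialField_mul le_rfl, hfield.integral_partialField_mul hnm,
        ← IsUnitField.blockCorr_mul n m hnm]
      ring
    have e2 : ∀ ω, ‖partialField γ ψ m s ω - partialField γ ψ n s ω‖ₑ ^ 2
        = ENNReal.ofReal ((partialField γ ψ m s ω - partialField γ ψ n s ω) ^ 2) := fun ω => by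
      rw [Real.enorm_eq_ofReal_abs, ← ENNReal.ofReal_pow (abs_nonneg _), sq_abs]
    simp_rw [e2]
    have hi3 : Integrable (fun ω => (partialField γ ψ m s ω - partialField γ ψ n s ω) ^ 2) P :=
      ((hmemLp m s).sub (hmemLp n s)).integrable_sq
    rw [← ofReal_integral_eq_lintegral_ofReal hi3 (ae_of_all _ fun ω => sq_nonneg _), e1]
    have b1 := prod_one_add_le_exp hq hq0 (fun k => hfield.factorCorr_nonneg k s s)
      (fun k => hqκ k s) 0 n
    have b2 := prod_one_add_le_exp hq hq0 (fun k => hfield.factorCorr_nonneg k s s)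
      (fun k => hqκ k s) n m
    refine ENNReal.ofReal_le_ofReal ?_
    have b3 : 1 ≤ Real.exp (∑' k, q (k + n)) := Real.one_le_exp (tsum_nonneg fun k => hq0 _)
    have b4 : blockCorr P γ ψ n m s s - 1 ≤ Real.exp (∑' k, q (k + n)) - 1 :=
      sub_le_sub_right b2 1
    exact (mul_le_mul_of_nonneg_left b4 (hfield.blockCorr_nonneg _ _ _ _)).trans
      (mul_le_mul_of_nonneg_right b1 (by linarith))
  -- the normalising constants converge
  have hNlim : ∀ s, ∃ L, 1 ≤ L ∧ Tendsto (fun n => ∏ k ∈ Finset.range n, eulerNorm P γ f τ k s)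
      atTop (𝓝 L) := by
    intro s
    have h1 : ∀ k, 1 ≤ eulerNorm P γ f τ k s := fun k => h.one_le_eulerNorm hγ τ k s
    have hmono : Monotone fun n => ∏ k ∈ Finset.range n, eulerNorm P γ f τ k s :=
      monotone_nat_of_le_succ fun n => by
        rw [Finset.prod_range_succ]
        exact le_mul_of_one_le_right (Finset.prod_nonneg fun k _ => zero_le_one.trans (h1 k)) (h1 n)
    have hbdd : BddAbove (Set.range fun n => ∏ k ∈ Finset.range n, eulerNorm P γ f τ k s) := by
      refine ⟨Real.exp (∑' k, q (k + 0)), ?_⟩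
      rintro _ ⟨n, rfl⟩
      simp only [Finset.range_eq_Ico]
      exact prod_one_add_le_exp hq hq0 (fun k => zero_le_one.trans (h1 k)) (fun k => hqN k s) 0 n
    refine ⟨_, ?_, tendsto_atTop_ciSup hmono hbdd⟩
    exact le_ciSup_of_le hbdd 0 (by simp)
  choose L hL1 hL using hNlim
  have hPconv : ∀ s, ∀ᵐ ω ∂P, Tendsto (fun n => partialField γ ψ n s ω) atTop
      (𝓝 (‖eulerLimit γ f τ s ω‖ ^ 2 / L s)) := fun s => by
    filter_upwards [h.ae_exists_tendsto hind hγ hd hτ s] with ω hω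
    refine ((hω.norm.pow 2).div (hL s) (by linarith [hL1 s])).congr fun n => ?_
    simp only [partialField, hψ, eulerField, Pi.div_apply]
    rw [Finset.prod_div_distrib, norm_prod, Finset.prod_pow]
  have hYm : ∀ s, Measurable fun ω => ‖eulerLimit γ f τ s ω‖ ^ 2 / L s := fun s =>
    ((hmeas.comp measurable_prodMk_left).norm.pow_const 2).div_const _
  have happ : ∀ n s, ∫⁻ ω, ‖‖eulerLimit γ f τ s ω‖ ^ 2 / L s - partialField γ ψ n s ω‖ₑ ^ 2 ∂P
      ≤ ENNReal.ofReal (d n) := by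
    intro n s
    have hpm : ∀ m, Measurable (partialField γ ψ m s) := fun m =>
      hfield.measurable_partialField_right m s
    calc _ = ∫⁻ ω, liminf (fun m => ‖partialField γ ψ m s ω - partialField γ ψ n s ω‖ₑ ^ 2) atTop
          ∂P := by
          refine lintegral_congr_ae ?_
          filter_upwards [hPconv s] with ω hω
          have h1 := (hω.sub_const (partialField γ ψ n s ω)).enorm
          exact (ENNReal.Tendsto.pow (n := 2) h1).liminf_eq.symm
      _ ≤ liminf (fun m => ∫⁻ ω, ‖partialField γ ψ m s ω - partialField γ ψ n s ω‖ₑ ^ 2 ∂P) atTop :=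
          lintegral_liminf_le fun m => ((hpm m).sub (hpm n)).enorm.pow_const 2
      _ ≤ _ := by
          refine liminf_le_of_frequently_le' (Eventually.frequently ?_)
          filter_upwards [eventually_ge_atTop n] with m hm using hsq n m s hm
  -- The L² bound implies convergence of means, and every partial field has mean one. Hence `L s` is
  -- the mean square of the infinite product.
  have hmean : ∀ s, ∫ ω, ‖eulerLimit γ f τ s ω‖ ^ 2 / L s ∂P = 1 := by
    intro s
    have h1 : Tendsto (fun n => eLpNorm (partialField γ ψ n s
        - fun ω => ‖eulerLimit γ f τ s ω‖ ^ 2 / L s) 1 P) atTop (𝓝 0) := by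
      have h2 : Tendsto (fun n => (ENNReal.ofReal (d n)) ^ (1 / 2 : ℝ)) atTop (𝓝 0) := by
        have := (ENNReal.continuous_rpow_const (y := (1 / 2 : ℝ))).tendsto (ENNReal.ofReal 0) |>.comp
          ((ENNReal.continuous_ofReal.tendsto 0).comp hd0)
        simpa [Function.comp_def] using this
      refine tendsto_of_tendsto_of_tendsto_of_le_of_le tendsto_const_nhds h2 (fun _ => zero_le)
        fun n => ?_
      have hm : AEStronglyMeasurable (partialField γ ψ n s
        - fun ω => ‖eulerLimit γ f τ s ω‖ ^ 2 / L s) P :=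
        (hmemLp n s).1.sub (hYm s).aestronglyMeasurable
      refine (eLpNorm_le_eLpNorm_of_exponent_le (q := 2) (by norm_num) hm).trans ?_
      rw [eLpNorm_sub_comm, ← ENNReal.rpow_le_rpow_iff (z := 2) (by norm_num), ← ENNReal.rpow_mul]
      norm_num
      rw [eLpNorm_two_sq]
      exact happ n s
    have h3 := tendsto_integral_of_L1' (μ := P) (fun ω => ‖eulerLimit γ f τ s ω‖ ^ 2 / L s)
      (hYm s).aestronglyMeasurable (Eventually.of_forall fun n => (hmemLp n s).integrable (by norm_num)) h1
    refine tendsto_nhds_unique h3 ?_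
    simp only [hfield.integral_partialField]
    exact tendsto_const_nhds
  have hX : ∀ s, ∫ ω, ‖eulerLimit γ f τ s ω‖ ^ 2 ∂P = L s := fun s => by
    have := hmean s
    rw [integral_div, div_eq_one_iff_eq (by linarith [hL1 s])] at this
    exact this
  refine ⟨?_, fun n => ENNReal.ofReal (d n), ?_, fun n s => ?_⟩
  · have h1 : Measurable fun x : ℝ × Ω => ‖eulerLimit γ f τ x.1 x.2‖ ^ 2 := hmeas.norm.pow_const 2
    have h2 : Measurable fun s : ℝ => ∫ ω, ‖eulerLimit γ f τ s ω‖ ^ 2 ∂P :=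
      (h1.stronglyMeasurable.integral_prod_right (ν := P)).measurable
    exact h1.div (h2.comp measurable_fst)
  · simpa [Function.comp_def] using (ENNReal.continuous_ofReal.tendsto 0).comp hd0
  · simp only [eulerLimitField, hX]
    exact happ n s

end SummabilityCondition

end RandomEuler

end

/-! ### Translation to Steinhaus random functions and proof of the theorem -/

noncomputable section

namespace RandomEuler

/-- The identity on the unit circle, and the constant `1` elsewhere. -/
def toUnitCircle (z : ℂ) : UnitCircle :=
  ⟨if ‖z‖ = 1 then z else 1, by split_ifs with h <;> simp [h]⟩

theorem measurable_toUnitCircle : Measurable toUnitCircle :=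
  (Measurable.ite (measurableSet_eq_fun measurable_norm measurable_const) measurable_id
    measurable_const).subtype_mk

theorem coe_toUnitCircle {z : ℂ} (hz : ‖z‖ = 1) : (toUnitCircle z : ℂ) = z := if_pos hz

variable {Ω : Type*} [MeasurableSpace Ω]

/-- The value at the `k`-th prime, as a point of the circle. -/
def circleValue (α : ℕ → Ω → ℂ) (k : ℕ) (ω : Ω) : UnitCircle := toUnitCircle (α (nthPrime k) ω)

variable {P : Measure Ω} {α : ℕ → Ω → ℂ} {f : ℕ → ℂ}

namespace IsSteinhaus

theorem measurable_circleValue (hα : IsSteinhaus P α) (k : ℕ) : Measurable (circleValue α k) :=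
  measurable_toUnitCircle.comp (hα.measurable _ (prime_nthPrime k))

theorem ae_coe_circleValue (hα : IsSteinhaus P α) :
    ∀ᵐ ω ∂P, ∀ k, (circleValue α k ω : ℂ) = α (nthPrime k) ω := by
  refine ae_all_iff.2 fun k => ?_
  have h1 := ae_norm_eq_one_uniformCircle
  rw [← hα.law _ (prime_nthPrime k)] at h1
  exact (ae_of_ae_map (hα.measurable _ (prime_nthPrime k)).aemeasurable h1).mono fun ω hω =>
    coe_toUnitCircle hω

theorem map_circleValue (hα : IsSteinhaus P α) (k : ℕ) :
    P.map (fun ω => (circleValue α k ω : ℂ)) = uniformCircle := by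
  rw [← hα.law _ (prime_nthPrime k)]
  exact Measure.map_congr (hα.ae_coe_circleValue.mono fun ω hω => hω k)

theorem isCentered_circleValue (hα : IsSteinhaus P α) (k : ℕ) : IsCentered P (circleValue α k) :=
  isCentered_of_map (hα.measurable_circleValue k) (hα.map_circleValue k)

theorem iIndepFun_circleValue (hα : IsSteinhaus P α) : iIndepFun (circleValue α) P := by
  have h1 := hα.indep.precomp (g := fun k => (⟨nthPrime k, prime_nthPrime k⟩ : Nat.Primes))
    fun a b hab => strictMono_nthPrime.injective (congrArg Subtype.val hab)
  exact h1.comp (fun _ => toUnitCircle) fun _ => measurable_toUnitCircle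

end IsSteinhaus

theorem prod_Iic_prime (F : ℕ → ℂ) (N : ℕ) : ∏ p ∈ Finset.Iic N with p.Prime, F p
    = ∏ k ∈ Finset.range (Nat.count Nat.Prime (N + 1)), F (nthPrime k) := by
  have hinj : Set.InjOn nthPrime (Finset.range (Nat.count Nat.Prime (N + 1))) :=
    strictMono_nthPrime.injective.injOn
  rw [← Finset.prod_image (f := F) hinj]
  refine Finset.prod_congr (Finset.ext fun p => ?_) fun _ _ => rfl
  simp only [Finset.mem_filter, Finset.mem_Iic, Finset.mem_image, Finset.mem_range]
  constructor
  · rintro ⟨hp, hpp⟩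
    obtain ⟨k, rfl⟩ := exists_nthPrime hpp
    exact ⟨k, nthPrime_lt_iff.1 (Nat.lt_succ_of_le hp), rfl⟩
  · rintro ⟨k, hk, rfl⟩
    exact ⟨Nat.lt_succ_iff.1 (nthPrime_lt_iff.2 hk), prime_nthPrime k⟩

omit [MeasurableSpace Ω] in
theorem eulerFactor_eq {ω : Ω} (hω : ∀ k, (circleValue α k ω : ℂ) = α (nthPrime k) ω) {σ : ℝ}
    {τ : NNReal} (hσ : σ = 1 / 2 * (1 + (τ : ℝ))) (k : ℕ) (s : ℝ) :
    eulerFactor f α (nthPrime k) ((σ : ℂ) + s * Complex.I) ω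
      = eulerSeries f τ k s (circleValue α k ω) := by
  subst hσ
  simp only [eulerFactor, eulerSeries, powerTail, eulerCoef, hω, mul_div_assoc]

omit [MeasurableSpace Ω] in
theorem eulerProduct_coe_eq {ω : Ω} (hω : ∀ k, (circleValue α k ω : ℂ) = α (nthPrime k) ω) {σ : ℝ}
    {τ : NNReal} (hσ : σ = 1 / 2 * (1 + (τ : ℝ))) (y s : ℝ) :
    eulerProduct f α (y : WithTop ℝ) ((σ : ℂ) + s * Complex.I) ω
      = ∏ k ∈ Finset.range (Nat.count Nat.Prime (⌊y⌋₊ + 1)),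
        eulerSeries f τ k s (circleValue α k ω) := by
  change ∏ p ∈ Finset.Iic ⌊y⌋₊ with p.Prime, eulerFactor f α p ((σ : ℂ) + s * Complex.I) ω = _
  rw [prod_Iic_prime (fun p => eulerFactor f α p ((σ : ℂ) + s * Complex.I) ω)]
  exact Finset.prod_congr rfl fun k _ => eulerFactor_eq hω hσ k s

omit [MeasurableSpace Ω] in
theorem eulerProduct_top_eq {ω : Ω} (hω : ∀ k, (circleValue α k ω : ℂ) = α (nthPrime k) ω) {σ : ℝ}
    {τ : NNReal} (hσ : σ = 1 / 2 * (1 + (τ : ℝ))) (s : ℝ) :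
    eulerProduct f α ⊤ ((σ : ℂ) + s * Complex.I) ω = eulerLimit (circleValue α) f τ s ω := by
  change limUnder atTop (fun N : ℕ => ∏ p ∈ Finset.Iic N with p.Prime,
    eulerFactor f α p ((σ : ℂ) + s * Complex.I) ω) = _
  rw [eulerLimit]
  congr 1
  ext N
  rw [prod_Iic_prime (fun p => eulerFactor f α p ((σ : ℂ) + s * Complex.I) ω)]
  exact Finset.prod_congr rfl fun k _ => eulerFactor_eq hω hσ k s

theorem sigma_top_eq : sigma ⊤ = 1 / 2 * (1 + ((0 : NNReal) : ℝ)) := by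
  change (1 / 2 : ℝ) = _
  simp

theorem sigma_coe_eq {t : ℝ} (ht : 1 < t) :
    sigma (t : WithTop ℝ) = 1 / 2 * (1 + ((1 / Real.log t).toNNReal : ℝ)) := by
  rw [Real.coe_toNNReal _ (one_div_nonneg.2 (Real.log_pos ht).le)]
  rfl

/-- By independence the expectation of the squared finite product splits, so the normalised density
is the product of the normalised factors at τ = 0. -/
theorem ae_eulerMeasure_top [IsProbabilityMeasure P] (hα : IsSteinhaus P α)
    (h : SummabilityCondition f) (y : ℝ) :
    ∀ᵐ ω ∂P, eulerMeasure P f α (y : WithTop ℝ) ⊤ ω = volume.withDensity fun s => ENNReal.ofReal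
      (partialField (circleValue α) (eulerField P (circleValue α) f 0)
        (Nat.count Nat.Prime (⌊y⌋₊ + 1)) s ω) := by
  filter_upwards [hα.ae_coe_circleValue] with ω hω
  rw [eulerMeasure]
  congr 1 with s
  have e1 : ∫ ω', ‖eulerProduct f α (y : WithTop ℝ) ((sigma ⊤ : ℂ) + s * Complex.I) ω'‖ ^ 2 ∂P
      = ∏ k ∈ Finset.range (Nat.count Nat.Prime (⌊y⌋₊ + 1)),
        eulerNorm P (circleValue α) f 0 k s := by
    unfold eulerNorm
    rw [← integral_prod_range_comp hα.iIndepFun_circleValue hα.measurable_circleValue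
      (φ := fun k z => ‖eulerSeries f 0 k s z‖ ^ 2)
      (fun k => (h.continuous_eulerSeries_right 0 k s).measurable.norm.pow_const 2)]
    refine integral_congr_ae (hα.ae_coe_circleValue.mono fun ω' hω' => ?_)
    simp only [eulerProduct_coe_eq hω' sigma_top_eq, norm_prod, Finset.prod_pow]
  rw [e1, eulerProduct_coe_eq hω sigma_top_eq]
  simp only [partialField, eulerField, Finset.prod_div_distrib, norm_prod, Finset.prod_pow]

theorem ae_eulerMeasure_coe (hα : IsSteinhaus P α) {t : ℝ} (ht : 1 < t) :
    ∀ᵐ ω ∂P, eulerMeasure P f α ⊤ (t : WithTop ℝ) ω = volume.withDensity fun s => ENNReal.ofReal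
      (eulerLimitField P (circleValue α) f (1 / Real.log t).toNNReal s ω) := by
  filter_upwards [hα.ae_coe_circleValue] with ω hω
  rw [eulerMeasure]
  congr 1 with s
  have e1 : ∫ ω', ‖eulerProduct f α ⊤ ((sigma (t : WithTop ℝ) : ℂ) + s * Complex.I) ω'‖ ^ 2 ∂P
      = ∫ ω', ‖eulerLimit (circleValue α) f (1 / Real.log t).toNNReal s ω'‖ ^ 2 ∂P :=
    integral_congr_ae (hα.ae_coe_circleValue.mono fun ω' hω' => by
      simp only [eulerProduct_top_eq hω' (sigma_coe_eq ht)])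
  rw [e1, eulerProduct_top_eq hω (sigma_coe_eq ht)]
  rfl

theorem setIntegral_withDensity_ofReal {X : ℝ → ℝ} (hX : Measurable X) (hX0 : ∀ s, 0 ≤ X s)
    {I : Set ℝ} (hI : MeasurableSet I) (h : ℝ → ℝ) :
    ∫ s in I, h s ∂(volume.withDensity fun s => ENNReal.ofReal (X s))
      = ∫ s, I.indicator h s * X s := by
  rw [← integral_indicator hI, integral_withDensity_eq_integral_toReal_smul hX.ennreal_ofReal
    (ae_of_all _ fun s => ENNReal.ofReal_lt_top)]
  simp only [ENNReal.toReal_ofReal (hX0 _), smul_eq_mul, mul_comm]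

theorem IsUnitField.measurable_partialField_left {E : Type*} [MeasurableSpace E] {P : Measure Ω}
    {γ : ℕ → Ω → E} {ψ : ℕ → ℝ → E → ℝ} (h : IsUnitField P γ ψ) (n : ℕ) (ω : Ω) :
    Measurable fun s => partialField γ ψ n s ω :=
  (h.measurable_partialField n).comp (measurable_prodMk_right (y := ω))

theorem IsUnitField.IsLimitField.measurable_left {E : Type*} [MeasurableSpace E] {P : Measure Ω}
    {γ : ℕ → Ω → E} {ψ : ℕ → ℝ → E → ℝ} {X : ℝ → Ω → ℝ} (h : IsUnitField.IsLimitField P γ ψ X)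
    (ω : Ω) : Measurable fun s => X s ω :=
  h.meas.comp (measurable_prodMk_right (y := ω))

theorem ae_setIntegral_eulerMeasure_top [IsProbabilityMeasure P] (hα : IsSteinhaus P α)
    (hf : SummabilityCondition f) (y : ℝ) {I : Set ℝ} (hI : MeasurableSet I) (h : ℝ → ℝ) :
    (fun ω => ∫ s in I, h s ∂(eulerMeasure P f α y ⊤ ω)) =ᵐ[P]
      partialMass (circleValue α) (eulerField P (circleValue α) f 0)
        (Nat.count Nat.Prime (⌊y⌋₊ + 1)) (I.indicator h) := by
  have hfield := hf.isUnitField_eulerField hα.iIndepFun_circleValue hα.isCentered_circleValue 0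
  filter_upwards [ae_eulerMeasure_top hα hf y] with ω hω
  have hm := hfield.measurable_partialField_left (Nat.count Nat.Prime (⌊y⌋₊ + 1)) ω
  have h0 := fun s => hfield.partialField_nonneg (Nat.count Nat.Prime (⌊y⌋₊ + 1)) s ω
  rw [hω]
  exact setIntegral_withDensity_ofReal hm h0 hI h

theorem ae_setIntegral_eulerMeasure_coe [IsProbabilityMeasure P] (hα : IsSteinhaus P α) {θ : ℝ}
    (hf : SummabilityCondition f) (hd : HasLogDensity θ fun j => if j.Prime then ‖f j‖ ^ 2 else 0)
    {t : ℝ} (ht : 1 < t) {I : Set ℝ} (hI : MeasurableSet I) (h : ℝ → ℝ) :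
    (fun ω => ∫ s in I, h s ∂(eulerMeasure P f α ⊤ t ω)) =ᵐ[P]
      fun ω => ∫ s, I.indicator h s *
        eulerLimitField P (circleValue α) f (1 / Real.log t).toNNReal s ω := by
  have hτ : 0 < (1 / Real.log t).toNNReal :=
    Real.toNNReal_pos.2 (one_div_pos.2 (Real.log_pos ht))
  have hX := hf.isLimitField hα.iIndepFun_circleValue hα.isCentered_circleValue hd hτ
  filter_upwards [ae_eulerMeasure_coe (f := f) hα ht] with ω hω
  have hm := hX.measurable_left ω
  have h0 : ∀ s, 0 ≤ eulerLimitField P (circleValue α) f (1 / Real.log t).toNNReal s ω := fun s =>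
    div_nonneg (by positivity) (integral_nonneg fun _ => by positivity)
  rw [hω]
  exact setIntegral_withDensity_ofReal hm h0 hI h

theorem isTest_indicator_of_continuousOn {I : Set ℝ} (hI : MeasurableSet I)
    (hb : Bornology.IsBounded I) {h : ℝ → ℝ} (hc : ContinuousOn h I)
    (hbd : ∃ C, ∀ s ∈ I, |h s| ≤ C) : IsTest (I.indicator h) where
  meas := by
    classical
    rw [← Set.piecewise_eq_indicator]
    exact hc.measurable_piecewise continuousOn_const hI
  bdd := by
    obtain ⟨C, hC⟩ := hbd
    refine ⟨|C|, fun s => ?_⟩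
    by_cases hs : s ∈ I
    · rw [Set.indicator_of_mem hs]
      exact (hC s hs).trans (le_abs_self C)
    · rw [Set.indicator_of_notMem hs, abs_zero]
      exact abs_nonneg C
  supp := by
    obtain ⟨M, hM⟩ := hb.exists_norm_le
    refine ⟨M, fun s hs => Set.indicator_of_notMem (fun hsI => ?_) _⟩
    exact absurd (hM s hsI) (not_le.2 hs)

/-- The approach is through positive τ, where the infinite products are known to converge. -/
theorem tendsto_one_div_log :
    Tendsto (fun t => (1 / Real.log t).toNNReal) atTop (𝓝[>] 0) := by
  refine tendsto_nhdsWithin_iff.2 ⟨?_, ?_⟩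
  · have h1 : Tendsto (fun t => (Real.log t)⁻¹) atTop (𝓝 0) :=
      tendsto_inv_atTop_zero.comp Real.tendsto_log_atTop
    have h2 := (continuous_real_toNNReal.tendsto 0).comp h1
    rw [Real.toNNReal_zero] at h2
    exact h2.congr fun t => by simp
  · filter_upwards [eventually_gt_atTop 1] with t ht
    exact Real.toNNReal_pos.2 (one_div_pos.2 (Real.log_pos ht))

end RandomEuler

end

theorem theorem2p3 {Ω : Type*} [MeasurableSpace Ω] (P : Measure Ω) [IsProbabilityMeasure P]
    (α : ℕ → Ω → ℂ) (hα : RandomEuler.IsSteinhaus P α)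
    (θ : ℝ) (hθ : θ ∈ Set.Ioo (0 : ℝ) (1 / 2))
    (f : ℕ → ℂ) (hf : RandomEuler.IsMultiplicative f)
    (hfP : RandomEuler.ClassP (θ : ℂ) (fun n => ((‖f n‖ ^ 2 : ℝ) : ℂ)))
    (hfs : RandomEuler.SummabilityCondition f) :
    -- the infinite product defining `m_{∞,t}` converges almost surely at each point
    (∀ t : ℝ, 1 < t → ∀ s : ℝ, ∀ᵐ ω ∂P,
      Tendsto (fun y : ℝ => RandomEuler.eulerProduct f α (y : WithTop ℝ)
          ((RandomEuler.sigma (t : WithTop ℝ) : ℂ) + s * Complex.I) ω) atTop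
        (𝓝 (RandomEuler.eulerProduct f α ⊤
          ((RandomEuler.sigma (t : WithTop ℝ) : ℂ) + s * Complex.I) ω))) ∧
    ∃ m : Ω → Measure ℝ,
      -- `m` is a random Radon measure, almost surely nonzero
      Measurable m ∧ (∀ ω, IsLocallyFiniteMeasure (m ω)) ∧ (∀ᵐ ω ∂P, m ω ≠ 0) ∧
      (∀ I : Set ℝ, I.OrdConnected → Bornology.IsBounded I →
        ∀ h : ℝ → ℝ, ContinuousOn h I → (∃ C : ℝ, ∀ s ∈ I, |h s| ≤ C) →
          -- the random variables in question are in `L^2`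
          (∀ y : ℝ, MemLp (fun ω => ∫ s in I, h s ∂(RandomEuler.eulerMeasure P f α y ⊤ ω)) 2 P) ∧
          (∀ t : ℝ, 1 < t →
            MemLp (fun ω => ∫ s in I, h s ∂(RandomEuler.eulerMeasure P f α ⊤ t ω)) 2 P) ∧
          MemLp (fun ω => ∫ s in I, h s ∂(m ω)) 2 P ∧
          -- (i), in `L^2` and in probability
          Tendsto (fun y : ℝ => eLpNorm (fun ω =>
              (∫ s in I, h s ∂(RandomEuler.eulerMeasure P f α y ⊤ ω))
                - ∫ s in I, h s ∂(m ω)) 2 P) atTop (𝓝 0) ∧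
          TendstoInMeasure P
            (fun (y : ℝ) ω => ∫ s in I, h s ∂(RandomEuler.eulerMeasure P f α y ⊤ ω)) atTop
            (fun ω => ∫ s in I, h s ∂(m ω)) ∧
          -- (ii), in `L^2` and in probability
          Tendsto (fun t : ℝ => eLpNorm (fun ω =>
              (∫ s in I, h s ∂(RandomEuler.eulerMeasure P f α ⊤ t ω))
                - ∫ s in I, h s ∂(m ω)) 2 P) atTop (𝓝 0) ∧
          TendstoInMeasure P
            (fun (t : ℝ) ω => ∫ s in I, h s ∂(RandomEuler.eulerMeasure P f α ⊤ t ω)) atTop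
            (fun ω => ∫ s in I, h s ∂(m ω))) ∧
      -- almost surely, the support of `m` is all of `ℝ`
      (∀ᵐ ω ∂P, (m ω).support = Set.univ) := by
  have hd := hfP.hasLogDensity
  have hind := hα.iIndepFun_circleValue
  have hγ := hα.isCentered_circleValue
  have hcorr := RandomEuler.hasCorrBound_eulerField hind hγ hfs hd hθ.1.le hθ.2
  have hcount : Tendsto (fun y : ℝ => Nat.count Nat.Prime (⌊y⌋₊ + 1)) atTop atTop :=
    RandomEuler.tendsto_count_prime.comp tendsto_nat_floor_atTop
  refine ⟨fun t ht s => ?_, ?_⟩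
  · have hτ : 0 < (1 / Real.log t).toNNReal :=
      Real.toNNReal_pos.2 (one_div_pos.2 (Real.log_pos ht))
    filter_upwards [hα.ae_coe_circleValue, hfs.ae_exists_tendsto hind hγ hd hτ s] with ω hω hlim
    rw [RandomEuler.eulerProduct_top_eq hω (RandomEuler.sigma_coe_eq ht)]
    simp only [RandomEuler.eulerProduct_coe_eq hω (RandomEuler.sigma_coe_eq ht)]
    exact hlim.comp hcount
  -- The limiting measure is built on the critical line, from finite products only.
  obtain ⟨m, hm, hmf, hmt, hms⟩ := hcorr.exists_limitMeasure 0
    (hfs.ae_eulerField_ne_zero hα.measurable_circleValue hα.map_circleValue 0)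
  refine ⟨m, hm, hmf, hms.mono fun ω hω h0 => ?_, fun I hI hIb h hc hbd => ?_, hms⟩
  · rw [h0, Measure.support_zero] at hω
    exact Set.empty_ne_univ hω
  have hIm := hI.measurableSet
  have hg := RandomEuler.isTest_indicator_of_continuousOn hIm hIb hc hbd
  obtain ⟨hmL, hmlim⟩ := hmt _ hg
  have hmI : ∀ ω, ∫ s, I.indicator h s ∂(m ω) = ∫ s in I, h s ∂(m ω) := fun ω =>
    integral_indicator hIm
  simp only [hmI] at hmL hmlim
  have hfield := hfs.isUnitField_eulerField hind hγ
  have hy := fun y => RandomEuler.ae_setIntegral_eulerMeasure_top hα hfs y hIm h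
  have hX := fun τ (hτ : 0 < τ) => hfs.isLimitField hind hγ hd (τ := τ) hτ
  have ht := fun t (ht : 1 < t) =>
    RandomEuler.ae_setIntegral_eulerMeasure_coe hα hfs hd ht hIm h
  have hyL : ∀ y : ℝ, MemLp (fun ω =>
      ∫ s in I, h s ∂(RandomEuler.eulerMeasure P f α y ⊤ ω)) 2 P := fun y =>
    ((hfield 0).memLp_partialMass _ hg.integrable 2).ae_eq (hy y).symm
  have htL : ∀ t : ℝ, 1 < t → MemLp (fun ω =>
      ∫ s in I, h s ∂(RandomEuler.eulerMeasure P f α ⊤ t ω)) 2 P := fun t ht1 =>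
    MemLp.ae_eq (ht t ht1).symm ((hX _ (Real.toNNReal_pos.2
      (one_div_pos.2 (Real.log_pos ht1)))).tendsto (hfield _) hg).1
  have h1 : Tendsto (fun y : ℝ => eLpNorm (fun ω =>
      (∫ s in I, h s ∂(RandomEuler.eulerMeasure P f α y ⊤ ω))
        - ∫ s in I, h s ∂(m ω)) 2 P) atTop (𝓝 0) :=
    (hmlim.comp hcount).congr fun y =>
      eLpNorm_congr_ae ((hy y).symm.sub (EventuallyEq.refl _ fun ω => ∫ s in I, h s ∂(m ω)))
  have h2 : Tendsto (fun t : ℝ => eLpNorm (fun ω =>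
      (∫ s in I, h s ∂(RandomEuler.eulerMeasure P f α ⊤ t ω))
        - ∫ s in I, h s ∂(m ω)) 2 P) atTop (𝓝 0) := by
    -- The limit fields are used only for τ > 0; at τ = 0 only the partial products enter, and these
    -- are continuous in τ up to the end point.
    have hlim := hcorr.tendsto_limitField (l := 𝓝[>] 0) (τ₀ := 0)
      (fun k => ⟨_, fun τ s z => hfs.eulerField_le hγ τ k s z⟩)
      (fun k s z => by
        have hcont : Continuous fun τ : NNReal =>
            RandomEuler.eulerField P (RandomEuler.circleValue α) f τ k s z :=
          (hfs.continuous_eulerField hγ k).comp (f := fun τ : NNReal => (τ, s, z)) (by fun_prop)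
        exact (hcont.tendsto 0).mono_left nhdsWithin_le_nhds)
      (eventually_mem_nhdsWithin.mono fun τ hτ => hX τ hτ) hg hmL hmlim
    refine (hlim.comp RandomEuler.tendsto_one_div_log).congr' ?_
    filter_upwards [eventually_gt_atTop 1] with t ht1
    exact eLpNorm_congr_ae ((ht t ht1).symm.sub
      (EventuallyEq.refl _ fun ω => ∫ s in I, h s ∂(m ω)))
  refine ⟨hyL, htL, hmL, h1, tendstoInMeasure_of_tendsto_eLpNorm two_ne_zero (fun y => (hyL y).1)
    hmL.1 h1, h2, ?_⟩
  classical
  -- Measurability in ω is known only for t > 1, so the family is replaced by 0 for t ≤ 1, which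
  -- does not affect the limit t → ∞.
  refine TendstoInMeasure.congr' (f := fun (t : ℝ) ω => if 1 < t then
    ∫ s in I, h s ∂(RandomEuler.eulerMeasure P f α ⊤ t ω) else 0) ?_ (EventuallyEq.refl _ _)
    (tendstoInMeasure_of_tendsto_eLpNorm two_ne_zero (fun t => ?_) hmL.1 (h2.congr' ?_))
  · filter_upwards [eventually_gt_atTop 1] with t ht1
    simp [ht1]
  · by_cases ht1 : 1 < t
    · simpa [ht1] using (htL t ht1).1
    · simpa [ht1] using aestronglyMeasurable_const
  · filter_upwards [eventually_gt_atTop 1] with t ht1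
    refine congrArg (fun F => eLpNorm F 2 P) ?_
    ext ω
    simp [ht1]
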